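/- Let $M^m$ be a smooth $m$-manifold and let $(N^{m+1}(c),g)$ be a smooth Riemannian $(m+1)$-manifold of constant sectional curvature $c$ (for instance a space form, i.e. a complete one), with Levi-Civita connection $\nabla$; its pull-back along a map into $N^{m+1}(c)$ is also denoted by $\nabla$. Let $f\colon M^m\to N^{m+1}(c)$ be a co-orientable frontal with unit normal vector field $\nu$; that is, $f$ is a $C^\infty$-map and $\nu$ is a $C^\infty$ vector field along $f$, defined on all of $M^m$, with $g(\nu,\nu)=1$ and $g(df(X),\nu)=0$ for all tangent vectors $X$ of $M^m$. Put $$(\mathcal E_f)_p=\{w\in T_{f(p)}N : g(w,\nu_p)=0\},\qquad \phi_f(X)=df(X),\qquad \psi_f(X)=\nabla_X\nu ,$$ let $\langle\ ,\ \rangle$ be the restriction of $g$ to $\mathcal E_f$, and for a section $\xi$ of $\mathcal E_f$ let $D_X\xi$ be the orthogonal projection of $\nabla_X\xi$ to $\mathcal E_f$. Then $\mathcal E_f$ is a smooth subbundle of rank $m$ of $f^*TN$, $\psi_f$ takes values in $\mathcal E_f$, and $(M^m,\mathcal E_f,\langle\ ,\ \rangle,D,\phi_f,\psi_f)$ is a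 frontal bundle; that is, $D$ is a (smooth) metric connection on $(\mathcal E_f,\langle\ ,\ \rangle)$, the maps $\phi=\phi_f$ and $\psi=\psi_f$ are smooth bundle homomorphisms $TM^m\to\mathcal E_f$, and for all smooth vector fields $X,Y$ on $M^m$ $$D_X\phi(Y)-D_Y\phi(X)-\phi([X,Y])=0,\qquad D_X\psi(Y)-D_Y\psi(X)-\psi([X,Y])=0,$$ $$\langle\phi(X),\psi(Y)\rangle=\langle\phi(Y),\psi(X)\rangle .$$ If $N^{m+1}(c)$ is orientable, then the bundle $\mathcal E_f$ is orientable. Moreover the Gauss equation $$\langle R^D(X,Y)\xi,\zeta\rangle= c\det\begin{pmatrix}\langle\phi(Y),\xi\rangle&\langle\phi(Y),\zeta\rangle\\ \langle\phi(X),\xi\rangle&\langle\phi(X),\zeta\rangle\end{pmatrix} +\det\begin{pmatrix}\langle\psi(Y),\xi\rangle&\langle\psi(Y),\zeta\rangle\\ \langle\psi(X),\xi\rangle&\langle\psi(X),\zeta\rangle\end{pmatrix}$$ holds for all smooth vector fields $X,Y$ on $M^m$ and all smooth sections $\xi,\zeta$ of $\mathcal E_f$, where $R^D(X,Y)\xi=D_XD_Y\xi-D_YD_X\xi-D_{[X,Y]}\xi$.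 Furthermore, this frontal bundle is a front bundle, i.e. $\operatorname{Ker}\phi_p\cap\operatorname{Ker}\psi_p=\{0\}$ for every $p\in M^m$, if and only if $f$ is a front with respect to $\nu$, i.e. the map $\nu\colon M^m\to T_1N^{m+1}(c)$ into the unit tangent bundle is an immersion. If the set of points at which $df$ is injective is dense in $M^m$, this is also equivalent to $f$ being a front in the sense that every point of $M^m$ has a neighbourhood on which some smooth unit normal vector field of $f$ is an immersion into $T_1N^{m+1}(c)$. -/

import Mathlib

open Bundle Manifold
open scoped ContDiff

noncomputable section

/-! ### Vector bundles with an inner product and a connection -/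

section General

variable {m k : ℕ}
  {M : Type*} [TopologicalSpace M] [ChartedSpace (EuclideanSpace ℝ (Fin m)) M]
  [IsManifold (𝓡 m) ∞ M]
  {E : M → Type*} [TopologicalSpace (TotalSpace (EuclideanSpace ℝ (Fin k)) E)]
  [∀ x, NormedAddCommGroup (E x)] [∀ x, InnerProductSpace ℝ (E x)]
  [FiberBundle (EuclideanSpace ℝ (Fin k)) E] [VectorBundle ℝ (EuclideanSpace ℝ (Fin k)) E]

/-- A smooth vector field on the manifold `M`. -/
def IsSmoothVectorField (X : Π x : M, TangentSpace (𝓡 m) x) : Prop :=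
  ContMDiff (𝓡 m) (𝓡 m).tangent ∞ (fun x ↦ (⟨x, X x⟩ : TangentBundle (𝓡 m) M))

/-- `ξ` is a smooth section over the set `U` of the vector bundle `E` of rank `k`. -/
def IsSmoothSectionOn (m k : ℕ) {M : Type*} [TopologicalSpace M]
    [ChartedSpace (EuclideanSpace ℝ (Fin m)) M] {E : M → Type*}
    [TopologicalSpace (TotalSpace (EuclideanSpace ℝ (Fin k)) E)]
    [∀ x, NormedAddCommGroup (E x)] [∀ x, InnerProductSpace ℝ (E x)]
    [FiberBundle (EuclideanSpace ℝ (Fin k)) E] (ξ : Π x : M, E x) (U : Set M) : Prop :=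
  ContMDiffOn (𝓡 m) ((𝓡 m).prod 𝓘(ℝ, EuclideanSpace ℝ (Fin k))) ∞
    (fun x ↦ TotalSpace.mk' (EuclideanSpace ℝ (Fin k)) x (ξ x)) U

/-- A smooth bundle homomorphism `TM → E`. -/
def IsSmoothBundleHom (m k : ℕ) {M : Type*} [TopologicalSpace M]
    [ChartedSpace (EuclideanSpace ℝ (Fin m)) M] [IsManifold (𝓡 m) ∞ M]
    {E : M → Type*} [TopologicalSpace (TotalSpace (EuclideanSpace ℝ (Fin k)) E)]
    [∀ x, NormedAddCommGroup (E x)] [∀ x, InnerProductSpace ℝ (E x)]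
    [FiberBundle (EuclideanSpace ℝ (Fin k)) E] [VectorBundle ℝ (EuclideanSpace ℝ (Fin k)) E]
    (φ : Π x : M, TangentSpace (𝓡 m) x →L[ℝ] E x) : Prop :=
  ContMDiff (𝓡 m)
    ((𝓡 m).prod 𝓘(ℝ, EuclideanSpace ℝ (Fin m) →L[ℝ] EuclideanSpace ℝ (Fin k))) ∞
    (fun x ↦ TotalSpace.mk' (EuclideanSpace ℝ (Fin m) →L[ℝ] EuclideanSpace ℝ (Fin k)) x (φ x))

/-- The curvature
`R^D(X,Y)ξ = D_X D_Y ξ - D_Y D_X ξ - D_{[X,Y]} ξ` of a connection `D` on `E`.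
(Mathlib writes `D ξ x (X x)` for `(D_X ξ)(x)`.) -/
def connectionCurvature (D : CovariantDerivative (𝓡 m) (EuclideanSpace ℝ (Fin k)) E)
    (X Y : Π x : M, TangentSpace (𝓡 m) x) (ξ : Π x : M, E x) (x : M) : E x :=
  D (fun y ↦ D ξ y (Y y)) x (X x) - D (fun y ↦ D ξ y (X y)) x (Y x)
    - D ξ x (VectorField.mlieBracket (𝓡 m) X Y x)

/-- Orientability of a rank `k` vector bundle with inner product: there is a smooth section `μ` of
the determinant bundle of the dual bundle (an alternating `k`-form on each fibre, whose values on
smooth local sections are smooth) with `μ(e₁, …, e_k) = ±1` on every orthonormal frame. -/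
def IsOrientableBundle (m k : ℕ) {M : Type*} [TopologicalSpace M]
    [ChartedSpace (EuclideanSpace ℝ (Fin m)) M] (E : M → Type*)
    [TopologicalSpace (TotalSpace (EuclideanSpace ℝ (Fin k)) E)]
    [∀ x, NormedAddCommGroup (E x)] [∀ x, InnerProductSpace ℝ (E x)]
    [FiberBundle (EuclideanSpace ℝ (Fin k)) E] : Prop :=
  ∃ μ : Π x : M, (E x) [⋀^Fin k]→ₗ[ℝ] ℝ,
    (∀ (U : Set M) (s : Fin k → Π x : M, E x), IsOpen U →
      (∀ i, IsSmoothSectionOn m k (s i) U) →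
      ContMDiffOn (𝓡 m) 𝓘(ℝ, ℝ) ∞ (fun x ↦ μ x (fun i ↦ s i x)) U) ∧
    ∀ (x : M) (e : Fin k → E x), Orthonormal ℝ e → μ x e = 1 ∨ μ x e = -1

set_option synthInstance.maxHeartbeats 200000 in
/-- `∇` is the Levi-Civita connection of the Riemannian manifold `M`: the smooth, metric and
torsion-free connection on the tangent bundle. -/
structure IsLeviCivita [RiemannianBundle (fun x : M ↦ TangentSpace (𝓡 m) x)]
    [IsContMDiffRiemannianBundle (𝓡 m) ∞ (EuclideanSpace ℝ (Fin m))
      (fun x : M ↦ TangentSpace (𝓡 m) x)]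
    (nabla : CovariantDerivative (𝓡 m) (EuclideanSpace ℝ (Fin m))
      (fun x : M ↦ TangentSpace (𝓡 m) x)) : Prop where
  smooth : nabla.ContMDiffCovariantDerivative ∞
  metric : nabla.IsMetricCompatible
  torsionFree : nabla.torsion = 0

/-- The connection `∇` (meant to be the Levi-Civita connection) has constant sectional curvature
`c`: `⟨R(X,Y)Y, X⟩ = c (|X|²|Y|² - ⟨X,Y⟩²)`. -/
def HasConstantCurvature [RiemannianBundle (fun x : M ↦ TangentSpace (𝓡 m) x)]
    (nabla : CovariantDerivative (𝓡 m) (EuclideanSpace ℝ (Fin m))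
      (fun x : M ↦ TangentSpace (𝓡 m) x)) (c : ℝ) : Prop :=
  ∀ X Y : Π x : M, TangentSpace (𝓡 m) x, IsSmoothVectorField X → IsSmoothVectorField Y →
    ∀ x, inner ℝ (connectionCurvature nabla X Y Y x) (X x) =
      c * (inner ℝ (X x) (X x) * inner ℝ (Y x) (Y x) - inner ℝ (X x) (Y x) ^ 2)

end General

/-! ### Coherent tangent bundles, frontal bundles and front bundles -/

section FrontalBundles

variable {m : ℕ}
  {M : Type*} [TopologicalSpace M] [ChartedSpace (EuclideanSpace ℝ (Fin m)) M]
  [IsManifold (𝓡 m) ∞ M]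
  {E : M → Type*} [TopologicalSpace (TotalSpace (EuclideanSpace ℝ (Fin m)) E)]
  [∀ x, NormedAddCommGroup (E x)] [∀ x, InnerProductSpace ℝ (E x)]
  [FiberBundle (EuclideanSpace ℝ (Fin m)) E] [VectorBundle ℝ (EuclideanSpace ℝ (Fin m)) E]
  [ContMDiffVectorBundle ∞ (EuclideanSpace ℝ (Fin m)) E (𝓡 m)]
  [IsContMDiffRiemannianBundle (𝓡 m) ∞ (EuclideanSpace ℝ (Fin m)) E]

/-- The smooth vector bundle `E` over `M^m`, of rank `m` and with smooth inner product, is with `D`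
and `φ` a coherent tangent bundle: `D` is a smooth metric connection, `φ : TM → E` is a smooth
bundle homomorphism, and `D_X φ(Y) - D_Y φ(X) - φ([X,Y]) = 0`. -/
structure IsCoherentTangentBundle
    (D : CovariantDerivative (𝓡 m) (EuclideanSpace ℝ (Fin m)) E)
    (φ : Π x : M, TangentSpace (𝓡 m) x →L[ℝ] E x) : Prop where
  smooth_connection : D.ContMDiffCovariantDerivative ∞
  metric : D.IsMetricCompatible
  smooth_hom : IsSmoothBundleHom m m φ
  codazzi : ∀ X Y : Π x : M, TangentSpace (𝓡 m) x,
    IsSmoothVectorField X → IsSmoothVectorField Y → ∀ x,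
      D (fun y ↦ φ y (Y y)) x (X x) - D (fun y ↦ φ y (X y)) x (Y x)
        - φ x (VectorField.mlieBracket (𝓡 m) X Y x) = 0

/-- A frontal bundle with first homomorphism `φ` and second homomorphism `ψ`. (Orientability of
`E` is the separate predicate `IsOrientableBundle`.) -/
structure IsFrontalBundle
    (D : CovariantDerivative (𝓡 m) (EuclideanSpace ℝ (Fin m)) E)
    (φ ψ : Π x : M, TangentSpace (𝓡 m) x →L[ℝ] E x) : Prop where
  coherent_fst : IsCoherentTangentBundle D φ
  coherent_snd : IsCoherentTangentBundle D ψ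
  compatible : ∀ (x : M) (v w : TangentSpace (𝓡 m) x),
    inner ℝ (φ x v) (ψ x w) = inner ℝ (φ x w) (ψ x v)

/-- A front bundle: a frontal bundle with `Ker φ_p ∩ Ker ψ_p = {0}` at every point. -/
structure IsFrontBundle
    (D : CovariantDerivative (𝓡 m) (EuclideanSpace ℝ (Fin m)) E)
    (φ ψ : Π x : M, TangentSpace (𝓡 m) x →L[ℝ] E x) : Prop extends
    IsFrontalBundle D φ ψ where
  ker_inter : ∀ x : M, LinearMap.ker (φ x).toLinearMap ⊓ LinearMap.ker (ψ x).toLinearMap = ⊥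

/-- The Gauss equation with constant `c`. -/
def GaussEquation (c : ℝ)
    (D : CovariantDerivative (𝓡 m) (EuclideanSpace ℝ (Fin m)) E)
    (φ ψ : Π x : M, TangentSpace (𝓡 m) x →L[ℝ] E x) : Prop :=
  ∀ (X Y : Π x : M, TangentSpace (𝓡 m) x) (ξ ζ : Π x : M, E x),
    IsSmoothVectorField X → IsSmoothVectorField Y →
    IsSmoothSectionOn m m ξ Set.univ → IsSmoothSectionOn m m ζ Set.univ → ∀ x,
      inner ℝ (connectionCurvature D X Y ξ x) (ζ x) =
        c * Matrix.det !![inner ℝ (φ x (Y x)) (ξ x), inner ℝ (φ x (Y x)) (ζ x);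
                          inner ℝ (φ x (X x)) (ξ x), inner ℝ (φ x (X x)) (ζ x)]
          + Matrix.det !![inner ℝ (ψ x (Y x)) (ξ x), inner ℝ (ψ x (Y x)) (ζ x);
                          inner ℝ (ψ x (X x)) (ξ x), inner ℝ (ψ x (X x)) (ζ x)]

end FrontalBundles

/-! ### Frontals and the data they induce -/

section Frontals

variable {m : ℕ}
  {M : Type*} [TopologicalSpace M] [ChartedSpace (EuclideanSpace ℝ (Fin m)) M]
  [IsManifold (𝓡 m) ∞ M]
  {N : Type*} [TopologicalSpace N] [ChartedSpace (EuclideanSpace ℝ (Fin (m + 1))) N]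
  [IsManifold (𝓡 (m + 1)) ∞ N]
  [RiemannianBundle (fun x : N ↦ TangentSpace (𝓡 (m + 1)) x)]

/-- A vector field `ξ` along `f`, as a map `M → TN`. -/
def alongMap (f : M → N) (ξ : Π p : M, TangentSpace (𝓡 (m + 1)) (f p)) (p : M) :
    TangentBundle (𝓡 (m + 1)) N :=
  ⟨f p, ξ p⟩

/-- `ν` is a smooth unit normal vector field along `f` on the set `U`. -/
structure IsUnitNormalOn (f : M → N) (ν : Π p : M, TangentSpace (𝓡 (m + 1)) (f p))
    (U : Set M) : Prop where
  smooth : ContMDiffOn (𝓡 m) (𝓡 (m + 1)).tangent ∞ (alongMap f ν) U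
  unit : ∀ p ∈ U, inner ℝ (ν p) (ν p) = (1 : ℝ)
  normal : ∀ p ∈ U, ∀ v : TangentSpace (𝓡 m) p,
    inner ℝ (mfderiv (𝓡 m) (𝓡 (m + 1)) f p v : TangentSpace (𝓡 (m + 1)) (f p)) (ν p) = (0 : ℝ)

/-- The unit vector field `ν` along `f` is an immersion on `U`. As the unit tangent bundle is an
embedded submanifold of `TN`, a map into it is an immersion if and only if it is one as a map into
`TN`. -/
def IsImmersiveOn (f : M → N) (ν : Π p : M, TangentSpace (𝓡 (m + 1)) (f p)) (U : Set M) : Prop :=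
  ∀ p ∈ U, Function.Injective (mfderiv (𝓡 m) (𝓡 (m + 1)).tangent (alongMap f ν) p)

/-- `f` is a front: near each point some smooth unit normal vector field of `f` is an immersion
into the unit tangent bundle. -/
def IsFront (m : ℕ) {M : Type*} [TopologicalSpace M]
    [ChartedSpace (EuclideanSpace ℝ (Fin m)) M]
    {N : Type*} [TopologicalSpace N] [ChartedSpace (EuclideanSpace ℝ (Fin (m + 1))) N]
    [IsManifold (𝓡 (m + 1)) ∞ N] [RiemannianBundle (fun x : N ↦ TangentSpace (𝓡 (m + 1)) x)]
    (f : M → N) : Prop :=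
  ContMDiff (𝓡 m) (𝓡 (m + 1)) ∞ f ∧
    ∀ p : M, ∃ U : Set M, IsOpen U ∧ p ∈ U ∧
      ∃ ν : Π p : M, TangentSpace (𝓡 (m + 1)) (f p), IsUnitNormalOn f ν U ∧ IsImmersiveOn f ν U

/-- The fibre at `p` of `E_f`: the vectors of `T_{f(p)}N` perpendicular to `ν(p)`, with the inner
product induced from `N`. -/
abbrev NormalPerp (f : M → N) (ν : Π p : M, TangentSpace (𝓡 (m + 1)) (f p)) (p : M) : Type :=
  ↥((Submodule.span ℝ {ν p})ᗮ)

/-- Orthogonal projection (the tangential part) `T_{f(p)}N → (E_f)_p`. -/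
def tangentialPart (f : M → N) (ν : Π p : M, TangentSpace (𝓡 (m + 1)) (f p)) (p : M) :
    TangentSpace (𝓡 (m + 1)) (f p) →L[ℝ] NormalPerp f ν p :=
  ((Submodule.span ℝ {ν p})ᗮ).orthogonalProjectionOnto

/-- The pull-back along `f` of a connection `∇` on `TN`: the covariant derivative `v ↦ ∇_v ξ` at
`p` of a vector field `ξ` along `f`. In the local trivialization `t` of `TN` around `f p`, with
frame `e_i` and `ξ = ∑ ξⁱ e_i`, it is `∑ dξⁱ(v) e_i + ∑ ξⁱ(p) ∇_{df(v)} e_i`; the first sum is the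
first term below, and `FiberBundle.extend` is the section of `TN` with the constant coefficients
`ξⁱ(p)` in the frame `e_i`. -/
def pullbackDerivative
    (nabla : CovariantDerivative (𝓡 (m + 1)) (EuclideanSpace ℝ (Fin (m + 1)))
      (fun x : N ↦ TangentSpace (𝓡 (m + 1)) x))
    (f : M → N) (ξ : Π p : M, TangentSpace (𝓡 (m + 1)) (f p)) (p : M) :
    TangentSpace (𝓡 m) p →L[ℝ] TangentSpace (𝓡 (m + 1)) (f p) :=
  letI t := trivializationAt (EuclideanSpace ℝ (Fin (m + 1)))
    (fun x : N ↦ TangentSpace (𝓡 (m + 1)) x) (f p)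
  letI dξ : TangentSpace (𝓡 m) p →L[ℝ] EuclideanSpace ℝ (Fin (m + 1)) :=
    mfderiv (𝓡 m) 𝓘(ℝ, EuclideanSpace ℝ (Fin (m + 1))) (fun q ↦ (t (alongMap f ξ q)).2) p
  (t.symmL ℝ (f p)).comp dξ
    + (nabla (FiberBundle.extend (EuclideanSpace ℝ (Fin (m + 1))) (ξ p)) (f p)).comp
        (mfderiv (𝓡 m) (𝓡 (m + 1)) f p)

/-- The connection on `E_f`: the tangential part of `∇`. -/
def inducedDerivative
    (nabla : CovariantDerivative (𝓡 (m + 1)) (EuclideanSpace ℝ (Fin (m + 1)))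
      (fun x : N ↦ TangentSpace (𝓡 (m + 1)) x))
    (f : M → N) (ν : Π p : M, TangentSpace (𝓡 (m + 1)) (f p))
    (ξ : Π p : M, NormalPerp f ν p) (p : M) :
    TangentSpace (𝓡 m) p →L[ℝ] NormalPerp f ν p :=
  (tangentialPart f ν p).comp (pullbackDerivative nabla f (fun q ↦ (ξ q : TangentSpace (𝓡 (m + 1)) (f q))) p)

/-- A vector bundle structure on `E_f` is that of a subbundle of `f^*TN`: its smooth
local sections are the smooth vector fields along `f` that are perpendicular to `ν`. This determines
the smooth structure of `E_f`. -/
def IsSubbundleStructure (f : M → N) (ν : Π p : M, TangentSpace (𝓡 (m + 1)) (f p))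
    [TopologicalSpace (TotalSpace (EuclideanSpace ℝ (Fin m)) (NormalPerp f ν))]
    [FiberBundle (EuclideanSpace ℝ (Fin m)) (NormalPerp f ν)] : Prop :=
  ∀ (U : Set M) (ξ : Π p : M, NormalPerp f ν p), IsOpen U →
    (IsSmoothSectionOn m m ξ U ↔
      ContMDiffOn (𝓡 m) (𝓡 (m + 1)).tangent ∞ 
        (alongMap f (fun p ↦ (ξ p : TangentSpace (𝓡 (m + 1)) (f p)))) U)

end Frontals

end

/-!
The pull-back of `∇` along `f` sends a section `ξ` of `f^*TN` to the covariant derivative of `ξ` in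
a trivialization, corrected by the connection form of `∇` evaluated on `df`. Every section along
`f` is locally a combination, with functions on `M` as coefficients, of sections of `TN` composed
with `f`. By the Leibniz rule, the metric, torsion and curvature identities of `∇` therefore pull
back to `M`; constant sectional curvature determines the curvature tensor of `∇` by polarization.

Locally `ν^⊥` has an orthonormal frame, obtained by projecting a frame of `TN` and applying the
Gram-Schmidt process, and the coordinates in such frames make it a smooth subbundle of `f^*TN`. The
projection of `∇` to it is a metric connection `D`. Vanishing torsion is the Codazzi equation of
`φ = df`, the curvature of `N` applied to `ν` gives that of `ψ = ∇ν`, and comparing second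
derivatives of `∇` and `D` gives the Gauss equation.

The derivative of `ν : M → TN` kills `v` exactly when `df(v) = 0` and `∇_v ν = 0`, which is the
criterion for a front bundle. Where `df` is injective, two unit normals agree up to sign; when such
points are dense, any local unit normal is therefore locally `±ν`.
-/

noncomputable section

open Filter VectorField
open scoped Topology

section Functions

variable {E : Type*} [NormedAddCommGroup E] [NormedSpace ℝ E]
  {H : Type*} [TopologicalSpace H] {I : ModelWithCorners ℝ E H}
  {M : Type*} [TopologicalSpace M] [ChartedSpace H M]
  {E' : Type*} [NormedAddCommGroup E'] [NormedSpace ℝ E']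
  {H' : Type*} [TopologicalSpace H'] {J : ModelWithCorners ℝ E' H'}
  {N : Type*} [TopologicalSpace N] [ChartedSpace H' N]
  {G : Type*} [NormedAddCommGroup G] [NormedSpace ℝ G]
  {f : M → N} {h : M → ℝ} {X Y V W Z : Π q : M, TangentSpace I q} {p : M}

theorem eventuallyEq_mvfderiv_eq {a b : M → G} (hab : a =ᶠ[𝓝 p] b) :
    mvfderiv I a p = mvfderiv I b p := by
  ext v
  change mfderiv I 𝓘(ℝ, G) a p v = mfderiv I 𝓘(ℝ, G) b p v
  rw [hab.mfderiv_eq]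
  rfl

variable [IsManifold I ∞ M]

theorem eventually_mdifferentiableAt [IsManifold J ∞ N] (hf : ContMDiffAt I J ∞ f p) :
    ∀ᶠ q in 𝓝 p, MDifferentiableAt I J f q := by
  have : IsManifold I 1 M := .of_le (n := ∞) (by norm_cast)
  have : IsManifold J 1 N := .of_le (n := ∞) (by norm_cast)
  filter_upwards [(contMDiffAt_iff_contMDiffAt_nhds (n := 1) (by simp)).1
    (hf.of_le (by norm_cast))] with q hq
  exact hq.mdifferentiableAt one_ne_zero

theorem contMDiffAt_mfderiv_apply [IsManifold J ∞ N] (hf : ContMDiffAt I J ∞ f p)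
    (hX : CMDiffAt ∞ (T% X) p) :
    ContMDiffAt I J.tangent ∞
      (fun q ↦ (⟨f q, mfderiv I J f q (X q)⟩ : TangentBundle J N)) p :=
  ContMDiffAt.clm_apply_of_inCoordinates (b₁ := fun q ↦ q) (b₂ := f)
    (E₁ := (TangentSpace I : M → Type _)) (E₂ := (TangentSpace J : N → Type _))
    (hf.mfderiv_const (m := ∞) le_rfl) hX hf

theorem contMDiffAt_mvfderiv_apply {a : M → G} (ha : CMDiffAt ∞ a p) (hX : CMDiffAt ∞ (T% X) p) :
    CMDiffAt ∞ (fun q ↦ d% a q (X q)) p :=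
  (contMDiff_snd_tangentBundle_modelSpace G 𝓘(ℝ, G)).contMDiffAt.comp p
    (contMDiffAt_mfderiv_apply ha hX)

theorem contMDiffAt_mlieBracket [CompleteSpace E] (hX : CMDiffAt ∞ (T% X) p)
    (hY : CMDiffAt ∞ (T% Y) p) : CMDiffAt ∞ (T% (mlieBracket I X Y)) p :=
  have : IsManifold I (∞ + 1) M := ‹IsManifold I ∞ M›
  have : IsManifold I (minSmoothness ℝ 3) M := .of_le (n := ∞) (by simp; norm_cast)
  ContMDiffAt.mlieBracket_vectorField (n := ⊤) (m := ⊤) hX hY (by simp)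

theorem mlieBracket_mlieBracket_smul [CompleteSpace E] (hh : CMDiffAt ∞ h p)
    (hW : CMDiffAt ∞ (T% W) p) (hZ : CMDiffAt ∞ (T% Z) p) :
    mlieBracket I V (mlieBracket I W (h • Z)) p =
      d% (fun q ↦ d% h q (W q)) p (V p) • Z p + d% h p (W p) • mlieBracket I V Z p
        + (d% h p (V p) • mlieBracket I W Z p
          + h p • mlieBracket I V (mlieBracket I W Z) p) := by
  have : IsManifold I (minSmoothness ℝ 2) M := .of_le (n := ∞) (by simp; norm_cast)
  have hinner : mlieBracket I W (h • Z) =ᶠ[𝓝 p]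
      (fun q ↦ d% h q (W q)) • Z + h • mlieBracket I W Z := by
    filter_upwards [eventually_mdifferentiableAt hh, eventually_mdifferentiableAt hZ] with q h1 h2
    exact mlieBracket_smul_right (V := W) h1 h2
  have hhp : MDiffAt h p := hh.mdifferentiableAt (by simp)
  have hWh : MDiffAt (fun q ↦ d% h q (W q)) p :=
    (contMDiffAt_mvfderiv_apply hh hW).mdifferentiableAt (by simp)
  have hZp : MDiffAt (T% Z) p := hZ.mdifferentiableAt (by simp)
  have hWZ : MDiffAt (T% (mlieBracket I W Z)) p :=
    (contMDiffAt_mlieBracket hW hZ).mdifferentiableAt (by simp)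
  rw [EventuallyEq.rfl.mlieBracket_vectorField_eq hinner,
    mlieBracket_add_right (hWh.smul_section hZp) (hhp.smul_section hWZ),
    mlieBracket_smul_right hWh hZp, mlieBracket_smul_right hhp hWZ]

-- Comparing the coefficients of `Z` in the Leibniz identity for `X`, `Y` and `h • Z`.
theorem mvfderiv_mlieBracket_smul [CompleteSpace E] (hh : CMDiffAt ∞ h p)
    (hX : CMDiffAt ∞ (T% X) p) (hY : CMDiffAt ∞ (T% Y) p) (hZ : CMDiffAt ∞ (T% Z) p) :
    d% h p (mlieBracket I X Y p) • Z p =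
      (d% (fun q ↦ d% h q (Y q)) p (X p) - d% (fun q ↦ d% h q (X q)) p (Y p)) • Z p := by
  have : IsManifold I (minSmoothness ℝ 3) M := .of_le (n := ∞) (by simp; norm_cast)
  have le2 {U : Π q : M, TangentSpace I q} (hU : CMDiffAt ∞ (T% U) p) :
      CMDiffAt (minSmoothness ℝ 2) (T% U) p := hU.of_le (by simp; norm_cast)
  have leibniz_smul := leibniz_identity_mlieBracket_apply (le2 hX) (le2 hY)
    (le2 (ContMDiffAt.smul_section hh hZ))
  have leibniz := leibniz_identity_mlieBracket_apply (le2 hX) (le2 hY) (le2 hZ)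
  have : IsManifold I (minSmoothness ℝ 2) M := .of_le (n := ∞) (by simp; norm_cast)
  rw [mlieBracket_mlieBracket_smul hh hY hZ, mlieBracket_mlieBracket_smul hh hX hZ,
    mlieBracket_smul_right (hh.mdifferentiableAt (by simp)) (hZ.mdifferentiableAt (by simp)),
    leibniz] at leibniz_smul
  rw [← sub_eq_zero, ← neg_eq_zero, ← sub_eq_zero.2 leibniz_smul]
  module

theorem mvfderiv_mlieBracket_real [CompleteSpace E] (hh : CMDiffAt ∞ h p)
    (hX : CMDiffAt ∞ (T% X) p) (hY : CMDiffAt ∞ (T% Y) p) :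
    d% h p (mlieBracket I X Y p) =
      d% (fun q ↦ d% h q (Y q)) p (X p) - d% (fun q ↦ d% h q (X q)) p (Y p) := by
  rcases subsingleton_or_nontrivial E with hE | hE
  · have : Subsingleton (TangentSpace I p) := hE
    simp [Subsingleton.elim (mlieBracket I X Y p) 0, Subsingleton.elim (X p) 0,
      Subsingleton.elim (Y p) 0]
  obtain ⟨z, hz⟩ : ∃ z : TangentSpace I p, z ≠ 0 := exists_ne (0 : E)
  have key := mvfderiv_mlieBracket_smul hh hX hY (FiberBundle.contMDiffAt_extend I E z)
  rw [FiberBundle.extend_apply_self] at key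
  exact smul_left_injective ℝ hz key

theorem mvfderiv_mlieBracket [CompleteSpace E] {a : M → G} (ha : CMDiffAt ∞ a p)
    (hX : CMDiffAt ∞ (T% X) p) (hY : CMDiffAt ∞ (T% Y) p) :
    d% a p (mlieBracket I X Y p) =
      d% (fun q ↦ d% a q (Y q)) p (X p) - d% (fun q ↦ d% a q (X q)) p (Y p) := by
  have hcomp (φ : G →L[ℝ] ℝ) {b : M → G} {q : M} (hb : MDiffAt b q) (v : TangentSpace I q) :
      d% (fun x ↦ φ (b x)) q v = φ (d% b q v) := by
    have := mfderiv_comp_apply q φ.mdifferentiableAt hb v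
    rw [φ.mfderiv_eq] at this
    exact this
  have hcomp' (φ : G →L[ℝ] ℝ) {U : Π q : M, TangentSpace I q} (hU : CMDiffAt ∞ (T% U) p)
      (v : TangentSpace I p) :
      d% (fun q ↦ d% (fun x ↦ φ (a x)) q (U q)) p v = φ (d% (fun q ↦ d% a q (U q)) p v) := by
    rw [← hcomp φ ((contMDiffAt_mvfderiv_apply ha hU).mdifferentiableAt (by simp))]
    refine DFunLike.congr_fun (eventuallyEq_mvfderiv_eq ?_) v
    filter_upwards [eventually_mdifferentiableAt ha] with q hq
    exact hcomp φ hq _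
  refine (SeparatingDual.eq_iff_forall_dual_eq (R := ℝ)).2 fun φ ↦ ?_
  have key := mvfderiv_mlieBracket_real (φ.contMDiff.contMDiffAt.comp p ha) hX hY
  rw [map_sub, ← hcomp' φ hY, ← hcomp' φ hX, ← hcomp φ (ha.mdifferentiableAt (by simp))]
  exact key

end Functions

theorem eventually_mem_baseSet {M N F : Type*} [TopologicalSpace M] [TopologicalSpace N]
    [TopologicalSpace F] {V : N → Type*} [TopologicalSpace (TotalSpace F V)]
    [∀ y, TopologicalSpace (V y)] [FiberBundle F V] {f : M → N} {p : M} (hf : ContinuousAt f p) :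
    ∀ᶠ q in 𝓝 p, f q ∈ (trivializationAt F V (f p)).baseSet :=
  hf.eventually ((trivializationAt F V (f p)).open_baseSet.mem_nhds
    (FiberBundle.mem_baseSet_trivializationAt' (f p)))

section Trivialization

variable {N : Type*} [TopologicalSpace N]
  {F : Type*} [NormedAddCommGroup F] [NormedSpace ℝ F] {V : N → Type*}
  [TopologicalSpace (TotalSpace F V)] [∀ y, AddCommGroup (V y)] [∀ y, Module ℝ (V y)]
  [∀ y, TopologicalSpace (V y)] [FiberBundle F V] [VectorBundle ℝ F V] {x y : N}

theorem trivializationAt_add (hy : y ∈ (trivializationAt F V x).baseSet) (v w : V y) :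
    (trivializationAt F V x ⟨y, v + w⟩).2 =
      (trivializationAt F V x ⟨y, v⟩).2 + (trivializationAt F V x ⟨y, w⟩).2 :=
  ((trivializationAt F V x).linear ℝ hy).map_add v w

theorem trivializationAt_smul (hy : y ∈ (trivializationAt F V x).baseSet) (a : ℝ) (v : V y) :
    (trivializationAt F V x ⟨y, a • v⟩).2 = a • (trivializationAt F V x ⟨y, v⟩).2 :=
  ((trivializationAt F V x).linear ℝ hy).map_smul a v

theorem symmL_trivializationAt_snd (hy : y ∈ (trivializationAt F V x).baseSet) (v : V y) :
    (trivializationAt F V x).symmL ℝ y (trivializationAt F V x ⟨y, v⟩).2 = v := by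
  rw [Trivialization.symmL_apply _ hy]
  exact Trivialization.symm_apply_apply_mk _ hy v

theorem eventually_extend_add (v w : V x) : ∀ᶠ y in 𝓝 x,
    FiberBundle.extend F (v + w) y = FiberBundle.extend F v y + FiberBundle.extend F w y := by
  filter_upwards [(trivializationAt F V x).open_baseSet.mem_nhds
    (FiberBundle.mem_baseSet_trivializationAt' x)] with y hy
  simp only [FiberBundle.extend, ← Trivialization.symmL_apply (R := ℝ) _ hy,
    trivializationAt_add (FiberBundle.mem_baseSet_trivializationAt' x), map_add]

theorem eventually_extend_smul (a : ℝ) (v : V x) : ∀ᶠ y in 𝓝 x,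
    FiberBundle.extend F (a • v) y = a • FiberBundle.extend F v y := by
  filter_upwards [(trivializationAt F V x).open_baseSet.mem_nhds
    (FiberBundle.mem_baseSet_trivializationAt' x)] with y hy
  simp only [FiberBundle.extend, ← Trivialization.symmL_apply (R := ℝ) _ hy,
    trivializationAt_smul (FiberBundle.mem_baseSet_trivializationAt' x), map_smul]

end Trivialization

theorem exists_contMDiff_section_eventuallyEq {E : Type*} [NormedAddCommGroup E]
    [NormedSpace ℝ E] [FiniteDimensional ℝ E] {H : Type*} [TopologicalSpace H]
    {I : ModelWithCorners ℝ E H} {M : Type*} [TopologicalSpace M] [T2Space M] [ChartedSpace H M]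
    [IsManifold I ∞ M] {F : Type*} [NormedAddCommGroup F] [NormedSpace ℝ F] {V : M → Type*}
    [TopologicalSpace (TotalSpace F V)] [∀ x, AddCommGroup (V x)] [∀ x, Module ℝ (V x)]
    [∀ x, TopologicalSpace (V x)] [FiberBundle F V] [VectorBundle ℝ F V]
    {σ : Π x, V x} {u : Set M} {p : M} (hu : u ∈ 𝓝 p) (hσ : CMDiff[u] ∞ (T% σ)) :
    ∃ τ : Π x, V x, CMDiff ∞ (T% τ) ∧ ∀ᶠ x in 𝓝 p, τ x = σ x := by
  obtain ⟨χ, -, hχ⟩ := (SmoothBumpFunction.nhds_basis_tsupport (I := I) p).mem_iff.1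
    (interior_mem_nhds.2 hu)
  refine ⟨(χ : M → ℝ) • σ, ContMDiffOn.smul_section_of_tsupport (u := interior u)
    χ.contMDiff.contMDiffOn isOpen_interior hχ (hσ.mono interior_subset), ?_⟩
  filter_upwards [χ.eventuallyEq_one] with x hx
  simp [hx]

section SectionsAlong

variable {E : Type*} [NormedAddCommGroup E] [NormedSpace ℝ E]
  {H : Type*} [TopologicalSpace H] (I : ModelWithCorners ℝ E H)
  {M : Type*} [TopologicalSpace M] [ChartedSpace H M]
  {E' : Type*} [NormedAddCommGroup E'] [NormedSpace ℝ E']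
  {H' : Type*} [TopologicalSpace H'] (J : ModelWithCorners ℝ E' H')
  {N : Type*} [TopologicalSpace N] [ChartedSpace H' N]
  (F : Type*) [NormedAddCommGroup F] [NormedSpace ℝ F] {V : N → Type*}
  [TopologicalSpace (TotalSpace F V)] [∀ y, TopologicalSpace (V y)] [FiberBundle F V]

/-- The section `ξ` of the bundle `V` along the map `f : M → N` is `C^k` at `p`. -/
abbrev ContMDiffAlongAt (k : ℕ∞ω) (f : M → N) (ξ : Π q, V (f q)) (p : M) : Prop :=
  ContMDiffAt I (J.prod 𝓘(ℝ, F)) k (fun q ↦ TotalSpace.mk' F (f q) (ξ q)) p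

/-- The section `ξ` of the bundle `V` along the map `f : M → N` is differentiable at `p`. -/
abbrev MDifferentiableAlongAt (f : M → N) (ξ : Π q, V (f q)) (p : M) : Prop :=
  MDifferentiableAt I (J.prod 𝓘(ℝ, F)) (fun q ↦ TotalSpace.mk' F (f q) (ξ q)) p

variable {I J F} {f : M → N} {ξ η : Π q, V (f q)} {g : M → ℝ} {p : M} {k : ℕ∞ω}

theorem ContMDiffAlongAt.map (hξ : ContMDiffAlongAt I J F k f ξ p) : ContMDiffAt I J k f p :=
  ((contMDiffAt_totalSpace ..).1 hξ).1

theorem ContMDiffAlongAt.trivializationAt_snd (hξ : ContMDiffAlongAt I J F k f ξ p) :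
    CMDiffAt k (fun q ↦ (trivializationAt F V (f p) ⟨f q, ξ q⟩).2) p :=
  ((contMDiffAt_totalSpace ..).1 hξ).2

theorem ContMDiffAlongAt.congr (hξ : ContMDiffAlongAt I J F k f ξ p)
    (h : ∀ᶠ q in 𝓝 p, η q = ξ q) : ContMDiffAlongAt I J F k f η p :=
  hξ.congr_of_eventuallyEq (h.mono fun q hq ↦ congrArg (TotalSpace.mk' F (f q)) hq)

theorem MDifferentiableAlongAt.map (hξ : MDifferentiableAlongAt I J F f ξ p) :
    MDifferentiableAt I J f p :=
  ((mdifferentiableAt_totalSpace ..).1 hξ).1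

theorem MDifferentiableAlongAt.trivializationAt_snd (hξ : MDifferentiableAlongAt I J F f ξ p) :
    MDiffAt (fun q ↦ (trivializationAt F V (f p) ⟨f q, ξ q⟩).2) p :=
  ((mdifferentiableAt_totalSpace ..).1 hξ).2

theorem MDifferentiableAlongAt.congr (hξ : MDifferentiableAlongAt I J F f ξ p)
    (h : ∀ᶠ q in 𝓝 p, η q = ξ q) : MDifferentiableAlongAt I J F f η p :=
  hξ.congr_of_eventuallyEq (h.mono fun q hq ↦ congrArg (TotalSpace.mk' F (f q)) hq)

theorem ContMDiffAlongAt.comp {Z : Π y, V y} (hZ : CMDiffAt k (T% Z) (f p))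
    (hf : ContMDiffAt I J k f p) : ContMDiffAlongAt I J F k f (fun q ↦ Z (f q)) p :=
  ContMDiffAt.comp p hZ hf

theorem MDifferentiableAlongAt.comp {Z : Π y, V y} (hZ : MDiffAt (T% Z) (f p))
    (hf : MDifferentiableAt I J f p) : MDifferentiableAlongAt I J F f (fun q ↦ Z (f q)) p :=
  MDifferentiableAt.comp p hZ hf

variable [∀ y, AddCommGroup (V y)] [∀ y, Module ℝ (V y)] [VectorBundle ℝ F V]

namespace ContMDiffAlongAt

theorem add (hξ : ContMDiffAlongAt I J F k f ξ p) (hη : ContMDiffAlongAt I J F k f η p) :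
    ContMDiffAlongAt I J F k f (fun q ↦ ξ q + η q) p := by
  refine (contMDiffAt_totalSpace ..).2 ⟨hξ.map,
    (hξ.trivializationAt_snd.add hη.trivializationAt_snd).congr_of_eventuallyEq ?_⟩
  filter_upwards [eventually_mem_baseSet (F := F) (V := V) hξ.map.continuousAt] with q hq
  exact trivializationAt_add hq _ _

theorem smul (hg : CMDiffAt k g p) (hξ : ContMDiffAlongAt I J F k f ξ p) :
    ContMDiffAlongAt I J F k f (fun q ↦ g q • ξ q) p := by
  refine (contMDiffAt_totalSpace ..).2 ⟨hξ.map,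
    (hg.smul hξ.trivializationAt_snd).congr_of_eventuallyEq ?_⟩
  filter_upwards [eventually_mem_baseSet (F := F) (V := V) hξ.map.continuousAt] with q hq
  exact trivializationAt_smul hq _ _

theorem sub (hξ : ContMDiffAlongAt I J F k f ξ p) (hη : ContMDiffAlongAt I J F k f η p) :
    ContMDiffAlongAt I J F k f (fun q ↦ ξ q - η q) p := by
  simpa [sub_eq_add_neg] using hξ.add (smul (g := fun _ ↦ -1) contMDiffAt_const hη)

theorem sum {ι : Type*} {s : Finset ι} {ζ : ι → Π q, V (f q)} (hf : ContMDiffAt I J k f p)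
    (hζ : ∀ i ∈ s, ContMDiffAlongAt I J F k f (ζ i) p) :
    ContMDiffAlongAt I J F k f (fun q ↦ ∑ i ∈ s, ζ i q) p := by
  classical
  induction s using Finset.induction_on with
  | empty => simpa using comp (contMDiff_zeroSection ℝ V _) hf
  | insert i s hi ih =>
    simp only [Finset.sum_insert hi]
    exact (hζ i (by simp)).add (ih fun j hj ↦ hζ j (by simp [hj]))

end ContMDiffAlongAt

namespace MDifferentiableAlongAt

theorem add (hξ : MDifferentiableAlongAt I J F f ξ p) (hη : MDifferentiableAlongAt I J F f η p) :
    MDifferentiableAlongAt I J F f (fun q ↦ ξ q + η q) p := by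
  refine (mdifferentiableAt_totalSpace ..).2 ⟨hξ.map,
    (hξ.trivializationAt_snd.add hη.trivializationAt_snd).congr_of_eventuallyEq ?_⟩
  filter_upwards [eventually_mem_baseSet (F := F) (V := V) hξ.map.continuousAt] with q hq
  exact trivializationAt_add hq _ _

theorem smul (hg : MDiffAt g p) (hξ : MDifferentiableAlongAt I J F f ξ p) :
    MDifferentiableAlongAt I J F f (fun q ↦ g q • ξ q) p := by
  refine (mdifferentiableAt_totalSpace ..).2 ⟨hξ.map,
    (hg.smul hξ.trivializationAt_snd).congr_of_eventuallyEq ?_⟩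
  filter_upwards [eventually_mem_baseSet (F := F) (V := V) hξ.map.continuousAt] with q hq
  exact trivializationAt_smul hq _ _

theorem sum {ι : Type*} {s : Finset ι} {ζ : ι → Π q, V (f q)} (hf : MDifferentiableAt I J f p)
    (hζ : ∀ i ∈ s, MDifferentiableAlongAt I J F f (ζ i) p) :
    MDifferentiableAlongAt I J F f (fun q ↦ ∑ i ∈ s, ζ i q) p := by
  classical
  induction s using Finset.induction_on with
  | empty => simpa using comp ((mdifferentiable_zeroSection ℝ V) _) hf
  | insert i s hi ih =>
    simp only [Finset.sum_insert hi]
    exact (hζ i (by simp)).add (ih fun j hj ↦ hζ j (by simp [hj]))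

end MDifferentiableAlongAt

theorem eventually_eq_sum_localFrame {ι : Type*} [Fintype ι] (b : Module.Basis ι ℝ F)
    (hf : ContinuousAt f p) : ∀ᶠ q in 𝓝 p,
      ξ q = ∑ i, b.repr (trivializationAt F V (f p) ⟨f q, ξ q⟩).2 i •
        (trivializationAt F V (f p)).localFrame b i (f q) := by
  filter_upwards [eventually_mem_baseSet (F := F) (V := V) hf] with q hq
  refine (((trivializationAt F V (f p)).basisAt b hq).sum_repr (ξ q)).symm.trans ?_
  simp [hq, Trivialization.basisAt]

/-- `R` is the regularity required of the coefficients. -/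
theorem induction_along [FiniteDimensional ℝ E'] [T2Space N] [IsManifold J ∞ N]
    [FiniteDimensional ℝ F] [ContMDiffVectorBundle ∞ F V J]
    {P : (Π q, V (f q)) → Prop} {R : (M → ℝ) → Prop} (hf : ContinuousAt f p)
    (coord : ∀ φ : F →L[ℝ] ℝ, R (fun q ↦ φ (trivializationAt F V (f p) ⟨f q, ξ q⟩).2))
    (congr : ∀ ξ η : Π q, V (f q), (∀ᶠ q in 𝓝 p, ξ q = η q) → P η → P ξ)
    (add : ∀ ξ η : Π q, V (f q), P ξ → P η → P (fun q ↦ ξ q + η q))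
    (smul_comp : ∀ (g : M → ℝ) (Z : Π y, V y), R g → CMDiff ∞ (T% Z) →
      P (fun q ↦ g q • Z (f q))) : P ξ := by
  classical
  set t := trivializationAt F V (f p)
  let b := Module.finBasis ℝ F
  refine congr _ _ (eventually_eq_sum_localFrame b hf) ?_
  choose Z hZ hZb using fun i ↦ exists_contMDiff_section_eventuallyEq
    (t.open_baseSet.mem_nhds (FiberBundle.mem_baseSet_trivializationAt' (f p)))
    (t.contMDiffOn_localFrame_baseSet (I := J) ∞ b i)
  suffices ∀ s : Finset (Fin (Module.finrank ℝ F)),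
      P (fun q ↦ ∑ i ∈ s, b.repr (t ⟨f q, ξ q⟩).2 i • Z i (f q)) by
    refine congr _ _ ?_ (this Finset.univ)
    filter_upwards [eventually_all.2 fun i ↦ hf.eventually (hZb i)] with q hq
    simp only [hq]
    rfl
  intro s
  induction s using Finset.induction_on with
  | empty => simpa using smul_comp _ 0 (coord 0) (contMDiff_zeroSection ℝ V)
  | insert i s hi ih =>
    simp only [Finset.sum_insert hi]
    exact add _ _
      (smul_comp _ _ (coord (LinearMap.toContinuousLinearMap (b.coord i))) (hZ i)) ih

end SectionsAlong

section CovariantDerivativeAlong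

variable {E : Type*} [NormedAddCommGroup E] [NormedSpace ℝ E]
  {H : Type*} [TopologicalSpace H] {I : ModelWithCorners ℝ E H}
  {M : Type*} [TopologicalSpace M] [ChartedSpace H M]
  {E' : Type*} [NormedAddCommGroup E'] [NormedSpace ℝ E']
  {H' : Type*} [TopologicalSpace H'] {J : ModelWithCorners ℝ E' H'}
  {N : Type*} [TopologicalSpace N] [ChartedSpace H' N]
  {F : Type*} [NormedAddCommGroup F] [NormedSpace ℝ F] {V : N → Type*}
  [TopologicalSpace (TotalSpace F V)] [∀ y, AddCommGroup (V y)] [∀ y, Module ℝ (V y)]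
  [∀ y, TopologicalSpace (V y)] [∀ y, IsTopologicalAddGroup (V y)] [∀ y, ContinuousSMul ℝ (V y)]
  [FiberBundle F V] [VectorBundle ℝ F V]
  (cov : CovariantDerivative J F V) {f : M → N} {ξ η : Π q, V (f q)} {g : M → ℝ} {p : M}

/-- The covariant derivative `v ↦ ∇_v ξ` of a section `ξ` along `f`, for the pull-back of a
connection `∇`. In the frame of a local trivialization, the first summand differentiates the
coefficients of `ξ` and the second one differentiates the frame in the direction of `df(v)`. -/
def covariantDerivativeAlong (f : M → N) (ξ : Π q, V (f q)) (p : M) :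
    TangentSpace I p →L[ℝ] V (f p) :=
  ((trivializationAt F V (f p)).symmL ℝ (f p)).comp
      (mvfderiv I (fun q ↦ (trivializationAt F V (f p) ⟨f q, ξ q⟩).2) p)
    + (cov (FiberBundle.extend F (ξ p)) (f p)).comp (mfderiv I J f p)

theorem covariantDerivativeAlong_congr (h : ∀ᶠ q in 𝓝 p, ξ q = η q) :
    covariantDerivativeAlong (I := I) cov f ξ p = covariantDerivativeAlong cov f η p := by
  have h' : (fun q ↦ (trivializationAt F V (f p) ⟨f q, ξ q⟩).2) =ᶠ[𝓝 p]
      fun q ↦ (trivializationAt F V (f p) ⟨f q, η q⟩).2 := by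
    filter_upwards [h] with q hq
    rw [hq]
  rw [covariantDerivativeAlong, covariantDerivativeAlong, eventuallyEq_mvfderiv_eq h',
    h.self_of_nhds]

theorem covariantDerivative_extend_add {y : N} (v w : V y) :
    cov (FiberBundle.extend F (v + w)) y =
      cov (FiberBundle.extend F v) y + cov (FiberBundle.extend F w) y := by
  have hv := FiberBundle.mdifferentiableAt_extend J F v
  have hw := FiberBundle.mdifferentiableAt_extend J F w
  rw [← cov.isCovariantDerivativeOnUniv.add hv hw]
  exact cov.isCovariantDerivativeOnUniv.congr_of_eventuallyEq
    (FiberBundle.mdifferentiableAt_extend J F _) (mdifferentiableAt_add_section hv hw)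
    univ_mem (eventually_extend_add v w)

theorem covariantDerivative_extend_smul {y : N} (a : ℝ) (v : V y) :
    cov (FiberBundle.extend F (a • v)) y = a • cov (FiberBundle.extend F v) y := by
  have hv := FiberBundle.mdifferentiableAt_extend J F v
  rw [← cov.isCovariantDerivativeOnUniv.smul_const a hv]
  exact cov.isCovariantDerivativeOnUniv.congr_of_eventuallyEq
    (FiberBundle.mdifferentiableAt_extend J F _) (mdifferentiableAt_const.smul_section hv)
    univ_mem (eventually_extend_smul a v)

theorem covariantDerivativeAlong_add (hξ : MDifferentiableAlongAt I J F f ξ p)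
    (hη : MDifferentiableAlongAt I J F f η p) :
    covariantDerivativeAlong (I := I) cov f (fun q ↦ ξ q + η q) p =
      covariantDerivativeAlong cov f ξ p + covariantDerivativeAlong cov f η p := by
  have h : (fun q ↦ (trivializationAt F V (f p) ⟨f q, ξ q + η q⟩).2) =ᶠ[𝓝 p]
      (fun q ↦ (trivializationAt F V (f p) ⟨f q, ξ q⟩).2) +
        fun q ↦ (trivializationAt F V (f p) ⟨f q, η q⟩).2 := by
    filter_upwards [eventually_mem_baseSet (F := F) (V := V) hξ.map.continuousAt] with q hq
    exact trivializationAt_add hq _ _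
  simp only [covariantDerivativeAlong]
  rw [eventuallyEq_mvfderiv_eq h, mvfderiv_add hξ.trivializationAt_snd hη.trivializationAt_snd,
    covariantDerivative_extend_add]
  ext v
  simp only [_root_.add_apply, ContinuousLinearMap.comp_apply, map_add]
  abel

theorem covariantDerivativeAlong_smul (hg : MDiffAt g p)
    (hξ : MDifferentiableAlongAt I J F f ξ p) :
    covariantDerivativeAlong (I := I) cov f (fun q ↦ g q • ξ q) p =
      g p • covariantDerivativeAlong cov f ξ p + (mvfderiv I g p).smulRight (ξ p) := by
  have h : (fun q ↦ (trivializationAt F V (f p) ⟨f q, g q • ξ q⟩).2) =ᶠ[𝓝 p]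
      g • (fun q ↦ (trivializationAt F V (f p) ⟨f q, ξ q⟩).2) := by
    filter_upwards [eventually_mem_baseSet (F := F) (V := V) hξ.map.continuousAt] with q hq
    exact trivializationAt_smul hq _ _
  simp only [covariantDerivativeAlong]
  rw [eventuallyEq_mvfderiv_eq h, mvfderiv_smul hg hξ.trivializationAt_snd,
    covariantDerivative_extend_smul]
  ext v
  simp only [_root_.add_apply, ContinuousLinearMap.comp_apply, map_add,
    _root_.smul_apply, map_smul, ContinuousLinearMap.smulRight_apply,
    symmL_trivializationAt_snd (FiberBundle.mem_baseSet_trivializationAt' (f p))]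
  module

variable [FiniteDimensional ℝ F] [ContMDiffVectorBundle 1 F V J]

theorem covariantDerivativeAlong_id {Z : Π y, V y} {y : N} (hZ : MDiffAt (T% Z) y) :
    covariantDerivativeAlong (I := J) cov (fun y ↦ y) Z y = cov Z y := by
  have tensorial : TensorialAt J F
      (fun Z : Π y, V y ↦ covariantDerivativeAlong (I := J) cov (fun y ↦ y) Z y - cov Z y) y :=
    { smul := fun {g σ} hg hσ ↦ by
        change covariantDerivativeAlong (I := J) cov (fun y ↦ y) (fun q ↦ g q • σ q) y - _ = _
        rw [covariantDerivativeAlong_smul (f := fun y ↦ y) cov hg hσ,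
          cov.isCovariantDerivativeOnUniv.leibniz hσ hg, smul_sub]
        abel
      add := fun {σ τ} hσ hτ ↦ by
        change covariantDerivativeAlong (I := J) cov (fun y ↦ y) (fun q ↦ σ q + τ q) y - _ = _
        rw [covariantDerivativeAlong_add (f := fun y ↦ y) cov hσ hτ,
          cov.isCovariantDerivativeOnUniv.add hσ hτ]
        abel }
  rw [← sub_eq_zero, tensorial.pointwise hZ (FiberBundle.mdifferentiableAt_extend J F (Z y))
    (FiberBundle.extend_apply_self F (Z y)).symm, sub_eq_zero]
  have h : (fun q ↦ (trivializationAt F V y ⟨q, FiberBundle.extend F (Z y) q⟩).2) =ᶠ[𝓝 y]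
      fun _ ↦ (trivializationAt F V y ⟨y, Z y⟩).2 := by
    filter_upwards [(trivializationAt F V y).open_baseSet.mem_nhds
      (FiberBundle.mem_baseSet_trivializationAt' y)] with q hq
    rw [FiberBundle.extend, Trivialization.apply_mk_symm _ hq]
  have hid : mfderiv J J (fun y : N ↦ y) y = .id ℝ (TangentSpace J y) := mfderiv_id
  rw [covariantDerivativeAlong, eventuallyEq_mvfderiv_eq h, mvfderiv_const, hid,
    FiberBundle.extend_apply_self]
  ext v
  simp

theorem covariantDerivativeAlong_comp {Z : Π y, V y} (hf : MDifferentiableAt I J f p)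
    (hZ : MDiffAt (T% Z) (f p)) :
    covariantDerivativeAlong (I := I) cov f (fun q ↦ Z (f q)) p =
      (cov Z (f p)).comp (mfderiv I J f p) := by
  rw [← covariantDerivativeAlong_id cov hZ]
  ext v
  have hid : mfderiv J J (fun y : N ↦ y) (f p) = .id ℝ (TangentSpace J (f p)) := mfderiv_id
  simp only [covariantDerivativeAlong, _root_.add_apply, ContinuousLinearMap.comp_apply, hid,
    ContinuousLinearMap.id_apply]
  congr 1
  exact congrArg _ (mfderiv_comp_apply p ((mdifferentiableAt_totalSpace ..).1 hZ).2 hf v)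

end CovariantDerivativeAlong

section Torsion

variable {E : Type*} [NormedAddCommGroup E] [NormedSpace ℝ E]
  {H : Type*} [TopologicalSpace H] {I : ModelWithCorners ℝ E H}
  {M : Type*} [TopologicalSpace M] [ChartedSpace H M] [IsManifold I ∞ M]
  {E' : Type*} [NormedAddCommGroup E'] [NormedSpace ℝ E']
  {H' : Type*} [TopologicalSpace H'] {J : ModelWithCorners ℝ E' H'}
  {N : Type*} [TopologicalSpace N] [ChartedSpace H' N] [IsManifold J ∞ N]
  {f : M → N} {X Y : Π q : M, TangentSpace I q} {p : M} {x y : N}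

theorem trivializationAt_tangentSpace_snd (hy : y ∈ (chartAt H' x).source)
    (v : TangentSpace J y) :
    (trivializationAt E' (TangentSpace J : N → Type _) x ⟨y, v⟩).2 =
      d% (extChartAt J x) y v := by
  have : IsManifold J 1 N := .of_le (n := ∞) (by norm_cast)
  have h := DFunLike.congr_fun (TangentBundle.continuousLinearMapAt_trivializationAt (I := J) hy) v
  rw [Trivialization.continuousLinearMapAt_apply, Trivialization.linearMapAt_apply,
    if_pos (by simpa using hy)] at h
  exact h

theorem eventually_trivializationAt_mfderiv_snd (hf : ContMDiffAt I J ∞ f p)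
    (X : Π q : M, TangentSpace I q) : ∀ᶠ q in 𝓝 p,
      (trivializationAt E' (TangentSpace J : N → Type _) (f p) ⟨f q, mfderiv I J f q (X q)⟩).2 =
        d% (extChartAt J (f p) ∘ f) q (X q) := by
  have : IsManifold J 1 N := .of_le (n := ∞) (by norm_cast)
  have hsource : ∀ᶠ q in 𝓝 p, f q ∈ (chartAt H' (f p)).source :=
    hf.continuousAt.eventually ((chartAt H' (f p)).open_source.mem_nhds (mem_chart_source H' (f p)))
  filter_upwards [eventually_mdifferentiableAt hf, hsource] with q hfq hq
  have hu : MDiffAt (extChartAt J (f p)) (f q) := mdifferentiableAt_extChartAt hq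
  exact (trivializationAt_tangentSpace_snd hq _).trans (mfderiv_comp_apply q hu hfq _).symm

theorem mlieBracket_extend [CompleteSpace E'] (v w : TangentSpace J y) :
    mlieBracket J (FiberBundle.extend E' v) (FiberBundle.extend E' w) y = 0 := by
  have hconst (v : TangentSpace J y) :
      (fun x ↦ d% (extChartAt J y) x (FiberBundle.extend E' v x)) =ᶠ[𝓝 y]
        fun _ ↦ (trivializationAt E' (TangentSpace J : N → Type _) y ⟨y, v⟩).2 := by
    filter_upwards [(chartAt H' y).open_source.mem_nhds (mem_chart_source H' y)] with x hx
    rw [← trivializationAt_tangentSpace_snd hx, FiberBundle.extend,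
      Trivialization.apply_mk_symm _ (by simpa using hx)]
  have key := mvfderiv_mlieBracket (contMDiffAt_extChartAt (I := J) (x := y) (n := ∞))
    (FiberBundle.contMDiffAt_extend J E' v) (FiberBundle.contMDiffAt_extend J E' w)
  rw [eventuallyEq_mvfderiv_eq (hconst v), eventuallyEq_mvfderiv_eq (hconst w), mvfderiv_const,
    mvfderiv_const, ← trivializationAt_tangentSpace_snd (mem_chart_source H' y)] at key
  have h := symmL_trivializationAt_snd (F := E') (V := (TangentSpace J : N → Type _))
    (FiberBundle.mem_baseSet_trivializationAt' y)
    (mlieBracket J (FiberBundle.extend E' v) (FiberBundle.extend E' w) y)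
  rw [key] at h
  simpa using h.symm

theorem covariantDerivative_extend_comm [FiniteDimensional ℝ E']
    {cov : CovariantDerivative J E' (TangentSpace J : N → Type _)} (hcov : cov.torsion = 0)
    (v w : TangentSpace J y) :
    cov (FiberBundle.extend E' w) y v = cov (FiberBundle.extend E' v) y w := by
  have : CompleteSpace E' := FiniteDimensional.complete ℝ E'
  have h := cov.torsion_eq_zero_iff.1 hcov (FiberBundle.mdifferentiableAt_extend J E' v)
    (FiberBundle.mdifferentiableAt_extend J E' w)
  rwa [mlieBracket_extend, FiberBundle.extend_apply_self, FiberBundle.extend_apply_self,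
    sub_eq_zero] at h

theorem covariantDerivativeAlong_mfderiv_sub [CompleteSpace E] [FiniteDimensional ℝ E']
    {cov : CovariantDerivative J E' (TangentSpace J : N → Type _)} (hcov : cov.torsion = 0)
    (hf : ContMDiffAt I J ∞ f p) (hX : CMDiffAt ∞ (T% X) p) (hY : CMDiffAt ∞ (T% Y) p) :
    covariantDerivativeAlong cov f (fun q ↦ mfderiv I J f q (Y q)) p (X p) -
      covariantDerivativeAlong cov f (fun q ↦ mfderiv I J f q (X q)) p (Y p) =
        mfderiv I J f p (mlieBracket I X Y p) := by
  have hbracket := mvfderiv_mlieBracket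
    (contMDiffAt_extChartAt (I := J) (x := f p) (n := ∞) |>.comp p hf) hX hY
  simp only [covariantDerivativeAlong, _root_.add_apply, ContinuousLinearMap.comp_apply,
    eventuallyEq_mvfderiv_eq (eventually_trivializationAt_mfderiv_snd hf _)]
  rw [covariantDerivative_extend_comm hcov, add_sub_add_right_eq_sub, ← map_sub, ← hbracket,
    ← (eventually_trivializationAt_mfderiv_snd hf (mlieBracket I X Y)).self_of_nhds,
    symmL_trivializationAt_snd (FiberBundle.mem_baseSet_trivializationAt' (f p))]

end Torsion

section MetricConnections

variable {E : Type*} [NormedAddCommGroup E] [NormedSpace ℝ E]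
  {H : Type*} [TopologicalSpace H] {I : ModelWithCorners ℝ E H}
  {M : Type*} [TopologicalSpace M] [ChartedSpace H M]
  {E' : Type*} [NormedAddCommGroup E'] [NormedSpace ℝ E']
  {H' : Type*} [TopologicalSpace H'] {J : ModelWithCorners ℝ E' H'}
  {N : Type*} [TopologicalSpace N] [ChartedSpace H' N]
  {F : Type*} [NormedAddCommGroup F] [NormedSpace ℝ F] {V : N → Type*}
  [TopologicalSpace (TotalSpace F V)] [∀ x, NormedAddCommGroup (V x)]
  [∀ x, InnerProductSpace ℝ (V x)] [FiberBundle F V] [VectorBundle ℝ F V]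
  {cov : CovariantDerivative J F V} {f : M → N} {ξ η ζ : Π q, V (f q)} {g : M → ℝ} {p : M}

/-- The product rule `v⟨ξ, η⟩ = ⟨∇_v ξ, η⟩ + ⟨ξ, ∇_v η⟩` for sections `ξ`, `η` along `f`, the
property that the pull-back of a metric connection has to inherit. -/
def InnerProductRule (cov : CovariantDerivative J F V) (f : M → N) (ξ η : Π q, V (f q)) {p : M}
    (v : TangentSpace I p) : Prop :=
  d% (fun q ↦ inner ℝ (ξ q) (η q)) p v =
    inner ℝ (covariantDerivativeAlong cov f ξ p v) (η p) +
      inner ℝ (ξ p) (covariantDerivativeAlong cov f η p v)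

namespace InnerProductRule

variable {v : TangentSpace I p}

theorem symm (h : InnerProductRule cov f ξ η v) : InnerProductRule cov f η ξ v := by
  simp only [InnerProductRule, real_inner_comm] at h ⊢
  rw [h, add_comm]

theorem congr_left (h : InnerProductRule cov f ξ η v) (hζ : ∀ᶠ q in 𝓝 p, ζ q = ξ q) :
    InnerProductRule cov f ζ η v := by
  have hinner : (fun q ↦ inner ℝ (ζ q) (η q)) =ᶠ[𝓝 p] fun q ↦ inner ℝ (ξ q) (η q) := by
    filter_upwards [hζ] with q hq
    rw [hq]
  rw [InnerProductRule, eventuallyEq_mvfderiv_eq hinner, covariantDerivativeAlong_congr cov hζ,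
    hζ.self_of_nhds, h]

variable [IsContMDiffRiemannianBundle J ∞ F V]

theorem add_left (hξ : MDifferentiableAlongAt I J F f ξ p)
    (hζ : MDifferentiableAlongAt I J F f ζ p) (hη : MDifferentiableAlongAt I J F f η p)
    (h : InnerProductRule cov f ξ η v) (h' : InnerProductRule cov f ζ η v) :
    InnerProductRule cov f (fun q ↦ ξ q + ζ q) η v := by
  rw [InnerProductRule] at h h' ⊢
  have hinner : (fun q ↦ inner ℝ (ξ q + ζ q) (η q)) =
      (fun q ↦ inner ℝ (ξ q) (η q)) + fun q ↦ inner ℝ (ζ q) (η q) :=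
    funext fun q ↦ inner_add_left ..
  rw [hinner, mvfderiv_add (hξ.inner_bundle hη) (hζ.inner_bundle hη),
    covariantDerivativeAlong_add cov hξ hζ]
  simp only [_root_.add_apply, h, h', inner_add_left]
  ring

theorem smul_left (hg : MDiffAt g p) (hξ : MDifferentiableAlongAt I J F f ξ p)
    (hη : MDifferentiableAlongAt I J F f η p) (h : InnerProductRule cov f ξ η v) :
    InnerProductRule cov f (fun q ↦ g q • ξ q) η v := by
  rw [InnerProductRule] at h ⊢
  have hinner : (fun q ↦ inner ℝ (g q • ξ q) (η q)) = g • fun q ↦ inner ℝ (ξ q) (η q) :=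
    funext fun q ↦ real_inner_smul_left ..
  rw [hinner, mvfderiv_smul hg (hξ.inner_bundle hη), covariantDerivativeAlong_smul cov hg hξ]
  simp only [_root_.add_apply, _root_.smul_apply, ContinuousLinearMap.smulRight_apply, h,
    inner_add_left, real_inner_smul_left, smul_eq_mul]
  ring

variable [IsManifold J ∞ N] [FiniteDimensional ℝ F] [ContMDiffVectorBundle ∞ F V J]

theorem comp_comp (hcov : cov.IsMetricCompatible) (hf : MDifferentiableAt I J f p)
    {Z W : Π y, V y} (hZ : MDiffAt (T% Z) (f p)) (hW : MDiffAt (T% W) (f p)) :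
    InnerProductRule cov f (fun q ↦ Z (f q)) (fun q ↦ W (f q)) v := by
  rw [InnerProductRule, covariantDerivativeAlong_comp cov hf hZ,
    covariantDerivativeAlong_comp cov hf hW]
  have key := hcov.mvfderiv_inner_eq
    (FiberBundle.extend E' (mfderiv I J f p v) : Π y : N, TangentSpace J y) hZ hW
  have hinner : MDiffAt (fun y ↦ inner ℝ (Z y) (W y)) (f p) :=
    MDifferentiableAt.inner_bundle hZ hW
  simp only [FiberBundle.extend_apply_self] at key
  exact (mfderiv_comp_apply p hinner hf v).trans key

variable [FiniteDimensional ℝ E'] [T2Space N]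

theorem of_comp_left (hξ : MDifferentiableAlongAt I J F f ξ p)
    (hη : MDifferentiableAlongAt I J F f η p)
    (h : ∀ Z : Π y, V y, CMDiff ∞ (T% Z) → InnerProductRule cov f (fun q ↦ Z (f q)) η v) :
    InnerProductRule cov f ξ η v := by
  suffices MDifferentiableAlongAt I J F f ξ p ∧ InnerProductRule cov f ξ η v from this.2
  refine induction_along (J := J) (F := F)
    (P := fun ξ ↦ MDifferentiableAlongAt I J F f ξ p ∧ InnerProductRule cov f ξ η v)
    (R := fun g ↦ MDiffAt g p) hξ.map.continuousAt
    (fun φ ↦ φ.mdifferentiableAt.comp p hξ.trivializationAt_snd) ?_ ?_ ?_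
  · exact fun ξ ζ hξζ hζ ↦ ⟨hζ.1.congr hξζ, hζ.2.congr_left hξζ⟩
  · exact fun ξ ζ hξ hζ ↦ ⟨hξ.1.add hζ.1, add_left hξ.1 hζ.1 hη hξ.2 hζ.2⟩
  · intro g Z hg hZ
    have hZf : MDifferentiableAlongAt I J F f (fun q ↦ Z (f q)) p :=
      .comp (hZ.mdifferentiable (by simp) (f p)) hξ.map
    exact ⟨hZf.smul hg, smul_left hg hZf hη (h Z hZ)⟩

end InnerProductRule

variable [IsManifold J ∞ N] [FiniteDimensional ℝ F] [ContMDiffVectorBundle ∞ F V J]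
  [IsContMDiffRiemannianBundle J ∞ F V] [FiniteDimensional ℝ E'] [T2Space N]

theorem innerProductRule_of_isMetricCompatible (hcov : cov.IsMetricCompatible)
    (hξ : MDifferentiableAlongAt I J F f ξ p) (hη : MDifferentiableAlongAt I J F f η p)
    (v : TangentSpace I p) : InnerProductRule cov f ξ η v := by
  refine .of_comp_left hξ hη fun Z hZ ↦ .symm ?_
  have hZf := hZ.mdifferentiable (by simp) (f p)
  refine .of_comp_left hη (.comp hZf hξ.map) fun W hW ↦ ?_
  exact .comp_comp hcov hξ.map (hW.mdifferentiable (by simp) (f p)) hZf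

end MetricConnections

section Smoothness

variable {E : Type*} [NormedAddCommGroup E] [NormedSpace ℝ E]
  {H : Type*} [TopologicalSpace H] {I : ModelWithCorners ℝ E H}
  {M : Type*} [TopologicalSpace M] [ChartedSpace H M]
  {E' : Type*} [NormedAddCommGroup E'] [NormedSpace ℝ E']
  {H' : Type*} [TopologicalSpace H'] {J : ModelWithCorners ℝ E' H'}
  {N : Type*} [TopologicalSpace N] [ChartedSpace H' N]
  {F : Type*} [NormedAddCommGroup F] [NormedSpace ℝ F] {V : N → Type*}
  [TopologicalSpace (TotalSpace F V)] [∀ y, AddCommGroup (V y)] [∀ y, Module ℝ (V y)]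
  [∀ y, TopologicalSpace (V y)] [∀ y, IsTopologicalAddGroup (V y)] [∀ y, ContinuousSMul ℝ (V y)]
  [FiberBundle F V] [VectorBundle ℝ F V]
  {cov : CovariantDerivative J F V} {f : M → N} {ξ η : Π q, V (f q)} {g : M → ℝ}
  {X Y : Π q : M, TangentSpace I q} {p : M}

/-- The curvature `∇_X ∇_Y ξ - ∇_Y ∇_X ξ - ∇_{[X,Y]} ξ` of the pull-back of a connection along `f`,
evaluated on a section `ξ` along `f`. -/
def curvatureAlong (cov : CovariantDerivative J F V) (f : M → N)
    (X Y : Π q : M, TangentSpace I q) (ξ : Π q, V (f q)) (p : M) : V (f p) :=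
  covariantDerivativeAlong cov f (fun q ↦ covariantDerivativeAlong cov f ξ q (Y q)) p (X p) -
    covariantDerivativeAlong cov f (fun q ↦ covariantDerivativeAlong cov f ξ q (X q)) p (Y p) -
      covariantDerivativeAlong cov f ξ p (mlieBracket I X Y p)

theorem curvatureAlong_congr (h : ∀ᶠ q in 𝓝 p, ξ q = η q) :
    curvatureAlong cov f X Y ξ p = curvatureAlong cov f X Y η p := by
  have hW (W : Π q : M, TangentSpace I q) : ∀ᶠ q in 𝓝 p,
      covariantDerivativeAlong cov f ξ q (W q) = covariantDerivativeAlong cov f η q (W q) := by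
    filter_upwards [eventually_eventually_nhds.2 h] with q hq
    rw [covariantDerivativeAlong_congr cov hq]
  simp only [curvatureAlong, covariantDerivativeAlong_congr cov (hW _),
    covariantDerivativeAlong_congr cov h]

variable [IsManifold J ∞ N]

theorem contMDiffAt_covariantDerivative_apply (hcov : cov.ContMDiffCovariantDerivative ∞)
    {Z : Π y, V y} (hZ : CMDiff ∞ (T% Z)) {w : Π q, TangentSpace J (f q)}
    (hw : ContMDiffAlongAt I J E' ∞ f w p) :
    ContMDiffAlongAt I J F ∞ f (fun q ↦ cov Z (f q) (w q)) p :=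
  ContMDiffAt.clm_bundle_apply (ContMDiffAt.comp p
    ((hcov.contMDiff.contMDiff (σ := Z) hZ.contMDiffOn).contMDiffAt univ_mem) hw.map) hw

theorem mdifferentiableAt_covariantDerivative_apply (hcov : cov.ContMDiffCovariantDerivative ∞)
    {Z : Π y, V y} (hZ : CMDiff ∞ (T% Z)) {w : Π q, TangentSpace J (f q)}
    (hw : MDifferentiableAlongAt I J E' f w p) :
    MDifferentiableAlongAt I J F f (fun q ↦ cov Z (f q) (w q)) p :=
  MDifferentiableAt.clm_bundle_apply (MDifferentiableAt.comp p
    (((hcov.contMDiff.contMDiff (σ := Z) hZ.contMDiffOn).contMDiffAt univ_mem).mdifferentiableAt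
      (by simp)) hw.map) hw

variable [ContMDiffVectorBundle ∞ F V J] [IsManifold I ∞ M]

theorem eventually_covariantDerivativeAlong_add (cov : CovariantDerivative J F V)
    (hξ : ContMDiffAlongAt I J F ∞ f ξ p) (hη : ContMDiffAlongAt I J F ∞ f η p)
    (X : Π q : M, TangentSpace I q) : ∀ᶠ q in 𝓝 p,
      covariantDerivativeAlong cov f (fun q ↦ ξ q + η q) q (X q) =
        covariantDerivativeAlong cov f ξ q (X q) + covariantDerivativeAlong cov f η q (X q) := by
  filter_upwards [eventually_mdifferentiableAt hξ, eventually_mdifferentiableAt hη]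
    with q hξq hηq
  rw [covariantDerivativeAlong_add cov hξq hηq, _root_.add_apply]

theorem eventually_covariantDerivativeAlong_smul (cov : CovariantDerivative J F V)
    (hg : CMDiffAt ∞ g p) (hξ : ContMDiffAlongAt I J F ∞ f ξ p)
    (X : Π q : M, TangentSpace I q) : ∀ᶠ q in 𝓝 p,
      covariantDerivativeAlong cov f (fun q ↦ g q • ξ q) q (X q) =
        g q • covariantDerivativeAlong cov f ξ q (X q) + d% g q (X q) • ξ q := by
  filter_upwards [eventually_mdifferentiableAt hg, eventually_mdifferentiableAt hξ]
    with q hgq hξq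
  rw [covariantDerivativeAlong_smul cov hgq hξq]
  rfl

variable [FiniteDimensional ℝ F]

theorem eventually_covariantDerivativeAlong_comp (cov : CovariantDerivative J F V)
    (hf : ContMDiffAt I J ∞ f p) {Z : Π y, V y} (hZ : CMDiff ∞ (T% Z))
    (X : Π q : M, TangentSpace I q) : ∀ᶠ q in 𝓝 p,
      covariantDerivativeAlong cov f (fun q ↦ Z (f q)) q (X q) =
        cov Z (f q) (mfderiv I J f q (X q)) := by
  have : ContMDiffVectorBundle 1 F V J := .of_le (n := ∞) (by norm_cast)
  filter_upwards [eventually_mdifferentiableAt hf] with q hfq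
  rw [covariantDerivativeAlong_comp cov hfq (hZ.mdifferentiable (by simp) _)]
  rfl

theorem contMDiffAt_covariantDerivativeAlong [FiniteDimensional ℝ E'] [T2Space N]
    (hcov : cov.ContMDiffCovariantDerivative ∞) (hξ : ContMDiffAlongAt I J F ∞ f ξ p)
    (hX : CMDiffAt ∞ (T% X) p) :
    ContMDiffAlongAt I J F ∞ f (fun q ↦ covariantDerivativeAlong cov f ξ q (X q)) p := by
  suffices ContMDiffAlongAt I J F ∞ f ξ p ∧
    ContMDiffAlongAt I J F ∞ f (fun q ↦ covariantDerivativeAlong cov f ξ q (X q)) p from this.2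
  refine induction_along (J := J) (F := F) (P := fun ξ ↦ ContMDiffAlongAt I J F ∞ f ξ p ∧
    ContMDiffAlongAt I J F ∞ f (fun q ↦ covariantDerivativeAlong cov f ξ q (X q)) p)
    (R := fun g ↦ CMDiffAt ∞ g p) hξ.map.continuousAt
    (fun φ ↦ φ.contMDiff.contMDiffAt.comp p hξ.trivializationAt_snd) ?_ ?_ ?_
  · intro ξ η hξη hη
    refine ⟨hη.1.congr hξη, hη.2.congr ?_⟩
    filter_upwards [eventually_eventually_nhds.2 hξη] with q hq
    rw [covariantDerivativeAlong_congr cov hq]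
  · exact fun ξ η hξ hη ↦ ⟨hξ.1.add hη.1,
      (hξ.2.add hη.2).congr (eventually_covariantDerivativeAlong_add cov hξ.1 hη.1 X)⟩
  · intro g Z hg hZ
    have hZf : ContMDiffAlongAt I J F ∞ f (fun q ↦ Z (f q)) p := .comp (hZ (f p)) hξ.map
    have hDZf : ContMDiffAlongAt I J F ∞ f
        (fun q ↦ covariantDerivativeAlong cov f (fun q ↦ Z (f q)) q (X q)) p :=
      (contMDiffAt_covariantDerivative_apply hcov hZ
        (contMDiffAt_mfderiv_apply hξ.map hX)).congr
        (eventually_covariantDerivativeAlong_comp cov hξ.map hZ X)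
    exact ⟨.smul hg hZf, (ContMDiffAlongAt.add (.smul hg hDZf)
      (.smul (contMDiffAt_mvfderiv_apply hg hX) hZf)).congr
      (eventually_covariantDerivativeAlong_smul cov hg hZf X)⟩

variable [FiniteDimensional ℝ E'] [T2Space N]

theorem curvatureAlong_add (hcov : cov.ContMDiffCovariantDerivative ∞)
    (hξ : ContMDiffAlongAt I J F ∞ f ξ p) (hη : ContMDiffAlongAt I J F ∞ f η p)
    (hX : CMDiffAt ∞ (T% X) p) (hY : CMDiffAt ∞ (T% Y) p) :
    curvatureAlong cov f X Y (fun q ↦ ξ q + η q) p =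
      curvatureAlong cov f X Y ξ p + curvatureAlong cov f X Y η p := by
  have hD {ζ : Π q, V (f q)} {W : Π q : M, TangentSpace I q}
      (hζ : ContMDiffAlongAt I J F ∞ f ζ p) (hW : CMDiffAt ∞ (T% W) p) :=
    (contMDiffAt_covariantDerivativeAlong hcov hζ hW).mdifferentiableAt (by simp)
  simp only [curvatureAlong,
    covariantDerivativeAlong_congr cov (eventually_covariantDerivativeAlong_add cov hξ hη _)]
  rw [covariantDerivativeAlong_add cov (hD hξ hX) (hD hη hX),
    covariantDerivativeAlong_add cov (hD hξ hY) (hD hη hY),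
    covariantDerivativeAlong_add cov (hξ.mdifferentiableAt (by simp))
      (hη.mdifferentiableAt (by simp))]
  simp only [_root_.add_apply]
  abel

-- The derivatives of `g` that appear cancel, since `[X, Y]g = X(Yg) - Y(Xg)`.
theorem curvatureAlong_smul [CompleteSpace E] (hcov : cov.ContMDiffCovariantDerivative ∞)
    (hg : CMDiffAt ∞ g p) (hξ : ContMDiffAlongAt I J F ∞ f ξ p)
    (hX : CMDiffAt ∞ (T% X) p) (hY : CMDiffAt ∞ (T% Y) p) :
    curvatureAlong cov f X Y (fun q ↦ g q • ξ q) p = g p • curvatureAlong cov f X Y ξ p := by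
  have hD {W : Π q : M, TangentSpace I q} (hW : CMDiffAt ∞ (T% W) p) :=
    (contMDiffAt_covariantDerivativeAlong hcov hξ hW).mdifferentiableAt (by simp)
  have hdg {W : Π q : M, TangentSpace I q} (hW : CMDiffAt ∞ (T% W) p) :=
    (contMDiffAt_mvfderiv_apply hg hW).mdifferentiableAt (by simp)
  have hgp := hg.mdifferentiableAt (by simp)
  have hξp : MDifferentiableAlongAt I J F f ξ p := hξ.mdifferentiableAt (by simp)
  simp only [curvatureAlong,
    covariantDerivativeAlong_congr cov (eventually_covariantDerivativeAlong_smul cov hg hξ _)]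
  rw [covariantDerivativeAlong_add cov (.smul hgp (hD hX)) (.smul (hdg hX) hξp),
    covariantDerivativeAlong_add cov (.smul hgp (hD hY)) (.smul (hdg hY) hξp),
    covariantDerivativeAlong_smul cov hgp hξp,
    covariantDerivativeAlong_smul cov hgp (hD hX), covariantDerivativeAlong_smul cov hgp (hD hY),
    covariantDerivativeAlong_smul cov (hdg hX) hξp, covariantDerivativeAlong_smul cov (hdg hY) hξp]
  simp only [_root_.add_apply, _root_.smul_apply, ContinuousLinearMap.smulRight_apply,
    mvfderiv_mlieBracket hg hX hY]
  module

end Smoothness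

section Curvature

variable {E : Type*} [NormedAddCommGroup E] [NormedSpace ℝ E]
  {H : Type*} [TopologicalSpace H] {I : ModelWithCorners ℝ E H}
  {M : Type*} [TopologicalSpace M] [ChartedSpace H M]
  {E' : Type*} [NormedAddCommGroup E'] [NormedSpace ℝ E']
  {H' : Type*} [TopologicalSpace H'] {J : ModelWithCorners ℝ E' H'}
  {N : Type*} [TopologicalSpace N] [ChartedSpace H' N] [IsManifold J ∞ N]
  {cov : CovariantDerivative J E' (TangentSpace J : N → Type _)}
  {f : M → N} {X Y : Π q : M, TangentSpace I q} {p : M}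

theorem tensorialAt_secondCovariantDerivative (hcov : cov.ContMDiffCovariantDerivative ∞)
    {Z : Π y : N, TangentSpace J y} (hZ : CMDiff ∞ (T% Z)) (y : N) :
    TensorialAt J E' (fun W : Π y : N, TangentSpace J y ↦
      cov (fun x ↦ cov Z x (W x)) y - (cov Z y).comp (cov W y)) y where
  smul {g σ} hg hσ := by
    have hZσ := mdifferentiableAt_covariantDerivative_apply (f := fun y ↦ y) hcov hZ hσ
    have hsmul : (fun x ↦ cov Z x ((g • σ) x)) = g • fun x ↦ cov Z x (σ x) :=
      funext fun x ↦ map_smul (cov Z x) (g x) (σ x)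
    rw [hsmul, cov.isCovariantDerivativeOnUniv.leibniz hZσ hg,
      cov.isCovariantDerivativeOnUniv.leibniz hσ hg]
    ext v
    simp
    module
  add {σ τ} hσ hτ := by
    have hZσ := mdifferentiableAt_covariantDerivative_apply (f := fun y ↦ y) hcov hZ hσ
    have hZτ := mdifferentiableAt_covariantDerivative_apply (f := fun y ↦ y) hcov hZ hτ
    have hadd : (fun x ↦ cov Z x ((σ + τ) x)) =
        (fun x ↦ cov Z x (σ x)) + fun x ↦ cov Z x (τ x) :=
      funext fun x ↦ map_add (cov Z x) (σ x) (τ x)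
    rw [hadd, cov.isCovariantDerivativeOnUniv.add hZσ hZτ,
      cov.isCovariantDerivativeOnUniv.add hσ hτ]
    ext v
    simp
    module

variable [FiniteDimensional ℝ E']

/-- The second covariant derivative `(w, v) ↦ ∇_v ∇_w Z - ∇_{∇_v w} Z` of a vector field `Z`, which
is tensorial in `w`. -/
def secondCovariantDerivative (hcov : cov.ContMDiffCovariantDerivative ∞)
    {Z : Π y : N, TangentSpace J y} (hZ : CMDiff ∞ (T% Z)) (y : N) :
    TangentSpace J y →L[ℝ] TangentSpace J y →L[ℝ] TangentSpace J y :=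
  TensorialAt.mkHom _ _ (tensorialAt_secondCovariantDerivative hcov hZ y)

theorem secondCovariantDerivative_apply (hcov : cov.ContMDiffCovariantDerivative ∞)
    {Z W : Π y : N, TangentSpace J y} (hZ : CMDiff ∞ (T% Z)) {y : N} (hW : MDiffAt (T% W) y) :
    secondCovariantDerivative hcov hZ y (W y) =
      cov (fun x ↦ cov Z x (W x)) y - (cov Z y).comp (cov W y) :=
  TensorialAt.mkHom_apply _ hW

theorem secondCovariantDerivative_sub_swap (hcov : cov.ContMDiffCovariantDerivative ∞)
    (htorsion : cov.torsion = 0) {U W Z : Π y : N, TangentSpace J y} (hZ : CMDiff ∞ (T% Z))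
    {y : N} (hU : MDiffAt (T% U) y) (hW : MDiffAt (T% W) y) :
    secondCovariantDerivative hcov hZ y (W y) (U y) -
        secondCovariantDerivative hcov hZ y (U y) (W y) =
      cov (fun x ↦ cov Z x (W x)) y (U y) - cov (fun x ↦ cov Z x (U x)) y (W y) -
        cov Z y (mlieBracket J U W y) := by
  rw [secondCovariantDerivative_apply hcov hZ hU, secondCovariantDerivative_apply hcov hZ hW,
    ← cov.torsion_eq_zero_iff.1 htorsion hU hW]
  simp only [_root_.sub_apply, ContinuousLinearMap.comp_apply, map_sub]
  abel

variable [T2Space N]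

theorem exists_contMDiff_vectorField {y : N} (v : TangentSpace J y) :
    ∃ Z : Π y : N, TangentSpace J y, CMDiff ∞ (T% Z) ∧ Z y = v := by
  obtain ⟨u, hu, hextend⟩ := FiberBundle.exists_contMDiffOn_extend (k := ∞) J E' v
  obtain ⟨Z, hZ, hZextend⟩ := exists_contMDiff_section_eventuallyEq hu hextend
  exact ⟨Z, hZ, by rw [hZextend.self_of_nhds, FiberBundle.extend_apply_self]⟩

theorem covariantDerivativeAlong_covariantDerivative_apply
    (hcov : cov.ContMDiffCovariantDerivative ∞)
    {Z : Π y : N, TangentSpace J y} (hZ : CMDiff ∞ (T% Z)) {w : Π q, TangentSpace J (f q)}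
    (hw : MDifferentiableAlongAt I J E' f w p) (v : TangentSpace I p) :
    covariantDerivativeAlong cov f (fun q ↦ cov Z (f q) (w q)) p v =
      cov Z (f p) (covariantDerivativeAlong cov f w p v) +
        secondCovariantDerivative hcov hZ (f p) (w p) (mfderiv I J f p v) := by
  set T := secondCovariantDerivative hcov hZ (f p) with hT
  suffices MDifferentiableAlongAt I J E' f w p ∧
    covariantDerivativeAlong cov f (fun q ↦ cov Z (f q) (w q)) p v =
      cov Z (f p) (covariantDerivativeAlong cov f w p v) + T (w p) (mfderiv I J f p v) from this.2
  refine induction_along (J := J) (F := E') (P := fun w ↦ MDifferentiableAlongAt I J E' f w p ∧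
    covariantDerivativeAlong cov f (fun q ↦ cov Z (f q) (w q)) p v =
      cov Z (f p) (covariantDerivativeAlong cov f w p v) + T (w p) (mfderiv I J f p v))
    (R := fun g ↦ MDiffAt g p) hw.map.continuousAt
    (fun φ ↦ φ.mdifferentiableAt.comp p hw.trivializationAt_snd) ?_ ?_ ?_
  · intro ξ η hξη ⟨hη, hηT⟩
    refine ⟨hη.congr hξη, ?_⟩
    rw [covariantDerivativeAlong_congr cov hξη, hξη.self_of_nhds, ← hηT]
    congr 1
    apply covariantDerivativeAlong_congr
    filter_upwards [hξη] with q hq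
    rw [hq]
  · intro ξ η ⟨hξ, hξT⟩ ⟨hη, hηT⟩
    refine ⟨hξ.add hη, ?_⟩
    simp only [map_add]
    rw [covariantDerivativeAlong_add cov (mdifferentiableAt_covariantDerivative_apply hcov hZ hξ)
      (mdifferentiableAt_covariantDerivative_apply hcov hZ hη),
      covariantDerivativeAlong_add cov hξ hη]
    simp only [map_add, _root_.add_apply, hξT, hηT]
    abel
  · intro g W hg hW
    have hWf : MDiffAt (T% W) (f p) := hW.mdifferentiable (by simp) (f p)
    have hWalong : MDifferentiableAlongAt I J E' f (fun q ↦ W (f q)) p := .comp hWf hw.map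
    have hZW : MDiffAt (T% fun y ↦ cov Z y (W y)) (f p) :=
      mdifferentiableAt_covariantDerivative_apply (f := fun y ↦ y) hcov hZ hWf
    refine ⟨hWalong.smul hg, ?_⟩
    simp only [map_smul]
    rw [covariantDerivativeAlong_smul cov hg
      (mdifferentiableAt_covariantDerivative_apply hcov hZ hWalong),
      covariantDerivativeAlong_smul cov hg hWalong, covariantDerivativeAlong_comp cov hw.map hWf,
      covariantDerivativeAlong_comp cov hw.map hZW, hT, secondCovariantDerivative_apply hcov hZ hWf]
    simp
    module

variable [CompleteSpace E] [IsManifold I ∞ M]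

theorem curvatureAlong_comp (hcov : cov.ContMDiffCovariantDerivative ∞)
    (htorsion : cov.torsion = 0) (hf : ContMDiffAt I J ∞ f p)
    (hX : CMDiffAt ∞ (T% X) p) (hY : CMDiffAt ∞ (T% Y) p)
    {Z : Π y : N, TangentSpace J y} (hZ : CMDiff ∞ (T% Z)) :
    curvatureAlong cov f X Y (fun q ↦ Z (f q)) p =
      secondCovariantDerivative hcov hZ (f p) (mfderiv I J f p (Y p)) (mfderiv I J f p (X p)) -
        secondCovariantDerivative hcov hZ (f p) (mfderiv I J f p (X p))
          (mfderiv I J f p (Y p)) := by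
  have hdf {W : Π q : M, TangentSpace I q} (hW : CMDiffAt ∞ (T% W) p) :
      MDifferentiableAlongAt I J E' f (fun q ↦ mfderiv I J f q (W q)) p :=
    (contMDiffAt_mfderiv_apply hf hW).mdifferentiableAt (by simp)
  simp only [curvatureAlong,
    covariantDerivativeAlong_congr cov (eventually_covariantDerivativeAlong_comp cov hf hZ _)]
  rw [covariantDerivativeAlong_covariantDerivative_apply hcov hZ (hdf hX),
    covariantDerivativeAlong_covariantDerivative_apply hcov hZ (hdf hY),
    covariantDerivativeAlong_comp cov (hf.mdifferentiableAt (by simp))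
      (hZ.mdifferentiable (by simp) _),
    ContinuousLinearMap.comp_apply, ← covariantDerivativeAlong_mfderiv_sub htorsion hf hX hY,
    map_sub]
  abel

theorem curvatureAlong_eq (hcov : cov.ContMDiffCovariantDerivative ∞) (htorsion : cov.torsion = 0)
    {R : Π y : N, TangentSpace J y → TangentSpace J y → TangentSpace J y →ₗ[ℝ] TangentSpace J y}
    (hR : ∀ U W Z : Π y : N, TangentSpace J y,
      CMDiff ∞ (T% U) → CMDiff ∞ (T% W) → CMDiff ∞ (T% Z) → ∀ y,
      cov (fun x ↦ cov Z x (W x)) y (U y) - cov (fun x ↦ cov Z x (U x)) y (W y) -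
        cov Z y (mlieBracket J U W y) = R y (U y) (W y) (Z y))
    {ξ : Π q, TangentSpace J (f q)} (hξ : ContMDiffAlongAt I J E' ∞ f ξ p)
    (hX : CMDiffAt ∞ (T% X) p) (hY : CMDiffAt ∞ (T% Y) p) :
    curvatureAlong cov f X Y ξ p =
      R (f p) (mfderiv I J f p (X p)) (mfderiv I J f p (Y p)) (ξ p) := by
  set r := R (f p) (mfderiv I J f p (X p)) (mfderiv I J f p (Y p)) with hr
  suffices ContMDiffAlongAt I J E' ∞ f ξ p ∧ curvatureAlong cov f X Y ξ p = r (ξ p) from this.2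
  refine induction_along (J := J) (F := E') (P := fun ξ ↦
    ContMDiffAlongAt I J E' ∞ f ξ p ∧ curvatureAlong cov f X Y ξ p = r (ξ p))
    (R := fun g ↦ CMDiffAt ∞ g p) hξ.map.continuousAt
    (fun φ ↦ φ.contMDiff.contMDiffAt.comp p hξ.trivializationAt_snd) ?_ ?_ ?_
  · intro ξ η hξη ⟨hη, hηr⟩
    exact ⟨hη.congr hξη, by rw [curvatureAlong_congr hξη, hηr, hξη.self_of_nhds]⟩
  · intro ξ η ⟨hξ, hξr⟩ ⟨hη, hηr⟩
    exact ⟨hξ.add hη, by rw [curvatureAlong_add hcov hξ hη hX hY, hξr, hηr, map_add]⟩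
  · intro g Z hg hZ
    have hZf : ContMDiffAlongAt I J E' ∞ f (fun q ↦ Z (f q)) p := .comp (hZ (f p)) hξ.map
    refine ⟨.smul hg hZf, ?_⟩
    obtain ⟨U, hU, hUX⟩ := exists_contMDiff_vectorField (mfderiv I J f p (X p))
    obtain ⟨W, hW, hWY⟩ := exists_contMDiff_vectorField (mfderiv I J f p (Y p))
    rw [curvatureAlong_smul hcov hg hZf hX hY, curvatureAlong_comp hcov htorsion hξ.map hX hY hZ,
      map_smul, hr, ← hUX, ← hWY, ← hR U W Z hU hW hZ, secondCovariantDerivative_sub_swap hcov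
        htorsion hZ (hU.mdifferentiable (by simp) _) (hW.mdifferentiable (by simp) _)]

end Curvature

/-- The symmetries of the curvature tensor `T x y z w = ⟨R(x, y)z, w⟩`, an algebraic curvature
tensor. Homogeneity is left out, as additivity is enough to recover such a tensor from its
sectional curvatures. -/
structure IsCurvatureForm {V : Type*} [AddCommGroup V] (T : V → V → V → V → ℝ) : Prop where
  add_fst : ∀ x x' y z w, T (x + x') y z w = T x y z w + T x' y z w
  add_fourth : ∀ x y z w w', T x y z (w + w') = T x y z w + T x y z w'
  swap_left : ∀ x y z w, T x y z w = -T y x z w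
  swap_right : ∀ x y z w, T x y z w = -T x y w z
  bianchi : ∀ x y z w, T x y z w + T y z x w + T z x y w = 0

namespace IsCurvatureForm

variable {V : Type*} [AddCommGroup V] {T S : V → V → V → V → ℝ}

theorem swap_pairs (hT : IsCurvatureForm T) (x y z w : V) : T x y z w = T z w x y := by
  have left := hT.swap_left
  have right := hT.swap_right
  linarith [hT.bianchi x y z w, hT.bianchi y z w x, hT.bianchi z w x y, hT.bianchi w x y z,
    left x y z w, left y z w x, left z w x y, left w x y z, left x z y w, left y w x z,
    left x z w y, left y w z x, right x y z w, right y z w x, right z w x y, right w x y z,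
    right x z y w, right y w x z, right z x y w, right w y x z, right y x z w, right z y w x,
    right w z x y, right x w y z, right z x w y, right w y z x]

theorem eq_zero_of_sectional (hT : IsCurvatureForm T) (h : ∀ x y, T x y y x = 0) (x y z w : V) :
    T x y z w = 0 := by
  have polar_outer (x y w : V) : T x y y w = 0 := by
    have hxw := h (x + w) y
    rw [hT.add_fst, hT.add_fourth, hT.add_fourth, h, h] at hxw
    linarith [hT.swap_pairs w y y x, hT.swap_left y x w y, hT.swap_right x y w y]
  have add_snd (x y y' z w : V) : T x (y + y') z w = T x y z w + T x y' z w := by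
    linarith [hT.swap_left x (y + y') z w, hT.add_fst y y' x z w, hT.swap_left x y z w,
      hT.swap_left x y' z w]
  have add_third (x y z z' w : V) : T x y (z + z') w = T x y z w + T x y z' w := by
    linarith [hT.swap_right x y (z + z') w, hT.add_fourth x y w z z', hT.swap_right x y z w,
      hT.swap_right x y z' w]
  have swap_middle (x y z w : V) : T x y z w = -T x z y w := by
    have hyz := polar_outer x (y + z) w
    rw [add_snd, add_third, add_third, polar_outer, polar_outer] at hyz
    linarith
  linarith [hT.bianchi x y z w, swap_middle y z x w, hT.swap_left y x z w, hT.swap_left z x y w,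
    swap_middle x z y w]

theorem eq_of_sectional_eq (hT : IsCurvatureForm T) (hS : IsCurvatureForm S)
    (h : ∀ x y, T x y y x = S x y y x) : T = S := by
  have hTS : IsCurvatureForm fun x y z w ↦ T x y z w - S x y z w :=
    { add_fst := fun x x' y z w ↦ by rw [hT.add_fst, hS.add_fst]; ring
      add_fourth := fun x y z w w' ↦ by rw [hT.add_fourth, hS.add_fourth]; ring
      swap_left := fun x y z w ↦ by rw [hT.swap_left x, hS.swap_left x]; ring
      swap_right := fun x y z w ↦ by rw [hT.swap_right x, hS.swap_right x]; ring
      bianchi := fun x y z w ↦ by linarith [hT.bianchi x y z w, hS.bianchi x y z w] }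
  ext x y z w
  exact sub_eq_zero.1 (hTS.eq_zero_of_sectional (fun x y ↦ sub_eq_zero.2 (h x y)) x y z w)

end IsCurvatureForm

theorem isCurvatureForm_inner {V : Type*} [NormedAddCommGroup V] [InnerProductSpace ℝ V] (c : ℝ) :
    IsCurvatureForm fun x y z w : V ↦
      c * (inner ℝ y z * inner ℝ x w - inner ℝ x z * inner ℝ y w) where
  add_fst x x' y z w := by simp only [inner_add_left]; ring
  add_fourth x y z w w' := by simp only [inner_add_right]; ring
  swap_left x y z w := by ring
  swap_right x y z w := by ring
  bianchi x y z w := by rw [real_inner_comm z x, real_inner_comm y x, real_inner_comm z y]; ring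

section ConstantCurvature

variable {n : ℕ}
  {N : Type*} [TopologicalSpace N] [ChartedSpace (EuclideanSpace ℝ (Fin n)) N]
  [IsManifold (𝓡 n) ∞ N]
  {nabla : CovariantDerivative (𝓡 n) (EuclideanSpace ℝ (Fin n))
    (fun x : N ↦ TangentSpace (𝓡 n) x)}
  {X Y Z W : Π y : N, TangentSpace (𝓡 n) y}

namespace IsSmoothVectorField

theorem mdifferentiableAt (hX : IsSmoothVectorField X) (y : N) :
    MDifferentiableAt (𝓡 n) (𝓡 n).tangent (fun y ↦ (⟨y, X y⟩ : TangentBundle (𝓡 n) N)) y :=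
  ContMDiff.mdifferentiable hX (by simp) y

theorem covariantDerivative (hZ : IsSmoothVectorField Z)
    (hnabla : nabla.ContMDiffCovariantDerivative ∞) (hX : IsSmoothVectorField X) :
    IsSmoothVectorField (fun y ↦ nabla Z y (X y)) :=
  fun y ↦ contMDiffAt_covariantDerivative_apply (f := fun y ↦ y) hnabla hZ (hX y)

theorem mlieBracket (hX : IsSmoothVectorField X) (hY : IsSmoothVectorField Y) :
    IsSmoothVectorField (mlieBracket (𝓡 n) X Y) :=
  fun y ↦ contMDiffAt_mlieBracket (hX y) (hY y)

end IsSmoothVectorField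

variable [RiemannianBundle (fun x : N ↦ TangentSpace (𝓡 n) x)]

theorem connectionCurvature_eq_secondCovariantDerivative
    (hnabla : nabla.ContMDiffCovariantDerivative ∞) (htorsion : nabla.torsion = 0)
    (hX : IsSmoothVectorField X) (hY : IsSmoothVectorField Y) (hZ : IsSmoothVectorField Z) (y : N) :
    connectionCurvature nabla X Y Z y =
      secondCovariantDerivative hnabla hZ y (Y y) (X y) -
        secondCovariantDerivative hnabla hZ y (X y) (Y y) :=
  (secondCovariantDerivative_sub_swap hnabla htorsion hZ (hX.mdifferentiableAt y)
    (hY.mdifferentiableAt y)).symm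

theorem connectionCurvature_bianchi
    (hnabla : nabla.ContMDiffCovariantDerivative ∞) (htorsion : nabla.torsion = 0)
    (hX : IsSmoothVectorField X) (hY : IsSmoothVectorField Y) (hZ : IsSmoothVectorField Z) (y : N) :
    connectionCurvature nabla X Y Z y + connectionCurvature nabla Y Z X y +
      connectionCurvature nabla Z X Y y = 0 := by
  have torsionFree {A B : Π y : N, TangentSpace (𝓡 n) y} (hA : IsSmoothVectorField A)
      (hB : IsSmoothVectorField B) (x : N) :
      nabla B x (A x) - nabla A x (B x) = mlieBracket (𝓡 n) A B x :=
    nabla.torsion_eq_zero_iff.1 htorsion (hA.mdifferentiableAt x) (hB.mdifferentiableAt x)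
  have nabla_nabla {A B : Π y : N, TangentSpace (𝓡 n) y} (hA : IsSmoothVectorField A)
      (hB : IsSmoothVectorField B) : nabla (fun x ↦ nabla B x (A x)) y =
      nabla (fun x ↦ nabla A x (B x)) y + nabla (mlieBracket (𝓡 n) A B) y := by
    rw [← nabla.isCovariantDerivativeOnUniv.add
      ((hA.covariantDerivative hnabla hB).mdifferentiableAt y)
      ((hA.mlieBracket hB).mdifferentiableAt y)]
    congr 1
    funext x
    simp [← torsionFree hA hB x]
  have : IsManifold (𝓡 n) (minSmoothness ℝ 3) N := .of_le (n := ∞) (by simp; norm_cast)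
  have le2 {A : Π y : N, TangentSpace (𝓡 n) y} (hA : IsSmoothVectorField A) :
      ContMDiffAt (𝓡 n) (𝓡 n).tangent (minSmoothness ℝ 2)
        (fun x ↦ (⟨x, A x⟩ : TangentBundle (𝓡 n) N)) y :=
    (hA y).of_le (by simp; norm_cast)
  have jacobi := leibniz_identity_mlieBracket_apply (le2 hX) (le2 hY) (le2 hZ)
  rw [← torsionFree hX (hY.mlieBracket hZ) y, ← torsionFree hY (hX.mlieBracket hZ) y,
    ← torsionFree (hX.mlieBracket hY) hZ y, ← sub_eq_zero] at jacobi
  have hswap : nabla Y y (mlieBracket (𝓡 n) Z X y) = -nabla Y y (mlieBracket (𝓡 n) X Z y) := by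
    rw [mlieBracket_swap_apply, map_neg]
  simp only [connectionCurvature, hswap, nabla_nabla hX hZ, nabla_nabla hX hY, nabla_nabla hY hZ,
    _root_.add_apply]
  rw [← jacobi]
  abel

variable [IsContMDiffRiemannianBundle (𝓡 n) ∞ (EuclideanSpace ℝ (Fin n))
    (fun x : N ↦ TangentSpace (𝓡 n) x)]

theorem IsSmoothVectorField.contMDiff_inner (hX : IsSmoothVectorField X)
    (hY : IsSmoothVectorField Y) :
    ContMDiff (𝓡 n) 𝓘(ℝ, ℝ) ∞ (fun x ↦ (inner ℝ (X x) (Y x) : ℝ)) :=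
  fun y ↦ ContMDiffAt.inner_bundle (hX y) (hY y)

set_option synthInstance.maxHeartbeats 200000 in
-- The search for the `C^1` structure of the metric from its `C^∞` structure is slow.
theorem IsLeviCivita.mvfderiv_inner (hnabla : IsLeviCivita nabla) (hX : IsSmoothVectorField X)
    (hY : IsSmoothVectorField Y) (Z : Π y : N, TangentSpace (𝓡 n) y) (y : N) :
    mvfderiv (𝓡 n) (fun x ↦ (inner ℝ (X x) (Y x) : ℝ)) y (Z y) =
      inner ℝ (nabla X y (Z y)) (Y y) + inner ℝ (X y) (nabla Y y (Z y)) :=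
  hnabla.metric.mvfderiv_inner_eq Z (hX.mdifferentiableAt y) (hY.mdifferentiableAt y)

theorem mvfderiv_mvfderiv_inner (hnabla : IsLeviCivita nabla)
    (hY : IsSmoothVectorField Y) (hZ : IsSmoothVectorField Z)
    (hW : IsSmoothVectorField W) (y : N) (v : TangentSpace (𝓡 n) y) :
    mvfderiv (𝓡 n) (fun x ↦ mvfderiv (𝓡 n) (fun x ↦ (inner ℝ (Z x) (W x) : ℝ)) x (Y x)) y v =
      inner ℝ (nabla (fun x ↦ nabla Z x (Y x)) y v) (W y) +
        inner ℝ (nabla Z y (Y y)) (nabla W y v) +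
      (inner ℝ (nabla Z y v) (nabla W y (Y y)) +
        inner ℝ (Z y) (nabla (fun x ↦ nabla W x (Y x)) y v)) := by
  have hZY := hZ.covariantDerivative hnabla.smooth hY
  have hWY := hW.covariantDerivative hnabla.smooth hY
  have hfun : (fun x ↦ mvfderiv (𝓡 n) (fun x ↦ (inner ℝ (Z x) (W x) : ℝ)) x (Y x)) =
      (fun x ↦ (inner ℝ (nabla Z x (Y x)) (W x) : ℝ)) +
        fun x ↦ (inner ℝ (Z x) (nabla W x (Y x)) : ℝ) :=
    funext fun x ↦ hnabla.mvfderiv_inner hZ hW Y x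
  obtain ⟨C, rfl⟩ : ∃ C : Π y : N, TangentSpace (𝓡 n) y, C y = v :=
    ⟨FiberBundle.extend (EuclideanSpace ℝ (Fin n)) v, FiberBundle.extend_apply_self ..⟩
  rw [hfun, mvfderiv_add ((hZY.contMDiff_inner hW).mdifferentiable (by simp) y)
    ((hZ.contMDiff_inner hWY).mdifferentiable (by simp) y), _root_.add_apply,
    hnabla.mvfderiv_inner hZY hW, hnabla.mvfderiv_inner hZ hWY]

theorem inner_connectionCurvature_swap (hnabla : IsLeviCivita nabla)
    (hX : IsSmoothVectorField X) (hY : IsSmoothVectorField Y) (hZ : IsSmoothVectorField Z)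
    (hW : IsSmoothVectorField W) (y : N) :
    (inner ℝ (connectionCurvature nabla X Y Z y) (W y) : ℝ) =
      -inner ℝ (connectionCurvature nabla X Y W y) (Z y) := by
  have hbracket := mvfderiv_mlieBracket (hZ.contMDiff_inner hW y) (hX y) (hY y)
  rw [mvfderiv_mvfderiv_inner hnabla hY hZ hW, mvfderiv_mvfderiv_inner hnabla hX hZ hW,
    hnabla.mvfderiv_inner hZ hW (mlieBracket (𝓡 n) X Y)] at hbracket
  simp only [connectionCurvature, inner_sub_left]
  rw [real_inner_comm (Z y) (nabla (fun x ↦ nabla W x (Y x)) y (X y)),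
    real_inner_comm (Z y) (nabla (fun x ↦ nabla W x (X x)) y (Y y)),
    real_inner_comm (Z y) (nabla W y _)]
  linarith

theorem isCurvatureForm_connectionCurvature (hnabla : IsLeviCivita nabla) {y : N}
    {extend : TangentSpace (𝓡 n) y → Π x : N, TangentSpace (𝓡 n) x}
    (hsmooth : ∀ v, IsSmoothVectorField (extend v)) (hextend : ∀ v, extend v y = v) :
    IsCurvatureForm fun x u z w ↦
      (inner ℝ (connectionCurvature nabla (extend x) (extend u) (extend z) y) w : ℝ) := by
  have hR (x u z : TangentSpace (𝓡 n) y) :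
      connectionCurvature nabla (extend x) (extend u) (extend z) y =
        secondCovariantDerivative hnabla.smooth (hsmooth z) y u x -
          secondCovariantDerivative hnabla.smooth (hsmooth z) y x u := by
    rw [connectionCurvature_eq_secondCovariantDerivative hnabla.smooth hnabla.torsionFree
      (hsmooth x) (hsmooth u) (hsmooth z), hextend, hextend]
  constructor
  · intro x x' u z w
    simp only [hR, map_add, _root_.add_apply, inner_add_left, inner_sub_left]
    ring
  · intro x u z w w'
    simp only [inner_add_right]
  · intro x u z w
    simp only [hR, inner_sub_left]
    ring
  · intro x u z w
    have h := inner_connectionCurvature_swap hnabla (hsmooth x) (hsmooth u) (hsmooth z)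
      (hsmooth w) y
    rwa [hextend, hextend] at h
  · intro x u z w
    have h := connectionCurvature_bianchi hnabla.smooth hnabla.torsionFree (hsmooth x) (hsmooth u)
      (hsmooth z) y
    rw [← inner_add_left, ← inner_add_left, h, inner_zero_left]

theorem HasConstantCurvature.connectionCurvature_eq [T2Space N] {c : ℝ}
    (hc : HasConstantCurvature nabla c) (hnabla : IsLeviCivita nabla)
    (hX : IsSmoothVectorField X) (hY : IsSmoothVectorField Y) (hZ : IsSmoothVectorField Z) (y : N) :
    connectionCurvature nabla X Y Z y =
      c • ((inner ℝ (Y y) (Z y) : ℝ) • X y - (inner ℝ (X y) (Z y) : ℝ) • Y y) := by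
  choose extend hsmooth hextend using
    fun v : TangentSpace (𝓡 n) y ↦ exists_contMDiff_vectorField v
  have hform := (isCurvatureForm_connectionCurvature hnabla hsmooth hextend).eq_of_sectional_eq
    (isCurvatureForm_inner c) fun x u ↦ by
      have h := hc (extend x) (extend u) (hsmooth x) (hsmooth u) y
      simp only [hextend] at h
      rw [h, real_inner_comm u x]
      ring
  refine ext_inner_right ℝ fun w ↦ ?_
  have hXYw : connectionCurvature nabla X Y (extend w) y =
      connectionCurvature nabla (extend (X y)) (extend (Y y)) (extend w) y := by
    rw [connectionCurvature_eq_secondCovariantDerivative hnabla.smooth hnabla.torsionFree hX hY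
        (hsmooth w),
      connectionCurvature_eq_secondCovariantDerivative hnabla.smooth hnabla.torsionFree
        (hsmooth (X y)) (hsmooth (Y y)) (hsmooth w), hextend, hextend]
  have hswap := inner_connectionCurvature_swap hnabla hX hY hZ (hsmooth w) y
  rw [hextend, hXYw] at hswap
  have h := congrFun (congrFun (congrFun (congrFun hform (X y)) (Y y)) w) (Z y)
  rw [hswap, h, inner_smul_left, inner_sub_left, inner_smul_left, inner_smul_left]
  simp only [conj_trivial]
  ring

end ConstantCurvature

section OrthonormalFrames

open InnerProductSpace

variable {E : Type*} [NormedAddCommGroup E] [NormedSpace ℝ E]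
  {H : Type*} [TopologicalSpace H] {I : ModelWithCorners ℝ E H}
  {M : Type*} [TopologicalSpace M] [ChartedSpace H M]
  {E' : Type*} [NormedAddCommGroup E'] [NormedSpace ℝ E']
  {H' : Type*} [TopologicalSpace H'] {J : ModelWithCorners ℝ E' H'}
  {N : Type*} [TopologicalSpace N] [ChartedSpace H' N]
  {F : Type*} [NormedAddCommGroup F] [NormedSpace ℝ F] {V : N → Type*}
  [TopologicalSpace (TotalSpace F V)] [∀ y, NormedAddCommGroup (V y)]
  [∀ y, InnerProductSpace ℝ (V y)] [FiberBundle F V] [VectorBundle ℝ F V]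
  {f : M → N} {k : ℕ∞ω} {p : M}

theorem linearIndependent_trivializationAt_snd_iff {ι : Type*} {x y : N} {v : ι → V y}
    (hy : y ∈ (trivializationAt F V x).baseSet) :
    (LinearIndependent ℝ fun i ↦ (trivializationAt F V x ⟨y, v i⟩).2) ↔ LinearIndependent ℝ v := by
  let e := (trivializationAt F V x).continuousLinearEquivAt ℝ y hy
  rw [← LinearMap.linearIndependent_iff (e.toLinearEquiv : V y →ₗ[ℝ] F) e.toLinearEquiv.ker]
  rfl

theorem eventually_linearIndependent {ι : Type*} [Finite ι] {z : ι → Π q, V (f q)}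
    (hz : ∀ i, ContMDiffAlongAt I J F k f (z i) p) (hf : ContinuousAt f p)
    (hlin : LinearIndependent ℝ fun i ↦ z i p) :
    ∀ᶠ q in 𝓝 p, LinearIndependent ℝ fun i ↦ z i q := by
  have hcont : ContinuousAt (fun q i ↦ (trivializationAt F V (f p) ⟨f q, z i q⟩).2) p :=
    continuousAt_pi.2 fun i ↦ (hz i).trivializationAt_snd.continuousAt
  have hopen := hcont.eventually (isOpen_setOfPred_linearIndependent.mem_nhds
    ((linearIndependent_trivializationAt_snd_iff
      (FiberBundle.mem_baseSet_trivializationAt' (f p))).2 hlin))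
  filter_upwards [hopen, eventually_mem_baseSet (F := F) (V := V) hf] with q hq hmem
  exact (linearIndependent_trivializationAt_snd_iff hmem).1 hq

section GramSchmidt

variable [IsContMDiffRiemannianBundle J k F V] {ι : Type*} [LinearOrder ι]
  [LocallyFiniteOrderBot ι] [WellFoundedLT ι] {z : ι → Π q, V (f q)}

theorem contMDiffAlongAt_gramSchmidt (hz : ∀ i, ContMDiffAlongAt I J F k f (z i) p)
    (hlin : LinearIndependent ℝ fun i ↦ z i p) (i : ι) :
    ContMDiffAlongAt I J F k f (fun q ↦ gramSchmidt ℝ (fun i ↦ z i q) i) p := by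
  induction i using WellFoundedLT.induction with
  | ind i ih =>
    simp only [gramSchmidt_def ℝ _ i, Submodule.starProjection_singleton,
      ← real_inner_self_eq_norm_sq, RCLike.ofReal_real_eq_id, id_eq]
    refine (hz i).sub (.sum (hz i).map fun j hj ↦ .smul (.div₀ ?_ ?_ ?_) ?_)
    · exact (ih j (Finset.mem_Iio.1 hj)).inner_bundle (hz i)
    · exact (ih j (Finset.mem_Iio.1 hj)).inner_bundle (ih j (Finset.mem_Iio.1 hj))
    · exact inner_self_ne_zero.2 (gramSchmidt_ne_zero j hlin)
    · exact ih j (Finset.mem_Iio.1 hj)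

theorem contMDiffAlongAt_gramSchmidtNormed (hz : ∀ i, ContMDiffAlongAt I J F k f (z i) p)
    (hlin : LinearIndependent ℝ fun i ↦ z i p) (i : ι) :
    ContMDiffAlongAt I J F k f (fun q ↦ gramSchmidtNormed ℝ (fun i ↦ z i q) i) p := by
  have hi := contMDiffAlongAt_gramSchmidt hz hlin i
  have hne : inner ℝ (gramSchmidt ℝ (fun i ↦ z i p) i) (gramSchmidt ℝ (fun i ↦ z i p) i) ≠
      (0 : ℝ) := inner_self_ne_zero.2 (gramSchmidt_ne_zero i hlin)
  have hinv : ContDiffAt ℝ k (fun t : ℝ ↦ (Real.sqrt t)⁻¹)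
      (inner ℝ (gramSchmidt ℝ (fun i ↦ z i p) i) (gramSchmidt ℝ (fun i ↦ z i p) i)) :=
    (Real.contDiffAt_sqrt hne).inv ((Real.sqrt_ne_zero real_inner_self_nonneg).2 hne)
  simp only [gramSchmidtNormed, norm_eq_sqrt_real_inner, RCLike.ofReal_real_eq_id, id_eq]
  exact .smul (ContMDiffAt.comp (g := fun t : ℝ ↦ (Real.sqrt t)⁻¹) p hinv.contMDiffAt
    (hi.inner_bundle hi)) hi

end GramSchmidt

variable (I J F) in
/-- A smooth orthonormal frame, over an open set, of a family `S` of subspaces of the fibres of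
`V` along `f`. -/
structure OrthonormalFrame (m : ℕ) (S : Π p, Submodule ℝ (V (f p))) where
  baseSet : Set M
  isOpen_baseSet : IsOpen baseSet
  frame : Fin m → Π p, S p
  contMDiffAlongAt_frame : ∀ i, ∀ p ∈ baseSet,
    ContMDiffAlongAt I J F ∞ f (fun q ↦ (frame i q : V (f q))) p
  orthonormal : ∀ p ∈ baseSet, Orthonormal ℝ fun i ↦ frame i p
  span_eq_top : ∀ p ∈ baseSet, Submodule.span ℝ (Set.range fun i ↦ frame i p) = ⊤

theorem gramSchmidtNormed_mem {W : Type*} [NormedAddCommGroup W] [InnerProductSpace ℝ W]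
    {ι : Type*} [LinearOrder ι] [LocallyFiniteOrderBot ι] [WellFoundedLT ι]
    {S : Submodule ℝ W} {z : ι → W} (hz : ∀ i, z i ∈ S) (i : ι) :
    gramSchmidtNormed ℝ z i ∈ S := by
  have hspan : Submodule.span ℝ (Set.range z) ≤ S :=
    Submodule.span_le.2 (Set.range_subset_iff.2 hz)
  rw [← span_gramSchmidt ℝ, ← span_gramSchmidtNormed_range] at hspan
  exact hspan (Submodule.subset_span (Set.mem_range_self i))

theorem exists_orthonormalFrame [IsManifold J ∞ N] [ContMDiffVectorBundle ∞ F V J]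
    [IsContMDiffRiemannianBundle J ∞ F V] {m : ℕ} {S : Π p, Submodule ℝ (V (f p))}
    [∀ p, FiniteDimensional ℝ (S p)] (hf : ContMDiff I J ∞ f)
    (hS : ∀ (ξ : Π p, V (f p)) (p : M), ContMDiffAlongAt I J F ∞ f ξ p →
      ContMDiffAlongAt I J F ∞ f (fun q ↦ (S q).starProjection (ξ q)) p)
    (hrank : ∀ p, Module.finrank ℝ (S p) = m) (p₀ : M) :
    ∃ s : OrthonormalFrame I J F m S, p₀ ∈ s.baseSet := by
  let b := (stdOrthonormalBasis ℝ (S p₀)).reindex (finCongr (hrank p₀))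
  let z (i : Fin m) (q : M) : V (f q) :=
    (S q).starProjection (FiberBundle.extend F (b i : V (f p₀)) (f q))
  have hz_p₀ (i : Fin m) : z i p₀ = b i := by
    simp only [z, FiberBundle.extend_apply_self]
    exact Submodule.starProjection_eq_self_iff.2 (b i).2
  have hz : ∀ᶠ q in 𝓝 p₀, ∀ i, ContMDiffAlongAt I J F ∞ f (z i) q := by
    refine eventually_all.2 fun i ↦ ?_
    obtain ⟨u, hu, hext⟩ := FiberBundle.exists_contMDiffOn_extend (k := ∞) J F (b i : V (f p₀))
    filter_upwards [(hf p₀).continuousAt.eventually (eventually_mem_nhds_iff.2 hu)] with q hq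
    exact hS _ q (.comp (hext.contMDiffAt hq) (hf q))
  have hlin : LinearIndependent ℝ fun i ↦ z i p₀ := by
    simp only [hz_p₀]
    exact (b.orthonormal.comp_linearIsometry (S p₀).subtypeₗᵢ).linearIndependent
  obtain ⟨u, hu, hu_open, hpu⟩ := eventually_nhds_iff.1
    (hz.and (eventually_linearIndependent hz.self_of_nhds (hf p₀).continuousAt hlin))
  have horth (p : M) (hp : p ∈ u) : Orthonormal ℝ fun i ↦
      (⟨gramSchmidtNormed ℝ (fun i ↦ z i p) i,
        gramSchmidtNormed_mem (fun i ↦ Submodule.starProjection_apply_mem _ _) i⟩ : S p) :=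
    (gramSchmidtNormed_orthonormal (hu p hp).2).codRestrict _ _
  exact ⟨{
    baseSet := u
    isOpen_baseSet := hu_open
    frame := fun i p ↦ ⟨gramSchmidtNormed ℝ (fun i ↦ z i p) i,
      gramSchmidtNormed_mem (fun i ↦ Submodule.starProjection_apply_mem _ _) i⟩
    contMDiffAlongAt_frame := fun i p hp ↦
      contMDiffAlongAt_gramSchmidtNormed (hu p hp).1 (hu p hp).2 i
    orthonormal := horth
    span_eq_top := fun p hp ↦ (horth p hp).linearIndependent.span_eq_top_of_card_eq_finrank'
      (by simp [hrank]) }, hpu⟩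

end OrthonormalFrames

section SubspaceBundle

variable {E : Type*} [NormedAddCommGroup E] [NormedSpace ℝ E]
  {H : Type*} [TopologicalSpace H] {I : ModelWithCorners ℝ E H}
  {M : Type*} [TopologicalSpace M] [ChartedSpace H M]
  {E' : Type*} [NormedAddCommGroup E'] [NormedSpace ℝ E']
  {H' : Type*} [TopologicalSpace H'] {J : ModelWithCorners ℝ E' H'}
  {N : Type*} [TopologicalSpace N] [ChartedSpace H' N]
  {F : Type*} [NormedAddCommGroup F] [NormedSpace ℝ F] {V : N → Type*}
  [TopologicalSpace (TotalSpace F V)] [∀ y, NormedAddCommGroup (V y)]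
  [∀ y, InnerProductSpace ℝ (V y)] [FiberBundle F V]
  {m : ℕ} {f : M → N} {S : Π p, Submodule ℝ (V (f p))}

namespace OrthonormalFrame

variable (s t : OrthonormalFrame I J F m S) {p : M}

/-- The orthonormal basis of a subspace given by a frame at a point of its domain. -/
def basis (hp : p ∈ s.baseSet) : OrthonormalBasis (Fin m) ℝ (S p) :=
  .mk (s.orthonormal p hp) (s.span_eq_top p hp).ge

theorem basis_apply (hp : p ∈ s.baseSet) (i : Fin m) : s.basis hp i = s.frame i p := by
  simp [basis]

/-- The coordinates of a vector with respect to a frame. They are given by inner products, hence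
also defined outside the domain of the frame. -/
def coord (p : M) (w : S p) : EuclideanSpace ℝ (Fin m) :=
  WithLp.toLp 2 fun i ↦ inner ℝ (s.frame i p) w

theorem coord_eq_sum_single (w : S p) : s.coord p w =
    ∑ i, (inner ℝ (s.frame i p) w : ℝ) • EuclideanSpace.single i (1 : ℝ) := by
  ext i
  simp [coord, Pi.single_apply]

theorem coord_eq_repr (hp : p ∈ s.baseSet) (w : S p) : s.coord p w = (s.basis hp).repr w := by
  ext i
  simp [coord, OrthonormalBasis.repr_apply_apply, basis_apply]

theorem sum_coord (hp : p ∈ s.baseSet) (w : S p) : ∑ i, s.coord p w i • s.frame i p = w := by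
  simpa only [s.coord_eq_repr hp, basis_apply] using (s.basis hp).sum_repr w

theorem coord_sum (hp : p ∈ s.baseSet) (a : EuclideanSpace ℝ (Fin m)) :
    s.coord p (∑ i, a i • s.frame i p) = a := by
  ext i
  simp only [coord, (s.orthonormal p hp).inner_right_fintype]

/-- The pretrivialization of the family `S` given by the coordinates of a frame. -/
def pretrivialization : Pretrivialization (EuclideanSpace ℝ (Fin m))
    (π (EuclideanSpace ℝ (Fin m)) fun p ↦ S p) where
  toFun z := (z.1, s.coord z.1 z.2)
  invFun z := ⟨z.1, ∑ i, z.2 i • s.frame i z.1⟩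
  source := TotalSpace.proj ⁻¹' s.baseSet
  target := s.baseSet ×ˢ Set.univ
  map_source' _ hz := ⟨hz, trivial⟩
  map_target' _ hz := hz.1
  left_inv' z hz := by rw [s.sum_coord hz]
  right_inv' z hz := by rw [s.coord_sum hz.1]
  open_target := s.isOpen_baseSet.prod isOpen_univ
  baseSet := s.baseSet
  open_baseSet := s.isOpen_baseSet
  source_eq := rfl
  target_eq := rfl
  proj_toFun _ _ := rfl

theorem pretrivialization_symm (hp : p ∈ s.baseSet) (a : EuclideanSpace ℝ (Fin m)) :
    s.pretrivialization.symm p a = ∑ i, a i • s.frame i p := by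
  rw [Pretrivialization.symm_apply _ (by exact hp)]
  rfl

/-- The transition matrix between two frames. -/
def transition (p : M) : EuclideanSpace ℝ (Fin m) →L[ℝ] EuclideanSpace ℝ (Fin m) :=
  ∑ i, ∑ j, (inner ℝ (t.frame j p) (s.frame i p) : ℝ) •
    (EuclideanSpace.proj (𝕜 := ℝ) i).smulRight (EuclideanSpace.single j (1 : ℝ))

theorem transition_apply (hp : p ∈ s.baseSet) (a : EuclideanSpace ℝ (Fin m)) :
    s.transition t p a = t.coord p (s.pretrivialization.symm p a) := by
  rw [s.pretrivialization_symm hp]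
  ext k
  simp [transition, coord, inner_sum, inner_smul_right, Finset.sum_apply, Pi.single_apply,
    mul_comm]

section Smoothness

variable {ξ : Π p, S p}

theorem contMDiffOn_transition [VectorBundle ℝ F V] [IsContMDiffRiemannianBundle J ∞ F V] :
    ContMDiffOn I 𝓘(ℝ, EuclideanSpace ℝ (Fin m) →L[ℝ] EuclideanSpace ℝ (Fin m)) ∞
      (s.transition t) (s.baseSet ∩ t.baseSet) := by
  intro p hp
  refine (ContMDiffAt.sum fun i _ ↦ .sum fun j _ ↦ ?_).contMDiffWithinAt
  have h : CMDiffAt ∞ (fun p ↦ (inner ℝ (t.frame j p) (s.frame i p) : ℝ)) p :=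
    (t.contMDiffAlongAt_frame j p hp.2).inner_bundle (s.contMDiffAlongAt_frame i p hp.1)
  exact h.smul contMDiffAt_const

theorem eventually_eq_sum_coord (hp : p ∈ s.baseSet) (ξ : Π p, S p) :
    ∀ᶠ q in 𝓝 p, (ξ q : V (f q)) = ∑ i, s.coord q (ξ q) i • (s.frame i q : V (f q)) := by
  filter_upwards [s.isOpen_baseSet.mem_nhds hp] with q hq
  conv_lhs => rw [← s.sum_coord hq (ξ q)]
  simp only [AddSubmonoidClass.coe_finsetSum, SetLike.val_smul]

theorem contMDiffAlongAt_iff_coord [VectorBundle ℝ F V] [IsContMDiffRiemannianBundle J ∞ F V]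
    (hp : p ∈ s.baseSet) (hf : ContMDiffAt I J ∞ f p) :
    ContMDiffAlongAt I J F ∞ f (fun q ↦ (ξ q : V (f q))) p ↔
      CMDiffAt ∞ (fun q ↦ s.coord q (ξ q)) p := by
  refine ⟨fun h ↦ ?_, fun h ↦ ?_⟩
  · simp only [coord_eq_sum_single]
    exact .sum fun i _ ↦ .smul ((s.contMDiffAlongAt_frame i p hp).inner_bundle h) contMDiffAt_const
  · exact (ContMDiffAlongAt.sum hf fun i _ ↦ .smul
      ((EuclideanSpace.proj (𝕜 := ℝ) i).contMDiff.contMDiffAt.comp p h)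
      (s.contMDiffAlongAt_frame i p hp)).congr (s.eventually_eq_sum_coord hp ξ)

theorem mdifferentiableAlongAt_iff_coord [VectorBundle ℝ F V]
    [IsContMDiffRiemannianBundle J ∞ F V]
    (hp : p ∈ s.baseSet) (hf : MDifferentiableAt I J f p) :
    MDifferentiableAlongAt I J F f (fun q ↦ (ξ q : V (f q))) p ↔
      MDiffAt (fun q ↦ s.coord q (ξ q)) p := by
  have hframe (i : Fin m) := (s.contMDiffAlongAt_frame i p hp).mdifferentiableAt (by simp)
  refine ⟨fun h ↦ ?_, fun h ↦ ?_⟩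
  · have hsum : (fun q ↦ s.coord q (ξ q)) = ∑ i, fun q ↦
        (inner ℝ (s.frame i q : V (f q)) (ξ q) : ℝ) • EuclideanSpace.single i (1 : ℝ) := by
      ext1 q
      simp only [coord_eq_sum_single, Finset.sum_apply, Submodule.coe_inner]
    rw [hsum]
    exact .sum fun i _ ↦ ((hframe i).inner_bundle h).smul mdifferentiableAt_const
  · exact (MDifferentiableAlongAt.sum hf fun i _ ↦ .smul
      ((EuclideanSpace.proj (𝕜 := ℝ) i).mdifferentiableAt.comp p h) (hframe i)).congr
      (s.eventually_eq_sum_coord hp ξ)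

end Smoothness

variable [VectorBundle ℝ F V] [IsContMDiffRiemannianBundle J ∞ F V]
  (s : M → OrthonormalFrame I J F m S) (hs : ∀ p, p ∈ (s p).baseSet)

/-- The vector prebundle structure on `S` whose pretrivializations are given by the orthonormal
frames. -/
def vectorPrebundle : VectorPrebundle ℝ (EuclideanSpace ℝ (Fin m)) (fun p ↦ S p) where
  pretrivializationAtlas := Set.range (pretrivialization (I := I) (J := J) (F := F))
  pretrivialization_linear' := by
    rintro _ ⟨t, rfl⟩
    refine ⟨fun _ _ ↦ ⟨fun v w ↦ ?_, fun a v ↦ ?_⟩⟩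
    · ext i
      exact inner_add_right _ _ _
    · ext i
      exact inner_smul_right _ _ _
  pretrivializationAt p := (s p).pretrivialization
  mem_base_pretrivializationAt := hs
  pretrivialization_mem_atlas p := ⟨s p, rfl⟩
  exists_coordChange := by
    rintro _ ⟨t, rfl⟩ _ ⟨t', rfl⟩
    exact ⟨t.transition t', (t.contMDiffOn_transition t').continuousOn,
      fun _ hp a ↦ t.transition_apply t' hp.1 a⟩
  totalSpaceMk_isInducing p := by
    have hrepr : (fun w ↦ (s p).coord p w) = ((s p).basis (hs p)).repr :=
      funext fun w ↦ (s p).coord_eq_repr (hs p) w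
    refine Topology.isInducing_const_prod.2 (?_ : Topology.IsInducing fun w ↦ (s p).coord p w)
    rw [hrepr]
    exact ((s p).basis (hs p)).repr.toHomeomorph.isInducing

instance isContMDiff_vectorPrebundle : (vectorPrebundle s hs).IsContMDiff I ∞ where
  exists_contMDiffCoordChange := by
    rintro _ ⟨t, rfl⟩ _ ⟨t', rfl⟩
    exact ⟨t.transition t', t.contMDiffOn_transition t',
      fun _ hp a ↦ t.transition_apply t' hp.1 a⟩

end OrthonormalFrame

section RiemannianBundle

variable [TopologicalSpace (TotalSpace (EuclideanSpace ℝ (Fin m)) fun p ↦ S p)]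
  [FiberBundle (EuclideanSpace ℝ (Fin m)) fun p ↦ S p]
  [VectorBundle ℝ (EuclideanSpace ℝ (Fin m)) fun p ↦ S p]
  {s : M → OrthonormalFrame I J F m S}

theorem OrthonormalFrame.isContMDiffRiemannianBundle (hs : ∀ p, p ∈ (s p).baseSet)
    (hbase : ∀ p, (s p).baseSet ⊆
      (trivializationAt (EuclideanSpace ℝ (Fin m)) (fun p ↦ S p) p).baseSet)
    (htriv : ∀ p q (w : S q),
      (trivializationAt (EuclideanSpace ℝ (Fin m)) (fun p ↦ S p) p ⟨q, w⟩).2 = (s p).coord q w) :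
    IsContMDiffRiemannianBundle I ∞ (EuclideanSpace ℝ (Fin m)) (fun p ↦ S p) := by
  refine ⟨fun p ↦ innerSL ℝ, fun p ↦ ?_, fun p v w ↦ rfl⟩
  rw [contMDiffAt_section]
  refine ContMDiffAt.congr_of_eventuallyEq (f := fun _ ↦ (show EuclideanSpace ℝ (Fin m) →L[ℝ]
    EuclideanSpace ℝ (Fin m) →L[ℝ] ℝ from innerSL ℝ)) contMDiffAt_const ?_
  filter_upwards [(s p).isOpen_baseSet.mem_nhds (hs p)] with q hq
  have hsymm (a : EuclideanSpace ℝ (Fin m)) :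
      (trivializationAt (EuclideanSpace ℝ (Fin m)) (fun p ↦ S p) p).symm q a =
        ((s p).basis hq).repr.symm a := by
    rw [LinearIsometryEquiv.eq_symm_apply, ← (s p).coord_eq_repr hq, ← htriv,
      Trivialization.apply_mk_symm _ (hbase p hq)]
  ext v w
  rw [hom_trivializationAt_apply,
    inCoordinates_apply_eq₂ (hbase p hq) (hbase p hq) (Set.mem_univ q)]
  simp only [hsymm, Trivial.fiberBundle_trivializationAt', Trivial.linearMapAt_trivialization,
    LinearMap.id_coe, id_eq]
  exact ((s p).basis hq).repr.symm.inner_map_map v w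

end RiemannianBundle

theorem exists_subspaceBundle [VectorBundle ℝ F V] [IsContMDiffRiemannianBundle J ∞ F V]
    (hf : ContMDiff I J ∞ f) (hS : ∀ p, ∃ s : OrthonormalFrame I J F m S, p ∈ s.baseSet) :
    ∃ (_ : TopologicalSpace (TotalSpace (EuclideanSpace ℝ (Fin m)) fun p ↦ S p))
      (_ : FiberBundle (EuclideanSpace ℝ (Fin m)) fun p ↦ S p)
      (_ : VectorBundle ℝ (EuclideanSpace ℝ (Fin m)) fun p ↦ S p)
      (_ : ContMDiffVectorBundle ∞ (EuclideanSpace ℝ (Fin m)) (fun p ↦ S p) I)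
      (_ : IsContMDiffRiemannianBundle I ∞ (EuclideanSpace ℝ (Fin m)) fun p ↦ S p),
      (∀ (ξ : Π p, S p) (p : M),
        ContMDiffAt I (I.prod 𝓘(ℝ, EuclideanSpace ℝ (Fin m))) ∞
          (fun q ↦ TotalSpace.mk' (EuclideanSpace ℝ (Fin m)) q (ξ q)) p ↔
        ContMDiffAlongAt I J F ∞ f (fun q ↦ (ξ q : V (f q))) p) ∧
      ∀ (ξ : Π p, S p) (p : M),
        MDifferentiableAt I (I.prod 𝓘(ℝ, EuclideanSpace ℝ (Fin m)))
          (fun q ↦ TotalSpace.mk' (EuclideanSpace ℝ (Fin m)) q (ξ q)) p ↔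
        MDifferentiableAlongAt I J F f (fun q ↦ (ξ q : V (f q))) p := by
  choose s hs using hS
  let b := OrthonormalFrame.vectorPrebundle s hs
  let _ := b.totalSpaceTopology
  let _ := b.toFiberBundle
  have := b.toVectorBundle
  refine ⟨inferInstance, inferInstance, inferInstance, b.contMDiffVectorBundle I,
    OrthonormalFrame.isContMDiffRiemannianBundle hs (fun _ ↦ subset_rfl) fun _ _ _ ↦ rfl,
    fun ξ p ↦ ?_, fun ξ p ↦ ?_⟩
  · rw [contMDiffAt_section]
    exact ((s p).contMDiffAlongAt_iff_coord (hs p) (hf p)).symm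
  · rw [mdifferentiableAt_section]
    exact ((s p).mdifferentiableAlongAt_iff_coord (hs p) ((hf p).mdifferentiableAt (by simp))).symm

end SubspaceBundle

section HomBundle

variable {E : Type*} [NormedAddCommGroup E] [NormedSpace ℝ E]
  {H : Type*} [TopologicalSpace H] {I : ModelWithCorners ℝ E H}
  {M : Type*} [TopologicalSpace M] [ChartedSpace H M]
  {F : Type*} [NormedAddCommGroup F] [NormedSpace ℝ F] [FiniteDimensional ℝ F]
  {F' : Type*} [NormedAddCommGroup F'] [NormedSpace ℝ F'] {p : M}

theorem contMDiffAt_clm_of_apply {k : ℕ∞ω} {L : M → F →L[ℝ] F'}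
    (hL : ∀ v, CMDiffAt k (fun q ↦ L q v) p) : CMDiffAt k L p := by
  let b := Module.finBasis ℝ F
  have hsum : L = fun q ↦ ∑ i, ContinuousLinearMap.smulRightL ℝ F F'
      (b.coord i).toContinuousLinearMap (L q (b i)) := by
    ext q v
    conv_lhs => rw [← b.sum_repr v, map_sum]
    simp
  rw [hsum]
  exact .sum fun i _ ↦ (ContinuousLinearMap.contMDiff _).contMDiffAt.comp p (hL (b i))

theorem contMDiffAt_hom_of_apply
    {V : M → Type*} [TopologicalSpace (TotalSpace F V)] [∀ x, AddCommGroup (V x)]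
    [∀ x, Module ℝ (V x)] [∀ x, TopologicalSpace (V x)] [FiberBundle F V] [VectorBundle ℝ F V]
    [ContMDiffVectorBundle ∞ F V I]
    {V' : M → Type*} [TopologicalSpace (TotalSpace F' V')] [∀ x, AddCommGroup (V' x)]
    [∀ x, Module ℝ (V' x)] [∀ x, TopologicalSpace (V' x)]
    [∀ x, IsTopologicalAddGroup (V' x)] [∀ x, ContinuousSMul ℝ (V' x)] [FiberBundle F' V']
    [VectorBundle ℝ F' V'] {φ : Π x, V x →L[ℝ] V' x}
    (hφ : ∀ Z : Π x, V x, CMDiffAt ∞ (T% Z) p → CMDiffAt ∞ (T% fun x ↦ φ x (Z x)) p) :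
    ContMDiffAt I (I.prod 𝓘(ℝ, F →L[ℝ] F')) ∞
      (fun x ↦ TotalSpace.mk' (F →L[ℝ] F') x (φ x)) p := by
  rw [contMDiffAt_hom_bundle]
  refine ⟨contMDiffAt_id, contMDiffAt_clm_of_apply fun v ↦ ?_⟩
  have hp := FiberBundle.mem_baseSet_trivializationAt' (F := F) (E := V) p
  have hp' := FiberBundle.mem_baseSet_trivializationAt' (F := F') (E := V') p
  have h := (contMDiffAt_section _).1 (hφ _ (FiberBundle.contMDiffAt_extend I F
    ((trivializationAt F V p).symm p v)))
  refine h.congr_of_eventuallyEq ?_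
  filter_upwards [(trivializationAt F V p).open_baseSet.mem_nhds hp,
    (trivializationAt F' V' p).open_baseSet.mem_nhds hp'] with q hq hq'
  rw [ContinuousLinearMap.inCoordinates_eq hq hq', FiberBundle.extend]
  simp [Trivialization.apply_mk_symm _ hp]

end HomBundle

section InducedConnection

variable {E : Type*} [NormedAddCommGroup E] [NormedSpace ℝ E]
  {H : Type*} [TopologicalSpace H] {I : ModelWithCorners ℝ E H}
  {M : Type*} [TopologicalSpace M] [ChartedSpace H M]
  {E' : Type*} [NormedAddCommGroup E'] [NormedSpace ℝ E']
  {H' : Type*} [TopologicalSpace H'] {J : ModelWithCorners ℝ E' H'}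
  {N : Type*} [TopologicalSpace N] [ChartedSpace H' N]
  {F : Type*} [NormedAddCommGroup F] [NormedSpace ℝ F] {V : N → Type*}
  [TopologicalSpace (TotalSpace F V)] [∀ y, NormedAddCommGroup (V y)]
  [∀ y, InnerProductSpace ℝ (V y)] [FiberBundle F V]
  {f : M → N} {S : Π p, Submodule ℝ (V (f p))} [∀ p, (S p).HasOrthogonalProjection]

/-- A bundle structure on a family `S` of subspaces of the fibres of `f^*V` is that of a smooth
subbundle: its sections are smooth or differentiable if and only if they are so as sections along
`f`, and the orthogonal projection to it preserves smoothness. -/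
structure IsSubbundleAlong (I : ModelWithCorners ℝ E H) (J : ModelWithCorners ℝ E' H')
    (F F₁ : Type*) [NormedAddCommGroup F] [NormedSpace ℝ F] [NormedAddCommGroup F₁]
    [NormedSpace ℝ F₁] {V : N → Type*} [TopologicalSpace (TotalSpace F V)]
    [∀ y, NormedAddCommGroup (V y)] [∀ y, InnerProductSpace ℝ (V y)] [FiberBundle F V]
    {f : M → N} (S : Π p, Submodule ℝ (V (f p))) [∀ p, (S p).HasOrthogonalProjection]
    [TopologicalSpace (TotalSpace F₁ fun p ↦ S p)] [FiberBundle F₁ fun p ↦ S p] : Prop where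
  contMDiffAt_iff (ξ : Π p, S p) (p : M) :
    ContMDiffAt I (I.prod 𝓘(ℝ, F₁)) ∞ (fun q ↦ TotalSpace.mk' F₁ q (ξ q)) p ↔
      ContMDiffAlongAt I J F ∞ f (fun q ↦ (ξ q : V (f q))) p
  mdifferentiableAt_iff (ξ : Π p, S p) (p : M) :
    MDifferentiableAt I (I.prod 𝓘(ℝ, F₁)) (fun q ↦ TotalSpace.mk' F₁ q (ξ q)) p ↔
      MDifferentiableAlongAt I J F f (fun q ↦ (ξ q : V (f q))) p
  contMDiffAlongAt_starProjection {ξ : Π p, V (f p)} {p : M}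
    (hξ : ContMDiffAlongAt I J F ∞ f ξ p) :
    ContMDiffAlongAt I J F ∞ f (fun q ↦ (S q).starProjection (ξ q)) p

theorem exists_isSubbundleAlong [VectorBundle ℝ F V] [IsManifold J ∞ N]
    [ContMDiffVectorBundle ∞ F V J] [IsContMDiffRiemannianBundle J ∞ F V]
    [∀ p, FiniteDimensional ℝ (S p)] {m : ℕ} (hf : ContMDiff I J ∞ f)
    (hS : ∀ (ξ : Π p, V (f p)) (p : M), ContMDiffAlongAt I J F ∞ f ξ p →
      ContMDiffAlongAt I J F ∞ f (fun q ↦ (S q).starProjection (ξ q)) p)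
    (hrank : ∀ p, Module.finrank ℝ (S p) = m) :
    ∃ (_ : TopologicalSpace (TotalSpace (EuclideanSpace ℝ (Fin m)) fun p ↦ S p))
      (_ : FiberBundle (EuclideanSpace ℝ (Fin m)) fun p ↦ S p)
      (_ : VectorBundle ℝ (EuclideanSpace ℝ (Fin m)) fun p ↦ S p)
      (_ : ContMDiffVectorBundle ∞ (EuclideanSpace ℝ (Fin m)) (fun p ↦ S p) I)
      (_ : IsContMDiffRiemannianBundle I ∞ (EuclideanSpace ℝ (Fin m)) fun p ↦ S p),
      IsSubbundleAlong I J F (EuclideanSpace ℝ (Fin m)) S := by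
  obtain ⟨h₁, h₂, h₃, h₄, h₅, hsmooth, hdiff⟩ :=
    exists_subspaceBundle hf (exists_orthonormalFrame (I := I) (J := J) (F := F) hf hS hrank)
  exact ⟨h₁, h₂, h₃, h₄, h₅, hsmooth, hdiff, fun hξ ↦ hS _ _ hξ⟩

variable {F₁ : Type*} [NormedAddCommGroup F₁] [NormedSpace ℝ F₁]
  [TopologicalSpace (TotalSpace F₁ fun p ↦ S p)] [FiberBundle F₁ fun p ↦ S p]

theorem IsSubbundleAlong.contMDiffAt_hom_of_apply [IsManifold I ∞ M] [FiniteDimensional ℝ E]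
    [VectorBundle ℝ F₁ fun p ↦ S p] (hE : IsSubbundleAlong I J F F₁ S) {p : M}
    {φ : Π q, TangentSpace I q →L[ℝ] S q}
    (hφ : ∀ X : Π q : M, TangentSpace I q, CMDiffAt ∞ (T% X) p →
      ContMDiffAlongAt I J F ∞ f (fun q ↦ (φ q (X q) : V (f q))) p) :
    ContMDiffAt I (I.prod 𝓘(ℝ, E →L[ℝ] F₁)) ∞
      (fun q ↦ TotalSpace.mk' (E →L[ℝ] F₁) (E := fun q ↦ TangentSpace I q →L[ℝ] S q) q (φ q)) p :=
  _root_.contMDiffAt_hom_of_apply (V := fun q : M ↦ TangentSpace I q) fun X hX ↦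
    (hE.contMDiffAt_iff (fun q ↦ φ q (X q)) p).2 (hφ X hX)

theorem ContMDiffAlongAt.starProjection_orthogonal [VectorBundle ℝ F V]
    (hE : IsSubbundleAlong I J F F₁ S) {ξ : Π p, V (f p)} {p : M}
    (hξ : ContMDiffAlongAt I J F ∞ f ξ p) :
    ContMDiffAlongAt I J F ∞ f (fun q ↦ (S q)ᗮ.starProjection (ξ q)) p := by
  simp only [Submodule.starProjection_orthogonal_val]
  exact hξ.sub (hE.contMDiffAlongAt_starProjection hξ)

namespace IsSubbundleAlong

variable [VectorBundle ℝ F V] (hE : IsSubbundleAlong I J F F₁ S) (cov : CovariantDerivative J F V)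

/-- The connection on a subbundle of `f^*V` whose covariant derivative is the orthogonal projection
of the one of a connection on `V`. -/
def inducedConnection : CovariantDerivative I F₁ fun p ↦ S p where
  toFun ξ p := (S p).orthogonalProjectionOnto.comp
    (covariantDerivativeAlong cov f (fun q ↦ (ξ q : V (f q))) p)
  isCovariantDerivativeOnUniv :=
    { add := fun {ξ η p} hξ hη _ ↦ by
        have hadd := covariantDerivativeAlong_add cov ((hE.mdifferentiableAt_iff ξ p).1 hξ)
          ((hE.mdifferentiableAt_iff η p).1 hη)
        exact (congrArg (S p).orthogonalProjectionOnto.comp hadd).trans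
          (ContinuousLinearMap.comp_add ..)
      leibniz := fun {ξ g p} hξ hg _ ↦ by
        have hsmul := covariantDerivativeAlong_smul cov hg ((hE.mdifferentiableAt_iff ξ p).1 hξ)
        refine (congrArg (S p).orthogonalProjectionOnto.comp hsmul).trans ?_
        ext1 v
        simp [Submodule.orthogonalProjectionOnto_mem_subspace_eq_self] }

variable {cov} {p : M}

theorem inner_inducedConnection (ξ : Π q, S q) (v : TangentSpace I p) (w : S p) :
    (inner ℝ (hE.inducedConnection cov ξ p v) w : ℝ) =
      inner ℝ (covariantDerivativeAlong cov f (fun q ↦ (ξ q : V (f q))) p v) (w : V (f p)) :=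
  Submodule.inner_orthogonalProjectionOnto_eq_of_mem_right w _

end IsSubbundleAlong

end InducedConnection

section ConnectionOnSubbundles

variable {E : Type*} [NormedAddCommGroup E] [NormedSpace ℝ E]
  {H : Type*} [TopologicalSpace H] {I : ModelWithCorners ℝ E H}
  {M : Type*} [TopologicalSpace M] [ChartedSpace H M]
  {E' : Type*} [NormedAddCommGroup E'] [NormedSpace ℝ E'] [FiniteDimensional ℝ E']
  {H' : Type*} [TopologicalSpace H'] {J : ModelWithCorners ℝ E' H'}
  {N : Type*} [TopologicalSpace N] [T2Space N] [ChartedSpace H' N] [IsManifold J ∞ N]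
  {F : Type*} [NormedAddCommGroup F] [NormedSpace ℝ F] [FiniteDimensional ℝ F] {V : N → Type*}
  [TopologicalSpace (TotalSpace F V)] [∀ y, NormedAddCommGroup (V y)]
  [∀ y, InnerProductSpace ℝ (V y)] [FiberBundle F V] [VectorBundle ℝ F V]
  [ContMDiffVectorBundle ∞ F V J] {cov : CovariantDerivative J F V} {f : M → N} {p : M}

theorem inner_covariantDerivativeAlong_eq_neg [IsContMDiffRiemannianBundle J ∞ F V]
    (hcov : cov.IsMetricCompatible) {ξ η : Π q, V (f q)}
    (hξ : MDifferentiableAlongAt I J F f ξ p) (hη : MDifferentiableAlongAt I J F f η p) {a : ℝ}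
    (hconst : ∀ q, (inner ℝ (ξ q) (η q) : ℝ) = a) (v : TangentSpace I p) :
    (inner ℝ (covariantDerivativeAlong cov f ξ p v) (η p) : ℝ) =
      -inner ℝ (ξ p) (covariantDerivativeAlong cov f η p v) := by
  have h := innerProductRule_of_isMetricCompatible hcov hξ hη v
  rw [InnerProductRule, funext hconst, mvfderiv_const, _root_.zero_apply] at h
  exact eq_neg_of_add_eq_zero_left h.symm

namespace IsSubbundleAlong

variable {S : Π p, Submodule ℝ (V (f p))} [∀ p, (S p).HasOrthogonalProjection]
  {F₁ : Type*} [NormedAddCommGroup F₁] [NormedSpace ℝ F₁]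
  [TopologicalSpace (TotalSpace F₁ fun p ↦ S p)] [FiberBundle F₁ fun p ↦ S p]
  (hE : IsSubbundleAlong I J F F₁ S)
include hE

theorem isMetricCompatible_inducedConnection [FiniteDimensional ℝ F₁]
    [VectorBundle ℝ F₁ fun p ↦ S p] [IsManifold I ∞ M]
    [ContMDiffVectorBundle ∞ F₁ (fun p ↦ S p) I] [IsContMDiffRiemannianBundle J ∞ F V]
    [IsContMDiffRiemannianBundle I ∞ F₁ fun p ↦ S p]
    (hcov : cov.IsMetricCompatible) : (hE.inducedConnection cov).IsMetricCompatible := by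
  rw [CovariantDerivative.isMetricCompatible_iff]
  intro x X σ τ _ hσ hτ
  have h := innerProductRule_of_isMetricCompatible hcov ((hE.mdifferentiableAt_iff σ x).1 hσ)
    ((hE.mdifferentiableAt_iff τ x).1 hτ) (X x)
  exact h.trans (congrArg₂ (· + ·)
    (Submodule.inner_orthogonalProjectionOnto_eq_of_mem_right _ _).symm
    (Submodule.inner_orthogonalProjectionOnto_eq_of_mem_left _ _).symm)

theorem contMDiffAt_inducedConnection [IsManifold I ∞ M]
    (hcov : cov.ContMDiffCovariantDerivative ∞) {ξ : Π q, S q}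
    (hξ : ContMDiffAlongAt I J F ∞ f (fun q ↦ (ξ q : V (f q))) p) {X : Π q : M, TangentSpace I q}
    (hX : CMDiffAt ∞ (T% X) p) :
    ContMDiffAlongAt I J F ∞ f (fun q ↦ (hE.inducedConnection cov ξ q (X q) : V (f q))) p :=
  hE.contMDiffAlongAt_starProjection (contMDiffAt_covariantDerivativeAlong hcov hξ hX)

theorem contMDiffCovariantDerivative_inducedConnection [IsManifold I ∞ M] [FiniteDimensional ℝ E]
    [VectorBundle ℝ F₁ fun p ↦ S p] (hcov : cov.ContMDiffCovariantDerivative ∞) :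
    (hE.inducedConnection cov).ContMDiffCovariantDerivative ∞ := by
  refine ⟨⟨fun {ξ} hξ p _ ↦ ContMDiffAt.contMDiffWithinAt ?_⟩⟩
  have hξp := (hE.contMDiffAt_iff ξ p).1 (hξ.contMDiffAt univ_mem)
  exact hE.contMDiffAt_hom_of_apply fun X hX ↦ hE.contMDiffAt_inducedConnection hcov hξp hX

theorem inner_inducedConnection_inducedConnection [IsManifold I ∞ M]
    [IsContMDiffRiemannianBundle J ∞ F V] (hmetric : cov.IsMetricCompatible)
    (hcov : cov.ContMDiffCovariantDerivative ∞) {ξ ζ : Π q, S q}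
    (hξ : ContMDiffAlongAt I J F ∞ f (fun q ↦ (ξ q : V (f q))) p)
    (hζ : MDifferentiableAlongAt I J F f (fun q ↦ (ζ q : V (f q))) p)
    {X : Π q : M, TangentSpace I q} (hX : CMDiffAt ∞ (T% X) p) (v : TangentSpace I p) :
    (inner ℝ (hE.inducedConnection cov (fun q ↦ hE.inducedConnection cov ξ q (X q)) p v)
        (ζ p) : ℝ) =
      inner ℝ (covariantDerivativeAlong cov f
        (fun q ↦ covariantDerivativeAlong cov f (fun q ↦ (ξ q : V (f q))) q (X q)) p v)
        (ζ p : V (f p)) +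
      inner ℝ ((S p)ᗮ.starProjection
          (covariantDerivativeAlong cov f (fun q ↦ (ξ q : V (f q))) p (X p)))
        (covariantDerivativeAlong cov f (fun q ↦ (ζ q : V (f q))) p v) := by
  set ξX : Π q, V (f q) :=
    fun q ↦ covariantDerivativeAlong cov f (fun q ↦ (ξ q : V (f q))) q (X q)
  have hξX : ContMDiffAlongAt I J F ∞ f ξX p := contMDiffAt_covariantDerivativeAlong hcov hξ hX
  have hnormal : MDifferentiableAlongAt I J F f (fun q ↦ (S q)ᗮ.starProjection (ξX q)) p :=
    (hξX.starProjection_orthogonal hE).mdifferentiableAt (by simp)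
  have htangent : MDifferentiableAlongAt I J F f (fun q ↦ (S q).starProjection (ξX q)) p :=
    (hE.contMDiffAlongAt_starProjection hξX).mdifferentiableAt (by simp)
  have horth := inner_covariantDerivativeAlong_eq_neg hmetric hnormal hζ (fun q ↦
    Submodule.inner_left_of_mem_orthogonal (ζ q).2 (Submodule.starProjection_apply_mem _ _)) v
  have hsplit : ξX = fun q ↦ (S q).starProjection (ξX q) + (S q)ᗮ.starProjection (ξX q) :=
    funext fun q ↦ (Submodule.starProjection_add_starProjection_orthogonal _).symm
  conv_rhs => enter [1]; rw [hsplit, covariantDerivativeAlong_add cov htangent hnormal,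
    _root_.add_apply, inner_add_left, horth]
  rw [neg_add_cancel_right]
  exact hE.inner_inducedConnection _ v (ζ p)

end IsSubbundleAlong

end ConnectionOnSubbundles

section CurvatureOfSubbundles

variable {m k : ℕ}
  {M : Type*} [TopologicalSpace M] [ChartedSpace (EuclideanSpace ℝ (Fin m)) M]
  [IsManifold (𝓡 m) ∞ M]
  {E' : Type*} [NormedAddCommGroup E'] [NormedSpace ℝ E'] [FiniteDimensional ℝ E']
  {H' : Type*} [TopologicalSpace H'] {J : ModelWithCorners ℝ E' H'}
  {N : Type*} [TopologicalSpace N] [T2Space N] [ChartedSpace H' N] [IsManifold J ∞ N]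
  {F : Type*} [NormedAddCommGroup F] [NormedSpace ℝ F] [FiniteDimensional ℝ F] {V : N → Type*}
  [TopologicalSpace (TotalSpace F V)] [∀ y, NormedAddCommGroup (V y)]
  [∀ y, InnerProductSpace ℝ (V y)] [FiberBundle F V] [VectorBundle ℝ F V]
  [ContMDiffVectorBundle ∞ F V J] [IsContMDiffRiemannianBundle J ∞ F V]
  {cov : CovariantDerivative J F V} {f : M → N}
  {S : Π p, Submodule ℝ (V (f p))} [∀ p, (S p).HasOrthogonalProjection]
  [TopologicalSpace (TotalSpace (EuclideanSpace ℝ (Fin k)) fun p ↦ S p)]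
  [FiberBundle (EuclideanSpace ℝ (Fin k)) fun p ↦ S p]

theorem IsSubbundleAlong.inner_connectionCurvature
    (hE : IsSubbundleAlong (𝓡 m) J F (EuclideanSpace ℝ (Fin k)) S)
    (hmetric : cov.IsMetricCompatible) (hcov : cov.ContMDiffCovariantDerivative ∞)
    {X Y : Π p : M, TangentSpace (𝓡 m) p} (hX : IsSmoothVectorField X)
    (hY : IsSmoothVectorField Y) {ξ ζ : Π p, S p} {p : M}
    (hξ : ContMDiffAlongAt (𝓡 m) J F ∞ f (fun q ↦ (ξ q : V (f q))) p)
    (hζ : MDifferentiableAlongAt (𝓡 m) J F f (fun q ↦ (ζ q : V (f q))) p) :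
    (inner ℝ (connectionCurvature (hE.inducedConnection cov) X Y ξ p) (ζ p) : ℝ) =
      inner ℝ (curvatureAlong cov f X Y (fun q ↦ (ξ q : V (f q))) p) (ζ p : V (f p)) +
      inner ℝ ((S p)ᗮ.starProjection
          (covariantDerivativeAlong cov f (fun q ↦ (ξ q : V (f q))) p (Y p)))
        (covariantDerivativeAlong cov f (fun q ↦ (ζ q : V (f q))) p (X p)) -
      inner ℝ ((S p)ᗮ.starProjection
          (covariantDerivativeAlong cov f (fun q ↦ (ξ q : V (f q))) p (X p)))
        (covariantDerivativeAlong cov f (fun q ↦ (ζ q : V (f q))) p (Y p)) := by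
  simp only [connectionCurvature, curvatureAlong, inner_sub_left]
  rw [hE.inner_inducedConnection_inducedConnection hmetric hcov hξ hζ (hY p),
    hE.inner_inducedConnection_inducedConnection hmetric hcov hξ hζ (hX p),
    hE.inner_inducedConnection]
  ring

end CurvatureOfSubbundles

section UnitNormal

variable {m : ℕ}
  {M : Type*} [TopologicalSpace M] [ChartedSpace (EuclideanSpace ℝ (Fin m)) M]
  {N : Type*} [TopologicalSpace N] [ChartedSpace (EuclideanSpace ℝ (Fin (m + 1))) N]
  [IsManifold (𝓡 (m + 1)) ∞ N] [RiemannianBundle (fun x : N ↦ TangentSpace (𝓡 (m + 1)) x)]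
  {f : M → N} {ν : Π p : M, TangentSpace (𝓡 (m + 1)) (f p)} {p : M}

namespace IsUnitNormalOn

theorem norm_eq_one {U : Set M} (hν : IsUnitNormalOn f ν U) (hp : p ∈ U) : ‖ν p‖ = 1 := by
  rw [norm_eq_sqrt_real_inner, hν.unit p hp, Real.sqrt_one]

variable (hν : IsUnitNormalOn f ν Set.univ)
include hν

theorem contMDiffAt (p : M) :
    ContMDiffAlongAt (𝓡 m) (𝓡 (m + 1)) (EuclideanSpace ℝ (Fin (m + 1))) ∞ f ν p :=
  hν.smooth.contMDiffAt univ_mem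

theorem mdifferentiableAt (p : M) :
    MDifferentiableAlongAt (𝓡 m) (𝓡 (m + 1)) (EuclideanSpace ℝ (Fin (m + 1))) f ν p :=
  (hν.contMDiffAt p).mdifferentiableAt (by simp)

theorem ne_zero (p : M) : ν p ≠ 0 :=
  norm_ne_zero_iff.1 (by simp [hν.norm_eq_one (Set.mem_univ p)])

theorem starProjection_normalPerp (w : TangentSpace (𝓡 (m + 1)) (f p)) :
    (Submodule.span ℝ {ν p})ᗮ.starProjection w = w - (inner ℝ (ν p) w : ℝ) • ν p := by
  rw [Submodule.starProjection_orthogonal_val,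
    Submodule.starProjection_unit_singleton ℝ (hν.norm_eq_one (Set.mem_univ p))]

theorem starProjection_orthogonal_normalPerp (w : TangentSpace (𝓡 (m + 1)) (f p)) :
    (Submodule.span ℝ {ν p})ᗮᗮ.starProjection w = (inner ℝ (ν p) w : ℝ) • ν p := by
  rw [Submodule.starProjection_orthogonal_val, hν.starProjection_normalPerp, sub_sub_cancel]

theorem exists_isSubbundleAlong
    [IsContMDiffRiemannianBundle (𝓡 (m + 1)) ∞ (EuclideanSpace ℝ (Fin (m + 1)))
      (fun x : N ↦ TangentSpace (𝓡 (m + 1)) x)] (hf : ContMDiff (𝓡 m) (𝓡 (m + 1)) ∞ f) :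
    ∃ (_ : TopologicalSpace (TotalSpace (EuclideanSpace ℝ (Fin m)) (NormalPerp f ν)))
      (_ : FiberBundle (EuclideanSpace ℝ (Fin m)) (NormalPerp f ν))
      (_ : VectorBundle ℝ (EuclideanSpace ℝ (Fin m)) (NormalPerp f ν))
      (_ : ContMDiffVectorBundle ∞ (EuclideanSpace ℝ (Fin m)) (NormalPerp f ν) (𝓡 m))
      (_ : IsContMDiffRiemannianBundle (𝓡 m) ∞ (EuclideanSpace ℝ (Fin m)) (NormalPerp f ν)),
      IsSubbundleAlong (𝓡 m) (𝓡 (m + 1)) (EuclideanSpace ℝ (Fin (m + 1)))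
        (EuclideanSpace ℝ (Fin m)) fun p ↦ (Submodule.span ℝ {ν p})ᗮ := by
  have hdim (p : M) : Module.finrank ℝ (TangentSpace (𝓡 (m + 1)) (f p)) = m + 1 :=
    finrank_euclideanSpace_fin
  have hfin (p : M) : FiniteDimensional ℝ (TangentSpace (𝓡 (m + 1)) (f p)) :=
    .of_finrank_eq_succ (hdim p)
  refine _root_.exists_isSubbundleAlong hf (fun ξ p hξ ↦ ?_) fun p ↦ ?_
  · simp only [hν.starProjection_normalPerp]
    exact hξ.sub (.smul (ContMDiffAt.inner_bundle (hν.contMDiffAt p) hξ) (hν.contMDiffAt p))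
  · have : Fact (Module.finrank ℝ (TangentSpace (𝓡 (m + 1)) (f p)) = m + 1) := ⟨hdim p⟩
    exact Submodule.finrank_orthogonal_span_singleton (hν.ne_zero p)

end IsUnitNormalOn

theorem IsSubbundleAlong.isSubbundleStructure
    [TopologicalSpace (TotalSpace (EuclideanSpace ℝ (Fin m)) (NormalPerp f ν))]
    [FiberBundle (EuclideanSpace ℝ (Fin m)) (NormalPerp f ν)]
    (hE : IsSubbundleAlong (𝓡 m) (𝓡 (m + 1)) (EuclideanSpace ℝ (Fin (m + 1)))
      (EuclideanSpace ℝ (Fin m)) fun p ↦ (Submodule.span ℝ {ν p})ᗮ) :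
    IsSubbundleStructure f ν := fun _ ξ hU ↦
  ⟨fun h p hp ↦ ((hE.contMDiffAt_iff ξ p).1 (h.contMDiffAt (hU.mem_nhds hp))).contMDiffWithinAt,
    fun h p hp ↦ ((hE.contMDiffAt_iff ξ p).2 (h.contMDiffAt (hU.mem_nhds hp))).contMDiffWithinAt⟩

end UnitNormal

section CoherentTangentBundle

variable {m : ℕ}
  {M : Type*} [TopologicalSpace M] [ChartedSpace (EuclideanSpace ℝ (Fin m)) M]
  [IsManifold (𝓡 m) ∞ M]
  {E' : Type*} [NormedAddCommGroup E'] [NormedSpace ℝ E'] [FiniteDimensional ℝ E']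
  {H' : Type*} [TopologicalSpace H'] {J : ModelWithCorners ℝ E' H'}
  {N : Type*} [TopologicalSpace N] [T2Space N] [ChartedSpace H' N] [IsManifold J ∞ N]
  {F : Type*} [NormedAddCommGroup F] [NormedSpace ℝ F] [FiniteDimensional ℝ F] {V : N → Type*}
  [TopologicalSpace (TotalSpace F V)] [∀ y, NormedAddCommGroup (V y)]
  [∀ y, InnerProductSpace ℝ (V y)] [FiberBundle F V] [VectorBundle ℝ F V]
  [ContMDiffVectorBundle ∞ F V J] [IsContMDiffRiemannianBundle J ∞ F V]
  {cov : CovariantDerivative J F V} {f : M → N}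
  {S : Π p, Submodule ℝ (V (f p))} [∀ p, (S p).HasOrthogonalProjection]
  [TopologicalSpace (TotalSpace (EuclideanSpace ℝ (Fin m)) fun p ↦ S p)]
  [FiberBundle (EuclideanSpace ℝ (Fin m)) fun p ↦ S p]
  [VectorBundle ℝ (EuclideanSpace ℝ (Fin m)) fun p ↦ S p]
  [ContMDiffVectorBundle ∞ (EuclideanSpace ℝ (Fin m)) (fun p ↦ S p) (𝓡 m)]
  [IsContMDiffRiemannianBundle (𝓡 m) ∞ (EuclideanSpace ℝ (Fin m)) fun p ↦ S p]

theorem IsSubbundleAlong.isCoherentTangentBundle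
    (hE : IsSubbundleAlong (𝓡 m) J F (EuclideanSpace ℝ (Fin m)) S)
    (hmetric : cov.IsMetricCompatible) (hcov : cov.ContMDiffCovariantDerivative ∞)
    {θ : Π p, TangentSpace (𝓡 m) p →L[ℝ] S p}
    (hθ : ∀ (X : Π p : M, TangentSpace (𝓡 m) p) (p : M),
      ContMDiffAt (𝓡 m) (𝓡 m).tangent ∞ (T% X) p →
      ContMDiffAlongAt (𝓡 m) J F ∞ f (fun q ↦ (θ q (X q) : V (f q))) p)
    (hcodazzi : ∀ X Y : Π p : M, TangentSpace (𝓡 m) p,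
      IsSmoothVectorField X → IsSmoothVectorField Y → ∀ p,
      covariantDerivativeAlong cov f (fun q ↦ (θ q (Y q) : V (f q))) p (X p) -
        covariantDerivativeAlong cov f (fun q ↦ (θ q (X q) : V (f q))) p (Y p) =
          θ p (mlieBracket (𝓡 m) X Y p)) :
    IsCoherentTangentBundle (hE.inducedConnection cov) θ where
  smooth_connection := hE.contMDiffCovariantDerivative_inducedConnection hcov
  metric := hE.isMetricCompatible_inducedConnection hmetric
  smooth_hom p := hE.contMDiffAt_hom_of_apply fun X hX ↦ hθ X p hX
  codazzi X Y hX hY p := by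
    have h := congrArg (S p).orthogonalProjectionOnto (hcodazzi X Y hX hY p)
    rw [map_sub, Submodule.orthogonalProjectionOnto_mem_subspace_eq_self] at h
    exact sub_eq_zero.2 h

end CoherentTangentBundle

section FrontalBundle

variable {m : ℕ}
  {M : Type*} [TopologicalSpace M] [ChartedSpace (EuclideanSpace ℝ (Fin m)) M]
  {N : Type*} [TopologicalSpace N] [T2Space N]
  [ChartedSpace (EuclideanSpace ℝ (Fin (m + 1))) N] [IsManifold (𝓡 (m + 1)) ∞ N]
  [RiemannianBundle (fun x : N ↦ TangentSpace (𝓡 (m + 1)) x)]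
  [IsContMDiffRiemannianBundle (𝓡 (m + 1)) ∞ (EuclideanSpace ℝ (Fin (m + 1)))
    (fun x : N ↦ TangentSpace (𝓡 (m + 1)) x)]
  {nabla : CovariantDerivative (𝓡 (m + 1)) (EuclideanSpace ℝ (Fin (m + 1)))
    (fun x : N ↦ TangentSpace (𝓡 (m + 1)) x)}
  {f : M → N} {ν : Π p : M, TangentSpace (𝓡 (m + 1)) (f p)} {p : M} {c : ℝ}

theorem HasConstantCurvature.curvatureAlong_eq [IsManifold (𝓡 m) ∞ M]
    (hc : HasConstantCurvature nabla c)
    (hnabla : IsLeviCivita nabla) {ξ : Π q, TangentSpace (𝓡 (m + 1)) (f q)}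
    (hξ : ContMDiffAlongAt (𝓡 m) (𝓡 (m + 1)) (EuclideanSpace ℝ (Fin (m + 1))) ∞ f ξ p)
    {X Y : Π q : M, TangentSpace (𝓡 m) q} (hX : IsSmoothVectorField X)
    (hY : IsSmoothVectorField Y) :
    curvatureAlong nabla f X Y ξ p =
      c • ((inner ℝ (mfderiv (𝓡 m) (𝓡 (m + 1)) f p (Y p) : TangentSpace (𝓡 (m + 1)) (f p))
          (ξ p) : ℝ) • (mfderiv (𝓡 m) (𝓡 (m + 1)) f p (X p) : TangentSpace (𝓡 (m + 1)) (f p)) -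
        (inner ℝ (mfderiv (𝓡 m) (𝓡 (m + 1)) f p (X p) : TangentSpace (𝓡 (m + 1)) (f p))
          (ξ p) : ℝ) • (mfderiv (𝓡 m) (𝓡 (m + 1)) f p (Y p) :
            TangentSpace (𝓡 (m + 1)) (f p))) :=
  _root_.curvatureAlong_eq hnabla.smooth hnabla.torsionFree
    (R := fun _ u w ↦ c • ((innerₛₗ ℝ w).smulRight u - (innerₛₗ ℝ u).smulRight w))
    (fun _ _ _ hU hW hZ y ↦ hc.connectionCurvature_eq hnabla hU hW hZ y) hξ (hX p) (hY p)

variable (hnabla : IsLeviCivita nabla) (hν : IsUnitNormalOn f ν Set.univ)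

include hnabla hν in
theorem IsUnitNormalOn.inner_pullbackDerivative (v : TangentSpace (𝓡 m) p) :
    (inner ℝ (ν p) (pullbackDerivative nabla f ν p v) : ℝ) = 0 := by
  have h : (inner ℝ (pullbackDerivative nabla f ν p v) (ν p) : ℝ) =
      -inner ℝ (ν p) (pullbackDerivative nabla f ν p v) :=
    inner_covariantDerivativeAlong_eq_neg hnabla.metric (hν.mdifferentiableAt p)
      (hν.mdifferentiableAt p) (fun q ↦ hν.unit q (Set.mem_univ q)) v
  rw [real_inner_comm] at h
  linarith

/-- The first homomorphism `φ_f = df : TM → E_f` of a frontal. -/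
def IsUnitNormalOn.firstHom (p : M) : TangentSpace (𝓡 m) p →L[ℝ] NormalPerp f ν p :=
  (mfderiv (𝓡 m) (𝓡 (m + 1)) f p).codRestrict _ fun v ↦
    Submodule.mem_orthogonal_singleton_iff_inner_left.2 (hν.normal p (Set.mem_univ p) v)

/-- The second homomorphism `ψ_f = ∇ν : TM → E_f` of a frontal. -/
def IsUnitNormalOn.secondHom (p : M) : TangentSpace (𝓡 m) p →L[ℝ] NormalPerp f ν p :=
  (pullbackDerivative nabla f ν p).codRestrict _ fun v ↦
    Submodule.mem_orthogonal_singleton_iff_inner_right.2 (hν.inner_pullbackDerivative hnabla v)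

include hnabla hν in
theorem IsUnitNormalOn.inner_mfderiv_pullbackDerivative [IsManifold (𝓡 m) ∞ M]
    (hf : ContMDiff (𝓡 m) (𝓡 (m + 1)) ∞ f)
    {X : Π q : M, TangentSpace (𝓡 m) q} (hX : ContMDiffAt (𝓡 m) (𝓡 m).tangent ∞ (T% X) p)
    (v : TangentSpace (𝓡 m) p) :
    (inner ℝ (mfderiv (𝓡 m) (𝓡 (m + 1)) f p (X p) : TangentSpace (𝓡 (m + 1)) (f p))
      (pullbackDerivative nabla f ν p v) : ℝ) =
    -inner ℝ (covariantDerivativeAlong nabla f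
      (fun q ↦ mfderiv (𝓡 m) (𝓡 (m + 1)) f q (X q)) p v) (ν p) :=
  neg_eq_iff_eq_neg.1 <| .symm <| inner_covariantDerivativeAlong_eq_neg hnabla.metric
    ((contMDiffAt_mfderiv_apply (hf p) hX).mdifferentiableAt (by simp)) (hν.mdifferentiableAt p)
    (fun q ↦ hν.normal q (Set.mem_univ q) (X q)) v

theorem IsUnitNormalOn.inner_covariantDerivativeAlong {ξ : Π q, NormalPerp f ν q}
    (hξ : MDifferentiableAlongAt (𝓡 m) (𝓡 (m + 1)) (EuclideanSpace ℝ (Fin (m + 1))) f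
      (fun q ↦ (ξ q : TangentSpace (𝓡 (m + 1)) (f q))) p) (v : TangentSpace (𝓡 m) p) :
    (inner ℝ (ν p) (covariantDerivativeAlong nabla f
      (fun q ↦ (ξ q : TangentSpace (𝓡 (m + 1)) (f q))) p v) : ℝ) =
      -inner ℝ (hν.secondHom hnabla p v) (ξ p) :=
  neg_eq_iff_eq_neg.1 <| .symm <| inner_covariantDerivativeAlong_eq_neg hnabla.metric
    (hν.mdifferentiableAt p) hξ
    (fun q ↦ Submodule.mem_orthogonal_singleton_iff_inner_right.1 (ξ q).2) v

include hnabla hν in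
theorem IsUnitNormalOn.inner_mfderiv_pullbackDerivative_comm [IsManifold (𝓡 m) ∞ M]
    (hf : ContMDiff (𝓡 m) (𝓡 (m + 1)) ∞ f) (v w : TangentSpace (𝓡 m) p) :
    (inner ℝ (mfderiv (𝓡 m) (𝓡 (m + 1)) f p v : TangentSpace (𝓡 (m + 1)) (f p))
      (pullbackDerivative nabla f ν p w) : ℝ) =
    inner ℝ (mfderiv (𝓡 m) (𝓡 (m + 1)) f p w : TangentSpace (𝓡 (m + 1)) (f p))
      (pullbackDerivative nabla f ν p v) := by
  set X := FiberBundle.extend (EuclideanSpace ℝ (Fin m)) v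
  set Y := FiberBundle.extend (EuclideanSpace ℝ (Fin m)) w
  have hX : ContMDiffAt (𝓡 m) (𝓡 m).tangent ∞ (T% X) p := FiberBundle.contMDiffAt_extend (𝓡 m) _ v
  have hY : ContMDiffAt (𝓡 m) (𝓡 m).tangent ∞ (T% Y) p := FiberBundle.contMDiffAt_extend (𝓡 m) _ w
  have hXp : X p = v := FiberBundle.extend_apply_self _ v
  have hYp : Y p = w := FiberBundle.extend_apply_self _ w
  have htorsion := congrArg (inner ℝ (ν p))
    (covariantDerivativeAlong_mfderiv_sub hnabla.torsionFree (hf p) hX hY)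
  rw [inner_sub_right, real_inner_comm _ (ν p), real_inner_comm _ (ν p), real_inner_comm _ (ν p),
    hν.normal p (Set.mem_univ p), sub_eq_zero] at htorsion
  rw [← hXp, ← hYp, hν.inner_mfderiv_pullbackDerivative hnabla hf hX,
    hν.inner_mfderiv_pullbackDerivative hnabla hf hY, htorsion]

theorem IsUnitNormalOn.inner_starProjection_covariantDerivativeAlong
    {ξ ζ : Π q, NormalPerp f ν q}
    (hξ : MDifferentiableAlongAt (𝓡 m) (𝓡 (m + 1)) (EuclideanSpace ℝ (Fin (m + 1))) f
      (fun q ↦ (ξ q : TangentSpace (𝓡 (m + 1)) (f q))) p)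
    (hζ : MDifferentiableAlongAt (𝓡 m) (𝓡 (m + 1)) (EuclideanSpace ℝ (Fin (m + 1))) f
      (fun q ↦ (ζ q : TangentSpace (𝓡 (m + 1)) (f q))) p) (v w : TangentSpace (𝓡 m) p) :
    (inner ℝ ((Submodule.span ℝ {ν p})ᗮᗮ.starProjection (covariantDerivativeAlong nabla f
        (fun q ↦ (ξ q : TangentSpace (𝓡 (m + 1)) (f q))) p v))
      (covariantDerivativeAlong nabla f
        (fun q ↦ (ζ q : TangentSpace (𝓡 (m + 1)) (f q))) p w) : ℝ) =
      inner ℝ (hν.secondHom hnabla p v) (ξ p) * inner ℝ (hν.secondHom hnabla p w) (ζ p) := by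
  rw [hν.starProjection_orthogonal_normalPerp, real_inner_smul_left,
    hν.inner_covariantDerivativeAlong hnabla hξ, hν.inner_covariantDerivativeAlong hnabla hζ,
    neg_mul_neg]

include hnabla in
theorem IsUnitNormalOn.inner_curvatureAlong [IsManifold (𝓡 m) ∞ M]
    (hc : HasConstantCurvature nabla c) {X Y : Π q : M, TangentSpace (𝓡 m) q}
    (hX : IsSmoothVectorField X) (hY : IsSmoothVectorField Y) {ξ : Π q, NormalPerp f ν q}
    (hξ : ContMDiffAlongAt (𝓡 m) (𝓡 (m + 1)) (EuclideanSpace ℝ (Fin (m + 1))) ∞ f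
      (fun q ↦ (ξ q : TangentSpace (𝓡 (m + 1)) (f q))) p) (w : NormalPerp f ν p) :
    (inner ℝ (curvatureAlong nabla f X Y (fun q ↦ (ξ q : TangentSpace (𝓡 (m + 1)) (f q))) p)
        (w : TangentSpace (𝓡 (m + 1)) (f p)) : ℝ) =
      c * (inner ℝ (hν.firstHom p (Y p)) (ξ p) * inner ℝ (hν.firstHom p (X p)) w -
        inner ℝ (hν.firstHom p (X p)) (ξ p) * inner ℝ (hν.firstHom p (Y p)) w) := by
  rw [hc.curvatureAlong_eq hnabla hξ hX hY, real_inner_smul_left, inner_sub_left,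
    real_inner_smul_left, real_inner_smul_left]
  rfl

variable [IsManifold (𝓡 m) ∞ M]
  [TopologicalSpace (TotalSpace (EuclideanSpace ℝ (Fin m)) (NormalPerp f ν))]
  [FiberBundle (EuclideanSpace ℝ (Fin m)) (NormalPerp f ν)]
  (hE : IsSubbundleAlong (𝓡 m) (𝓡 (m + 1)) (EuclideanSpace ℝ (Fin (m + 1)))
    (EuclideanSpace ℝ (Fin m)) fun p ↦ (Submodule.span ℝ {ν p})ᗮ)

namespace IsSubbundleAlong

theorem gaussEquation (hc : HasConstantCurvature nabla c) :
    GaussEquation c (hE.inducedConnection nabla) hν.firstHom (hν.secondHom hnabla) := by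
  intro X Y ξ ζ hX hY hξ hζ p
  have hξp := (hE.contMDiffAt_iff ξ p).1 (hξ.contMDiffAt univ_mem)
  have hξd := hξp.mdifferentiableAt (by simp)
  have hζd := ((hE.contMDiffAt_iff ζ p).1 (hζ.contMDiffAt univ_mem)).mdifferentiableAt (by simp)
  have hcurv := hν.inner_curvatureAlong hnabla hc hX hY hξp (ζ p)
  have hshape := hν.inner_starProjection_covariantDerivativeAlong hnabla hξd hζd
  refine (hE.inner_connectionCurvature hnabla.metric hnabla.smooth hX hY hξp hζd).trans ?_
  refine (congrArg₂ (· - ·) (congrArg₂ (· + ·) hcurv (hshape (Y p) (X p)))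
    (hshape (X p) (Y p))).trans ?_
  refine Eq.trans ?_ (congrArg₂ (fun a b ↦ c * a + b) (Matrix.det_fin_two_of _ _ _ _)
    (Matrix.det_fin_two_of _ _ _ _)).symm
  ring

variable [VectorBundle ℝ (EuclideanSpace ℝ (Fin m)) (NormalPerp f ν)]
  [ContMDiffVectorBundle ∞ (EuclideanSpace ℝ (Fin m)) (NormalPerp f ν) (𝓡 m)]
  [IsContMDiffRiemannianBundle (𝓡 m) ∞ (EuclideanSpace ℝ (Fin m)) (NormalPerp f ν)]

theorem isFrontalBundle (hc : HasConstantCurvature nabla c)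
    (hf : ContMDiff (𝓡 m) (𝓡 (m + 1)) ∞ f) :
    IsFrontalBundle (hE.inducedConnection nabla) hν.firstHom (hν.secondHom hnabla) where
  coherent_fst := hE.isCoherentTangentBundle hnabla.metric hnabla.smooth
    (fun _ p hX ↦ contMDiffAt_mfderiv_apply (hf p) hX) fun _ _ hX hY p ↦
      covariantDerivativeAlong_mfderiv_sub hnabla.torsionFree (hf p) (hX p) (hY p)
  coherent_snd := hE.isCoherentTangentBundle hnabla.metric hnabla.smooth
    (fun _ p hX ↦ contMDiffAt_covariantDerivativeAlong hnabla.smooth (hν.contMDiffAt p) hX)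
    fun _ _ hX hY p ↦ by
      have h := hc.curvatureAlong_eq hnabla (hν.contMDiffAt p) hX hY
      rw [hν.normal p (Set.mem_univ p), hν.normal p (Set.mem_univ p), zero_smul, zero_smul,
        sub_zero, smul_zero] at h
      exact sub_eq_zero.1 h
  compatible _ v w := hν.inner_mfderiv_pullbackDerivative_comm hnabla hf v w

end IsSubbundleAlong

end FrontalBundle

section Orientation

theorem contMDiffAt_multilinear_along
    {E : Type*} [NormedAddCommGroup E] [NormedSpace ℝ E]
    {H : Type*} [TopologicalSpace H] {I : ModelWithCorners ℝ E H}
    {M : Type*} [TopologicalSpace M] [ChartedSpace H M]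
    {E' : Type*} [NormedAddCommGroup E'] [NormedSpace ℝ E']
    {H' : Type*} [TopologicalSpace H'] {J : ModelWithCorners ℝ E' H'}
    {N : Type*} [TopologicalSpace N] [ChartedSpace H' N]
    {F : Type*} [NormedAddCommGroup F] [NormedSpace ℝ F] [FiniteDimensional ℝ F] {V : N → Type*}
    [TopologicalSpace (TotalSpace F V)] [∀ y, AddCommGroup (V y)] [∀ y, Module ℝ (V y)]
    [∀ y, TopologicalSpace (V y)] [FiberBundle F V] [VectorBundle ℝ F V] {k : ℕ∞ω}
    [ContMDiffVectorBundle k F V J] {ι : Type*} [Finite ι]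
    {μ : Π y : N, MultilinearMap ℝ (fun _ : ι ↦ V y) ℝ}
    (hμ : ∀ (U : Set N) (s : ι → Π y, V y), IsOpen U → (∀ i, CMDiff[U] k (T% (s i))) →
      CMDiff[U] k fun y ↦ μ y fun i ↦ s i y)
    {f : M → N} {p : M} (hf : ContMDiffAt I J k f p) {ξ : ι → Π q, V (f q)}
    (hξ : ∀ i, ContMDiffAlongAt I J F k f (ξ i) p) :
    CMDiffAt k (fun q ↦ μ (f q) fun i ↦ ξ i q) p := by
  classical
  cases nonempty_fintype ι
  set t := trivializationAt F V (f p)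
  let b := Module.finBasis ℝ F
  have hframe (r : ι → Fin (Module.finrank ℝ F)) :
      ContMDiffAt J 𝓘(ℝ) k (fun y ↦ μ y fun i ↦ t.localFrame b (r i) y) (f p) :=
    (hμ t.baseSet _ t.open_baseSet fun i ↦
      t.contMDiffOn_localFrame_baseSet k b (r i)).contMDiffAt
        (t.open_baseSet.mem_nhds (FiberBundle.mem_baseSet_trivializationAt' (f p)))
  have hcoord (i : ι) (j : Fin (Module.finrank ℝ F)) :
      CMDiffAt k (fun q ↦ b.repr (t ⟨f q, ξ i q⟩).2 j) p :=
    (LinearMap.toContinuousLinearMap (b.coord j)).contMDiff.contMDiffAt.comp p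
      (hξ i).trivializationAt_snd
  have hsum : CMDiffAt k (fun q ↦ ∑ r : ι → Fin (Module.finrank ℝ F),
      (∏ i, b.repr (t ⟨f q, ξ i q⟩).2 (r i)) *
        μ (f q) fun i ↦ t.localFrame b (r i) (f q)) p :=
    ContMDiffAt.sum fun r _ ↦
      (contMDiffAt_finsetProd fun i _ ↦ hcoord i (r i)).mul ((hframe r).comp p hf)
  refine hsum.congr_of_eventuallyEq ?_
  filter_upwards [eventually_all.2 fun i ↦
    eventually_eq_sum_localFrame (ξ := ξ i) b hf.continuousAt] with q hq
  rw [funext hq, MultilinearMap.map_sum]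
  simp only [MultilinearMap.map_smul_univ, smul_eq_mul]
  rfl

theorem IsSubbundleAlong.isOrientableBundle {m : ℕ}
    {M : Type*} [TopologicalSpace M] [ChartedSpace (EuclideanSpace ℝ (Fin m)) M]
    {N : Type*} [TopologicalSpace N] [ChartedSpace (EuclideanSpace ℝ (Fin (m + 1))) N]
    [IsManifold (𝓡 (m + 1)) ∞ N] [RiemannianBundle (fun x : N ↦ TangentSpace (𝓡 (m + 1)) x)]
    {f : M → N} {ν : Π p : M, TangentSpace (𝓡 (m + 1)) (f p)}
    [TopologicalSpace (TotalSpace (EuclideanSpace ℝ (Fin m)) (NormalPerp f ν))]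
    [FiberBundle (EuclideanSpace ℝ (Fin m)) (NormalPerp f ν)]
    (hE : IsSubbundleAlong (𝓡 m) (𝓡 (m + 1)) (EuclideanSpace ℝ (Fin (m + 1)))
      (EuclideanSpace ℝ (Fin m)) fun p ↦ (Submodule.span ℝ {ν p})ᗮ)
    (hf : ContMDiff (𝓡 m) (𝓡 (m + 1)) ∞ f) (hν : IsUnitNormalOn f ν Set.univ)
    (hN : IsOrientableBundle (m + 1) (m + 1) (fun x : N ↦ TangentSpace (𝓡 (m + 1)) x)) :
    IsOrientableBundle m m (NormalPerp f ν) := by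
  obtain ⟨μ, hμ, hμ_frame⟩ := hN
  refine ⟨fun p ↦ ((μ (f p)).curryLeft (ν p)).compLinearMap (Submodule.subtype _),
    fun U s hU hs p hp ↦ ContMDiffAt.contMDiffWithinAt ?_, fun p e he ↦ hμ_frame (f p) _ ?_⟩
  · let ξ : Fin (m + 1) → Π q : M, TangentSpace (𝓡 (m + 1)) (f q) :=
      Fin.cons ν fun i q ↦ (s i q : TangentSpace (𝓡 (m + 1)) (f q))
    have hξ (i : Fin (m + 1)) : ContMDiffAlongAt (𝓡 m) (𝓡 (m + 1))
        (EuclideanSpace ℝ (Fin (m + 1))) ∞ f (ξ i) p :=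
      i.cases (hν.contMDiffAt p) fun i ↦
        (hE.contMDiffAt_iff (s i) p).1 ((hs i).contMDiffAt (hU.mem_nhds hp))
    refine (contMDiffAt_multilinear_along (μ := fun y ↦ (μ y).toMultilinearMap) hμ (hf p)
      hξ).congr_of_eventuallyEq (.of_forall fun q ↦ ?_)
    exact congrArg (μ (f q)) (funext fun i ↦ i.cases rfl fun _ ↦ rfl)
  · exact orthonormal_vecCons_iff.2 ⟨hν.norm_eq_one (Set.mem_univ _),
      fun i ↦ Submodule.mem_orthogonal_singleton_iff_inner_right.1 (e i).2,
      he.comp_linearIsometry (Submodule.subtypeₗᵢ _)⟩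

end Orientation

section DerivativeOfSections

variable {E : Type*} [NormedAddCommGroup E] [NormedSpace ℝ E]
  {H : Type*} [TopologicalSpace H] {I : ModelWithCorners ℝ E H}
  {M : Type*} [TopologicalSpace M] [ChartedSpace H M]
  {E' : Type*} [NormedAddCommGroup E'] [NormedSpace ℝ E']
  {H' : Type*} [TopologicalSpace H'] {J : ModelWithCorners ℝ E' H'}
  {N : Type*} [TopologicalSpace N] [ChartedSpace H' N] {p : M}

theorem mfderiv_comp_eq_zero_iff {E'' : Type*} [NormedAddCommGroup E''] [NormedSpace ℝ E'']
    {H'' : Type*} [TopologicalSpace H''] {K : ModelWithCorners ℝ E'' H''}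
    {P : Type*} [TopologicalSpace P] [ChartedSpace H'' P] {f : M → N} {g : N → P} {h : P → N}
    (hf : MDifferentiableAt I J f p) (hg : MDifferentiableAt J K g (f p))
    (hh : MDifferentiableAt K J h (g (f p))) (hgh : ∀ᶠ y in 𝓝 (f p), h (g y) = y)
    (v : TangentSpace I p) :
    mfderiv I K (g ∘ f) p v = 0 ↔ mfderiv I J f p v = 0 := by
  have hfac : f =ᶠ[𝓝 p] h ∘ g ∘ f := by
    filter_upwards [hf.continuousAt.eventually hgh] with q hq using hq.symm
  constructor <;> intro hv
  · rw [hfac.mfderiv_eq, mfderiv_comp p hh (hg.comp p hf)]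
    exact (congrArg (mfderiv K J h (g (f p))) hv).trans (map_zero _)
  · rw [mfderiv_comp_apply p hg hf, hv, map_zero]

variable {F : Type*} [NormedAddCommGroup F] [NormedSpace ℝ F] {V : N → Type*}
  [TopologicalSpace (TotalSpace F V)] [∀ y, AddCommGroup (V y)] [∀ y, Module ℝ (V y)]
  [∀ y, TopologicalSpace (V y)] [FiberBundle F V] [VectorBundle ℝ F V]
  [ContMDiffVectorBundle 1 F V J] {f : M → N} {ξ : Π q, V (f q)}

theorem mfderiv_totalSpace_eq_zero_iff
    (hξ : MDifferentiableAlongAt I J F f ξ p) (v : TangentSpace I p) :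
    mfderiv I (J.prod 𝓘(ℝ, F)) (fun q ↦ TotalSpace.mk' F (f q) (ξ q)) p v = 0 ↔
      mfderiv I J f p v = 0 ∧
        mvfderiv I (fun q ↦ (trivializationAt F V (f p) ⟨f q, ξ q⟩).2) p v = 0 := by
  set t := trivializationAt F V (f p)
  have hsource : (⟨f p, ξ p⟩ : TotalSpace F V) ∈ t.source :=
    t.mem_source.2 (FiberBundle.mem_baseSet_trivializationAt' (f p))
  have ht : MDifferentiableAt (J.prod 𝓘(ℝ, F)) (J.prod 𝓘(ℝ, F)) t ⟨f p, ξ p⟩ :=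
    (t.contMDiffOn.contMDiffAt (t.open_source.mem_nhds hsource)).mdifferentiableAt one_ne_zero
  have ht_symm : MDifferentiableAt (J.prod 𝓘(ℝ, F)) (J.prod 𝓘(ℝ, F))
      t.toOpenPartialHomeomorph.symm (t ⟨f p, ξ p⟩) :=
    (t.contMDiffOn_symm.contMDiffAt
      (t.open_target.mem_nhds (t.map_source hsource))).mdifferentiableAt one_ne_zero
  have hinv : ∀ᶠ z in 𝓝 (⟨f p, ξ p⟩ : TotalSpace F V),
      t.toOpenPartialHomeomorph.symm (t z) = z := by
    filter_upwards [t.open_source.mem_nhds hsource] with z hz using t.left_inv hz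
  have hprod : (t ∘ fun q ↦ TotalSpace.mk' F (f q) (ξ q)) =ᶠ[𝓝 p]
      fun q ↦ (f q, (t ⟨f q, ξ q⟩).2) := by
    filter_upwards [hξ.continuousAt.eventually (t.open_source.mem_nhds hsource)] with q hq
    exact (t.mk_proj_snd hq).symm
  rw [← mfderiv_comp_eq_zero_iff hξ ht ht_symm hinv v, hprod.mfderiv_eq,
    mfderiv_prodMk hξ.map hξ.trivializationAt_snd]
  exact Prod.mk_eq_zero

variable [∀ y, IsTopologicalAddGroup (V y)] [∀ y, ContinuousSMul ℝ (V y)]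
  (cov : CovariantDerivative J F V)

theorem mfderiv_totalSpace_eq_zero_iff_covariantDerivativeAlong
    (hξ : MDifferentiableAlongAt I J F f ξ p) (v : TangentSpace I p) :
    mfderiv I (J.prod 𝓘(ℝ, F)) (fun q ↦ TotalSpace.mk' F (f q) (ξ q)) p v = 0 ↔
      mfderiv I J f p v = 0 ∧ covariantDerivativeAlong cov f ξ p v = 0 := by
  refine (mfderiv_totalSpace_eq_zero_iff hξ v).trans (and_congr_right fun hv ↦ ?_)
  have hp := FiberBundle.mem_baseSet_trivializationAt' (F := F) (E := V) (f p)
  simp only [covariantDerivativeAlong, _root_.add_apply, ContinuousLinearMap.comp_apply, hv,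
    map_zero, add_zero]
  exact (map_eq_zero_iff _ (Function.LeftInverse.injective
    ((trivializationAt F V (f p)).continuousLinearMapAt_symmL hp))).symm

theorem injective_mfderiv_totalSpace_iff (hξ : MDifferentiableAlongAt I J F f ξ p) :
    Function.Injective (mfderiv I (J.prod 𝓘(ℝ, F)) (fun q ↦ TotalSpace.mk' F (f q) (ξ q)) p) ↔
      ∀ v : TangentSpace I p, mfderiv I J f p v = 0 →
        covariantDerivativeAlong cov f ξ p v = 0 → v = 0 := by
  rw [injective_iff_map_eq_zero]
  exact forall_congr' fun v ↦ by
    rw [mfderiv_totalSpace_eq_zero_iff_covariantDerivativeAlong cov hξ v, and_imp]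

end DerivativeOfSections

section InnerProductSpace

variable {E : Type*} [NormedAddCommGroup E] [InnerProductSpace ℝ E] {v w : E}

theorem eq_inner_smul_of_inner_sq_eq_one (hv : ‖v‖ = 1) (hw : ‖w‖ = 1)
    (h : (inner ℝ v w : ℝ) ^ 2 = 1) : w = (inner ℝ v w : ℝ) • v := by
  rw [← sub_eq_zero, ← norm_eq_zero, ← sq_eq_zero_iff, norm_sub_sq_real, norm_smul, hv, hw,
    real_inner_smul_right, real_inner_comm, mul_one, Real.norm_eq_abs, sq_abs]
  linarith [real_inner_comm v w ▸ h]

theorem inner_sq_eq_one_of_mem_orthogonal [FiniteDimensional ℝ E] {K : Submodule ℝ E}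
    (hK : Module.finrank ℝ K + 1 = Module.finrank ℝ E) (hv : v ∈ Kᗮ) (hw : w ∈ Kᗮ)
    (hv_norm : ‖v‖ = 1) (hw_norm : ‖w‖ = 1) : (inner ℝ v w : ℝ) ^ 2 = 1 := by
  have hK_orthogonal : Module.finrank ℝ Kᗮ = 1 := by
    have := K.finrank_add_finrank_orthogonal
    lia
  have hv_ne : (⟨v, hv⟩ : Kᗮ) ≠ 0 :=
    Subtype.coe_ne_coe.1 (norm_ne_zero_iff.1 (hv_norm.trans_ne one_ne_zero))
  obtain ⟨a, ha⟩ := (finrank_eq_one_iff_of_nonzero' _ hv_ne).1 hK_orthogonal ⟨w, hw⟩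
  obtain rfl : a • v = w := congrArg Subtype.val ha
  rw [real_inner_smul_right, real_inner_self_eq_norm_sq, hv_norm, one_pow, mul_one, ← sq_abs]
  rw [norm_smul, hv_norm, mul_one, Real.norm_eq_abs] at hw_norm
  rw [hw_norm, one_pow]

end InnerProductSpace

theorem eventually_eq_of_sq_eq_one {X : Type*} [TopologicalSpace X] {a : X → ℝ} {p : X}
    (ha : ContinuousAt a p) (ha_sq : ∀ᶠ q in 𝓝 p, a q ^ 2 = 1) : ∀ᶠ q in 𝓝 p, a q = a p := by
  have hp : a p ^ 2 = 1 := ha_sq.self_of_nhds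
  have hp_ne : a p ≠ -a p := self_ne_neg.2 (sq_eq_zero_iff.not.1 (hp.trans_ne one_ne_zero))
  filter_upwards [ha_sq, ha.eventually_ne hp_ne] with q hq hq_ne
  exact (sq_eq_sq_iff_eq_or_eq_neg.1 (hq.trans hp.symm)).resolve_right hq_ne

section Fronts

variable {m : ℕ}
  {M : Type*} [TopologicalSpace M] [ChartedSpace (EuclideanSpace ℝ (Fin m)) M]
  {N : Type*} [TopologicalSpace N] [ChartedSpace (EuclideanSpace ℝ (Fin (m + 1))) N]
  [IsManifold (𝓡 (m + 1)) ∞ N] [RiemannianBundle (fun x : N ↦ TangentSpace (𝓡 (m + 1)) x)]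
  {f : M → N} {ν ξ : Π p : M, TangentSpace (𝓡 (m + 1)) (f p)} {U : Set M} {p : M}

namespace IsUnitNormalOn

theorem mono {U' : Set M} (hν : IsUnitNormalOn f ν U) (hU' : U' ⊆ U) :
    IsUnitNormalOn f ν U' where
  smooth := hν.smooth.mono hU'
  unit p hp := hν.unit p (hU' hp)
  normal p hp := hν.normal p (hU' hp)

theorem inner_sq_eq_one_of_injective (hν : IsUnitNormalOn f ν U) (hξ : IsUnitNormalOn f ξ U)
    (hp : p ∈ U) (hinj : Function.Injective (mfderiv (𝓡 m) (𝓡 (m + 1)) f p)) :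
    (inner ℝ (ν p) (ξ p) : ℝ) ^ 2 = 1 := by
  have hdim : Module.finrank ℝ (TangentSpace (𝓡 (m + 1)) (f p)) = m + 1 :=
    finrank_euclideanSpace_fin
  have : FiniteDimensional ℝ (TangentSpace (𝓡 (m + 1)) (f p)) := .of_finrank_eq_succ hdim
  have hrange : Module.finrank ℝ (mfderiv (𝓡 m) (𝓡 (m + 1)) f p).toLinearMap.range = m :=
    (LinearMap.finrank_range_of_inj hinj).trans finrank_euclideanSpace_fin
  have hmem {η : Π p : M, TangentSpace (𝓡 (m + 1)) (f p)} (hη : IsUnitNormalOn f η U) :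
      η p ∈ (mfderiv (𝓡 m) (𝓡 (m + 1)) f p).toLinearMap.rangeᗮ := by
    rintro _ ⟨v, rfl⟩
    exact hη.normal p hp v
  exact inner_sq_eq_one_of_mem_orthogonal ((congrArg (· + 1) hrange).trans hdim.symm)
    (hmem hν) (hmem hξ) (hν.norm_eq_one hp) (hξ.norm_eq_one hp)

variable [IsContMDiffRiemannianBundle (𝓡 (m + 1)) ∞ (EuclideanSpace ℝ (Fin (m + 1)))
    (fun x : N ↦ TangentSpace (𝓡 (m + 1)) x)]

theorem continuousOn_inner (hν : IsUnitNormalOn f ν U) (hξ : IsUnitNormalOn f ξ U) :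
    ContinuousOn (fun q ↦ (inner ℝ (ν q) (ξ q) : ℝ)) U :=
  (ContMDiffOn.inner_bundle hν.smooth hξ.smooth).continuousOn

theorem inner_sq_eq_one_of_dense (hν : IsUnitNormalOn f ν U) (hξ : IsUnitNormalOn f ξ U)
    (hU : IsOpen U)
    (hdense : Dense {p : M | Function.Injective (mfderiv (𝓡 m) (𝓡 (m + 1)) f p)}) (hp : p ∈ U) :
    (inner ℝ (ν p) (ξ p) : ℝ) ^ 2 = 1 := by
  by_contra h
  obtain ⟨q, ⟨hqU, hq⟩, hinj⟩ := hdense.inter_open_nonempty _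
    (((hν.continuousOn_inner hξ).pow 2).isOpen_inter_preimage hU isOpen_ne) ⟨p, hp, h⟩
  exact hq (hν.inner_sq_eq_one_of_injective hξ hqU hinj)

theorem eventually_eq_inner_smul_of_dense (hν : IsUnitNormalOn f ν U)
    (hξ : IsUnitNormalOn f ξ U) (hU : IsOpen U)
    (hdense : Dense {p : M | Function.Injective (mfderiv (𝓡 m) (𝓡 (m + 1)) f p)}) (hp : p ∈ U) :
    ∀ᶠ q in 𝓝 p, ξ q = (inner ℝ (ν p) (ξ p) : ℝ) • ν q := by
  have hsq {q : M} (hq : q ∈ U) := hν.inner_sq_eq_one_of_dense hξ hU hdense hq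
  have hconst := eventually_eq_of_sq_eq_one
    ((hν.continuousOn_inner hξ).continuousAt (hU.mem_nhds hp))
    (eventually_of_mem (hU.mem_nhds hp) fun q hq ↦ hsq hq)
  filter_upwards [hU.mem_nhds hp, hconst] with q hq hq_const
  exact (eq_inner_smul_of_inner_sq_eq_one (hν.norm_eq_one hq) (hξ.norm_eq_one hq)
    (hsq hq)).trans (congrArg (· • ν q) hq_const)

theorem isImmersiveOn_iff_isFront (hν : IsUnitNormalOn f ν Set.univ)
    (nabla : CovariantDerivative (𝓡 (m + 1)) (EuclideanSpace ℝ (Fin (m + 1)))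
      (fun x : N ↦ TangentSpace (𝓡 (m + 1)) x))
    (hf : ContMDiff (𝓡 m) (𝓡 (m + 1)) ∞ f)
    (hdense : Dense {p : M | Function.Injective (mfderiv (𝓡 m) (𝓡 (m + 1)) f p)}) :
    IsImmersiveOn f ν Set.univ ↔ IsFront m f := by
  refine ⟨fun h ↦ ⟨hf, fun p ↦ ⟨Set.univ, isOpen_univ, Set.mem_univ p, ν, hν, h⟩⟩, ?_⟩
  rintro ⟨-, h⟩ p -
  obtain ⟨U, hU, hp, ξ, hξ, hξ_immersive⟩ := h p
  have hξp : MDifferentiableAlongAt (𝓡 m) (𝓡 (m + 1)) (EuclideanSpace ℝ (Fin (m + 1))) f ξ p :=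
    (hξ.smooth.contMDiffAt (hU.mem_nhds hp)).mdifferentiableAt (by simp)
  have hνp := hν.mdifferentiableAt p
  have heq := (hν.mono (Set.subset_univ U)).eventually_eq_inner_smul_of_dense hξ hU hdense hp
  have hderiv : covariantDerivativeAlong (I := 𝓡 m) nabla f ξ p =
      (inner ℝ (ν p) (ξ p) : ℝ) • covariantDerivativeAlong nabla f ν p := by
    rw [covariantDerivativeAlong_congr nabla heq,
      covariantDerivativeAlong_smul nabla mdifferentiableAt_const hνp, mvfderiv_const]
    ext v
    simp
  refine (injective_mfderiv_totalSpace_iff nabla hνp).2 fun v hfv hνv ↦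
    (injective_mfderiv_totalSpace_iff nabla hξp).1 (hξ_immersive p hp) v hfv ?_
  rw [hderiv, _root_.smul_apply, hνv, smul_zero]

end IsUnitNormalOn

variable [T2Space N] [IsManifold (𝓡 m) ∞ M]
  [IsContMDiffRiemannianBundle (𝓡 (m + 1)) ∞ (EuclideanSpace ℝ (Fin (m + 1)))
    (fun x : N ↦ TangentSpace (𝓡 (m + 1)) x)]
  {nabla : CovariantDerivative (𝓡 (m + 1)) (EuclideanSpace ℝ (Fin (m + 1)))
    (fun x : N ↦ TangentSpace (𝓡 (m + 1)) x)}
  [TopologicalSpace (TotalSpace (EuclideanSpace ℝ (Fin m)) (NormalPerp f ν))]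
  [FiberBundle (EuclideanSpace ℝ (Fin m)) (NormalPerp f ν)]
  [VectorBundle ℝ (EuclideanSpace ℝ (Fin m)) (NormalPerp f ν)]
  [ContMDiffVectorBundle ∞ (EuclideanSpace ℝ (Fin m)) (NormalPerp f ν) (𝓡 m)]
  [IsContMDiffRiemannianBundle (𝓡 m) ∞ (EuclideanSpace ℝ (Fin m)) (NormalPerp f ν)]
  {D : CovariantDerivative (𝓡 m) (EuclideanSpace ℝ (Fin m)) (NormalPerp f ν)}

theorem IsUnitNormalOn.isFrontBundle_iff_isImmersiveOn (hν : IsUnitNormalOn f ν Set.univ)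
    (hnabla : IsLeviCivita nabla)
    (hD : IsFrontalBundle D hν.firstHom (hν.secondHom hnabla)) :
    IsFrontBundle D hν.firstHom (hν.secondHom hnabla) ↔ IsImmersiveOn f ν Set.univ := by
  have hker (p : M) : LinearMap.ker (hν.firstHom p).toLinearMap ⊓
      LinearMap.ker (hν.secondHom hnabla p).toLinearMap = ⊥ ↔
      Function.Injective (mfderiv (𝓡 m) (𝓡 (m + 1)).tangent (alongMap f ν) p) := by
    rw [Submodule.eq_bot_iff]
    refine (forall_congr' fun v ↦ ?_).trans
      (injective_mfderiv_totalSpace_iff nabla (hν.mdifferentiableAt p)).symm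
    rw [Submodule.mem_inf, and_imp]
    exact imp_congr Subtype.ext_iff (imp_congr Subtype.ext_iff Iff.rfl)
  exact ⟨fun h p _ ↦ (hker p).1 (h.ker_inter p),
    fun h ↦ ⟨hD, fun p ↦ (hker p).2 (h p (Set.mem_univ p))⟩⟩

end Fronts

end

theorem proposition2 {m : ℕ}
    {M : Type*} [TopologicalSpace M] [T2Space M] [ChartedSpace (EuclideanSpace ℝ (Fin m)) M]
    [IsManifold (𝓡 m) ∞ M]
    {N : Type*} [TopologicalSpace N] [T2Space N]
    [ChartedSpace (EuclideanSpace ℝ (Fin (m + 1))) N] [IsManifold (𝓡 (m + 1)) ∞ N]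
    [RiemannianBundle (fun x : N ↦ TangentSpace (𝓡 (m + 1)) x)]
    [IsContMDiffRiemannianBundle (𝓡 (m + 1)) ∞ (EuclideanSpace ℝ (Fin (m + 1)))
      (fun x : N ↦ TangentSpace (𝓡 (m + 1)) x)]
    (nabla : CovariantDerivative (𝓡 (m + 1)) (EuclideanSpace ℝ (Fin (m + 1)))
      (fun x : N ↦ TangentSpace (𝓡 (m + 1)) x))
    (hnabla : IsLeviCivita nabla) (c : ℝ) (hc : HasConstantCurvature nabla c)
    (f : M → N) (hf : ContMDiff (𝓡 m) (𝓡 (m + 1)) ∞ f)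
    (ν : Π p : M, TangentSpace (𝓡 (m + 1)) (f p)) (hν : IsUnitNormalOn f ν Set.univ) :
    ∃ (_ : TopologicalSpace (TotalSpace (EuclideanSpace ℝ (Fin m)) (NormalPerp f ν)))
      (_ : FiberBundle (EuclideanSpace ℝ (Fin m)) (NormalPerp f ν))
      (_ : VectorBundle ℝ (EuclideanSpace ℝ (Fin m)) (NormalPerp f ν))
      (_ : ContMDiffVectorBundle ∞ (EuclideanSpace ℝ (Fin m)) (NormalPerp f ν) (𝓡 m))
      (_ : IsContMDiffRiemannianBundle (𝓡 m) ∞ (EuclideanSpace ℝ (Fin m)) (NormalPerp f ν))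
      (D : CovariantDerivative (𝓡 m) (EuclideanSpace ℝ (Fin m)) (NormalPerp f ν))
      (φ ψ : Π p : M, TangentSpace (𝓡 m) p →L[ℝ] NormalPerp f ν p),
      IsSubbundleStructure f ν ∧
      (∀ ξ p, D ξ p = inducedDerivative nabla f ν ξ p) ∧
      (∀ p v, (φ p v : TangentSpace (𝓡 (m + 1)) (f p)) = mfderiv (𝓡 m) (𝓡 (m + 1)) f p v) ∧
      (∀ p v, (ψ p v : TangentSpace (𝓡 (m + 1)) (f p)) = pullbackDerivative nabla f ν p v) ∧
      IsFrontalBundle D φ ψ ∧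
      (IsOrientableBundle (m + 1) (m + 1) (fun x : N ↦ TangentSpace (𝓡 (m + 1)) x) →
        IsOrientableBundle m m (NormalPerp f ν)) ∧
      GaussEquation c D φ ψ ∧
      (IsFrontBundle D φ ψ ↔ IsImmersiveOn f ν Set.univ) ∧
      (Dense {p : M | Function.Injective (mfderiv (𝓡 m) (𝓡 (m + 1)) f p)} →
        (IsFrontBundle D φ ψ ↔ IsFront m f)) := by
  obtain ⟨_, _, _, _, _, hE⟩ := hν.exists_isSubbundleAlong hf
  have hfrontal := hE.isFrontalBundle hnabla hν hc hf
  have hfront := hν.isFrontBundle_iff_isImmersiveOn hnabla hfrontal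
  exact ⟨_, _, _, _, _, hE.inducedConnection nabla, hν.firstHom, hν.secondHom hnabla,
    hE.isSubbundleStructure, fun _ _ ↦ rfl, fun _ _ ↦ rfl, fun _ _ ↦ rfl, hfrontal,
    hE.isOrientableBundle hf hν, hE.gaussEquation hnabla hν hc, hfront,
    fun hdense ↦ hfront.trans (hν.isImmersiveOn_iff_isFront nabla hf hdense)⟩
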